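/- Conventions. Logarithms are natural (another base multiplies all quantities below by the same positive constant). For probability mass functions (PMFs) $P,Q$ on a finite set, $D(P\|Q)=\sum_x P(x)\log\frac{P(x)}{Q(x)}$ with $0\log\frac0q=0$ and $p\log\frac p0=\infty$ for $p>0$; for $\alpha>0$, $\alpha\neq1$, $D_\alpha(P\|Q)=\frac1{\alpha-1}\log\sum_x P(x)^\alpha Q(x)^{1-\alpha}$, where for $\alpha>1$ the summand is read as $P(x)^\alpha/Q(x)^{\alpha-1}$ with $\frac00=0$ and $\frac p0=\infty$ for $p>0$; and $D_1=D$. For random variables $X,Y$ on finite sets $\mathcal X,\mathcal Y$ with joint PMF $P_{XY}$ and for $\alpha>0$, let $J_\alpha(X;Y)=\min_{Q_X,Q_Y}D_\alpha(P_{XY}\|Q_XQ_Y)$, where $Q_X$ and $Q_Y$ range over all PMFs on $\mathcal X$ and $\mathcal Y$. For a joint PMF $R_{XY}$ with marginals $R_X,R_Y$ let $I_{R_{XY}}(X;Y)=D(R_{XY}\|R_XR_Y)$, and let $I(X;Y)=I_{P_{XY}}(X;Y)$. Let $H_\beta(X)=\frac1{1-\beta}\log\sum_xP_X(x)^\beta$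 for $\beta>0$, $\beta\ne1$, $H_1(X)=\sum_xP_X(x)\log\frac1{P_X(x)}$, and $H_\infty(X)=-\log\max_xP_X(x)$. Theorem. Let $X,X_1,X_2,Y,Y_1,Y_2,Z$ be random variables on finite sets, defined on a common probability space. For all $\alpha>0$ the minimum defining $J_\alpha(X;Y)$ is attained, and: 1. $J_\alpha(X;Y)\ge0$, with equality if and only if $X$ and $Y$ are independent. 2. $J_\alpha(X;Y)=J_\alpha(Y;X)$. 3. $J_\alpha(X;Z)\le J_\alpha(X;Y)$ if $X,Y,Z$ form a Markov chain (in this order). 4. $J_\alpha(X_1,X_2;Y_1,Y_2)=J_\alpha(X_1;Y_1)+J_\alpha(X_2;Y_2)$ if the pairs $(X_1,Y_1)$ and $(X_2,Y_2)$ are independent. 5. $J_\alpha(X;Y)\le\log|\mathcal X|$ and $J_\alpha(X;Y)\le\log|\mathcal Y|$. 6. $J_1(X;Y)=I(X;Y)$. 7. $\alpha\mapsto J_\alpha(X;Y)$ is continuous and nondecreasing on $(0,\infty)$. 8. For $\alpha>0$, $\alpha\ne1$, $$J_\alpha(X;Y)=\min_{Q_X}\frac{\alpha}{\alpha-1}\log\sum_{y\in\mathcal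 Y}\Big[\sum_{x\in\mathcal X}P_{XY}(x,y)^\alpha Q_X(x)^{1-\alpha}\Big]^{1/\alpha},$$ where the minimum is over all PMFs $Q_X$ on $\mathcal X$ (with the conventions above). If moreover $\alpha\ge\frac12$, the objective is a convex function of $Q_X$, with values in $(-\infty,\infty]$. 9. For $\alpha\in(0,1)$, $J_\alpha(X;Y)=\min_{R_{XY}}\big[I_{R_{XY}}(X;Y)+\frac{\alpha}{1-\alpha}D(R_{XY}\|P_{XY})\big]$, over all joint PMFs $R_{XY}$ on $\mathcal X\times\mathcal Y$. 10. For $\alpha>1$, $J_\alpha(X;Y)=\max_{R_{XY}}\big[I_{R_{XY}}(X;Y)+\frac{\alpha}{1-\alpha}D(R_{XY}\|P_{XY})\big]$, over all joint PMFs $R_{XY}$. The expression in brackets, with values in $[-\infty,\infty)$, is concave in $R_{XY}$, and strictly concave on the set where it is finite. A joint PMF $R_{XY}$ maximizes it if and only if its value at $R_{XY}$ equals $D_\alpha(P_{XY}\|R_XR_Y)$. 11. For $\alpha\ge1$ and a fixed conditional PMF $P_{Y|X}$, $J_\alpha(X;Y)$ is concave in $P_X$. 12. $J_\alpha(X;X)=H_{\frac{\alpha}{2\alpha-1}}(X)$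 if $\alpha>\frac12$, and $J_\alpha(X;X)=\frac{\alpha}{1-\alpha}H_\infty(X)$ if $\alpha\in(0,\frac12]$. -/

import Mathlib

open MeasureTheory ProbabilityTheory

namespace RenyiDep

/-! Probability mass functions on a finite set `ι` are the elements of `stdSimplex ℝ ι`.
Logarithms are natural. -/

noncomputable section

/-- The probability mass function of a random variable `X`, that is `x ↦ P(X = x)`. -/
def pmf {Ω ι : Type*} [MeasurableSpace Ω] (μ : Measure Ω) (X : Ω → ι) : ι → ℝ :=
  fun x => μ.real (X ⁻¹' {x})

/-- The joint probability mass function of a pair of random variables. -/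
def jointPmf {Ω 𝒳 𝒴 : Type*} [MeasurableSpace Ω] (μ : Measure Ω) (X : Ω → 𝒳) (Y : Ω → 𝒴) :
    𝒳 × 𝒴 → ℝ :=
  pmf μ (fun ω => (X ω, Y ω))

/-- `X`, `Y`, `Z` form a Markov chain:
`P(x, y, z) P(y) = P(x, y) P(y, z)` for all `x`, `y`, `z`. -/
def IsMarkovChain {Ω 𝒳 𝒴 𝒵 : Type*} [MeasurableSpace Ω] (μ : Measure Ω)
    (X : Ω → 𝒳) (Y : Ω → 𝒴) (Z : Ω → 𝒵) : Prop :=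
  ∀ x y z, pmf μ (fun ω => (X ω, Y ω, Z ω)) (x, y, z) * pmf μ Y y
    = jointPmf μ X Y (x, y) * jointPmf μ Y Z (y, z)

/-- The product `(x, y) ↦ Q_X(x) Q_Y(y)`. -/
def prodPmf {𝒳 𝒴 : Type*} (QX : 𝒳 → ℝ) (QY : 𝒴 → ℝ) : 𝒳 × 𝒴 → ℝ :=
  fun p => QX p.1 * QY p.2

/-- The first marginal. -/
def margFst {𝒳 𝒴 : Type*} [Fintype 𝒴] (R : 𝒳 × 𝒴 → ℝ) : 𝒳 → ℝ :=
  fun x => ∑ y, R (x, y)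

/-- The second marginal. -/
def margSnd {𝒳 𝒴 : Type*} [Fintype 𝒳] (R : 𝒳 × 𝒴 → ℝ) : 𝒴 → ℝ :=
  fun y => ∑ x, R (x, y)

/-- Relative entropy `D(P‖Q) = ∑ P(x) log (P(x) / Q(x))`, extended-real valued.
The arithmetic of `ℝ≥0∞` and `EReal` gives `0 log (0 / q) = 0` and `p log (p / 0) = ∞`
for `p > 0`. -/
def relEntropy {ι : Type*} [Fintype ι] (P Q : ι → ℝ) : EReal :=
  ∑ x, (P x : EReal) * ENNReal.log (ENNReal.ofReal (P x) / ENNReal.ofReal (Q x))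

open Classical in
/-- Rényi divergence `D_α(P‖Q) = (α - 1)⁻¹ log ∑ P(x)^α Q(x)^(1-α)`, extended-real valued, with
`D_1 = D`. In `ℝ≥0∞` the negative powers of `0` are `∞` and `0 * ∞ = 0`, so for `α > 1` one has
`P(x)^α Q(x)^(1-α) = P(x)^α / Q(x)^(α-1)` with `0 / 0 = 0` and `p / 0 = ∞`. -/
def renyiDiv {ι : Type*} [Fintype ι] (α : ℝ) (P Q : ι → ℝ) : EReal :=
  if α = 1 then relEntropy P Q
  else (((α - 1)⁻¹ : ℝ) : EReal) *
    ENNReal.log (∑ x, ENNReal.ofReal (P x) ^ α * ENNReal.ofReal (Q x) ^ (1 - α))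

/-- `J_α` of a joint probability mass function `P`: the minimum of `D_α(P‖Q_X Q_Y)` over all
probability mass functions `Q_X` and `Q_Y`. -/
def renyiJ {𝒳 𝒴 : Type*} [Fintype 𝒳] [Fintype 𝒴] (α : ℝ) (P : 𝒳 × 𝒴 → ℝ) : EReal :=
  ⨅ QX ∈ stdSimplex ℝ 𝒳, ⨅ QY ∈ stdSimplex ℝ 𝒴, renyiDiv α P (prodPmf QX QY)

/-- `J_α(X;Y)` of two random variables. -/
def renyiJRV {Ω 𝒳 𝒴 : Type*} [MeasurableSpace Ω] [Fintype 𝒳] [Fintype 𝒴] (μ : Measure Ω)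
    (α : ℝ) (X : Ω → 𝒳) (Y : Ω → 𝒴) : EReal :=
  renyiJ α (jointPmf μ X Y)

/-- The mutual information of a joint probability mass function `R`: `D(R‖R_X R_Y)`. -/
def mutualInfo {𝒳 𝒴 : Type*} [Fintype 𝒳] [Fintype 𝒴] (R : 𝒳 × 𝒴 → ℝ) : EReal :=
  relEntropy R (prodPmf (margFst R) (margSnd R))

/-- `α / (α - 1) * log ∑ y, (∑ x, P(x,y)^α Q_X(x)^(1-α))^(1/α)`, with the same conventions
as in the Rényi divergence. -/
def reducedObjective {𝒳 𝒴 : Type*} [Fintype 𝒳] [Fintype 𝒴] (α : ℝ) (P : 𝒳 × 𝒴 → ℝ)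
    (QX : 𝒳 → ℝ) : EReal :=
  ((α / (α - 1) : ℝ) : EReal) *
    ENNReal.log (∑ y, (∑ x, ENNReal.ofReal (P (x, y)) ^ α *
      ENNReal.ofReal (QX x) ^ (1 - α)) ^ (1 / α))

/-- `I_R(X;Y) + α / (1 - α) * D(R‖P)`. -/
def dualObjective {𝒳 𝒴 : Type*} [Fintype 𝒳] [Fintype 𝒴] (α : ℝ) (P R : 𝒳 × 𝒴 → ℝ) : EReal :=
  mutualInfo R + ((α / (1 - α) : ℝ) : EReal) * relEntropy R P

open Classical in
/-- Rényi entropy of order `β` (Shannon entropy for `β = 1`). -/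
def renyiEntropy {ι : Type*} [Fintype ι] (β : ℝ) (P : ι → ℝ) : ℝ :=
  if β = 1 then ∑ x, P x * Real.log (1 / P x)
  else 1 / (1 - β) * Real.log (∑ x, P x ^ β)

/-- Rényi entropy of order `∞`: `- log max_x P(x)`. -/
def minEntropy {ι : Type*} (P : ι → ℝ) : ℝ :=
  -Real.log (⨆ x, P x)

/-- Convexity for functions with values in `(-∞, ∞]`. -/
def EConvexOn {E : Type*} [AddCommGroup E] [Module ℝ E] (s : Set E) (f : E → EReal) : Prop :=
  Convex ℝ s ∧ ∀ ⦃x⦄, x ∈ s → ∀ ⦃y⦄, y ∈ s → ∀ ⦃a b : ℝ⦄, 0 ≤ a → 0 ≤ b → a + b = 1 →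
    f (a • x + b • y) ≤ (a : EReal) * f x + (b : EReal) * f y

/-- Concavity for functions with values in `[-∞, ∞)`. -/
def EConcaveOn {E : Type*} [AddCommGroup E] [Module ℝ E] (s : Set E) (f : E → EReal) : Prop :=
  Convex ℝ s ∧ ∀ ⦃x⦄, x ∈ s → ∀ ⦃y⦄, y ∈ s → ∀ ⦃a b : ℝ⦄, 0 ≤ a → 0 ≤ b → a + b = 1 →
    (a : EReal) * f x + (b : EReal) * f y ≤ f (a • x + b • y)

/-- Strict concavity for functions with values in `[-∞, ∞)`: concavity, with strict inequality
between any two distinct points where the function is not `-∞`. -/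
def EStrictConcaveOn {E : Type*} [AddCommGroup E] [Module ℝ E] (s : Set E) (f : E → EReal) :
    Prop :=
  EConcaveOn s f ∧ ∀ ⦃x⦄, x ∈ s → f x ≠ ⊥ → ∀ ⦃y⦄, y ∈ s → f y ≠ ⊥ → x ≠ y →
    ∀ ⦃a b : ℝ⦄, 0 < a → 0 < b → a + b = 1 →
      (a : EReal) * f x + (b : EReal) * f y < f (a • x + b • y)

end

end RenyiDep

open RenyiDep

/-! Everything rests on one computation. Put `w = P^α Q^(1-α)`. For a PMF `R` dominated by `P` and
`Q`, `D(R‖w) = (1-α) [D(R‖Q) + α/(1-α) D(R‖P)]` (`klReal_tilt`), while Gibbs' inequality gives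
`D(R‖w) ≥ -log ∑ w`, with equality when `R` is `w` normalized. Dividing by `1-α` exhibits `D_α(P‖Q)`
as a minimum (`α < 1`) or a maximum (`α > 1`) over `R` of `D(R‖Q) + α/(1-α) D(R‖P)`.

For `Q = Q_X Q_Y` the identity `D(R‖Q_X Q_Y) = I_R + D(R_X‖Q_X) + D(R_Y‖Q_Y)` (`klReal_prodPmf`)
shows that the best factors for a given `R` are its marginals. For `α < 1` two minima commute and
the variational formula follows. For `α > 1` only "max ≤ min" is free. Equality needs no minimax
theorem: Sibson's identity `mul_log_sum_eq` determines the optimal `Q_Y` for fixed `Q_X`, and this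
forces the normalized tilt of an optimal pair `(Q_X, Q_Y)` to have exactly these marginals
(`margSnd_normalize_tilt`). Hence its dual value equals `J_α`.

So `J_α` is an extremum of functions affine in `α/(1-α)`. Monotonicity, the cardinality bounds and
continuity away from `1` are read off from this. At `1`, the optimal `R` is forced towards `P` in
Hellinger distance. For `α > 1` the dual objective is a sum of entropies with positive coefficients
plus a linear term, hence strictly concave, so its maximizer is unique.

The other properties work directly on the sum inside the logarithm: Hölder's inequality for data
processing, a chain rule for additivity, joint convexity in `(Q_X, Q_Y)` followed by partial
minimization for `α ≥ 1/2`, and Sibson's minimization applied to the diagonal law. Where these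
arguments exclude `α = 1`, that case is a limit from the right. -/

namespace RenyiDep

/-- The real-valued version of the relative entropy, meaningful if `R` vanishes where `P` does. -/
noncomputable def klReal {ι : Type*} [Fintype ι] (R P : ι → ℝ) : ℝ :=
  ∑ x, R x * Real.log (R x / P x)

/-- The unnormalized tilted measure `P ^ α * Q ^ (1 - α)`. -/
noncomputable def tilt {ι : Type*} (α : ℝ) (P Q : ι → ℝ) : ι → ℝ :=
  fun x => P x ^ α * Q x ^ (1 - α)

/-- The argument of the logarithm in the Rényi divergence. -/
noncomputable def renyiSum {ι : Type*} [Fintype ι] (α : ℝ) (P Q : ι → ℝ) : ENNReal :=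
  ∑ x, ENNReal.ofReal (P x) ^ α * ENNReal.ofReal (Q x) ^ (1 - α)

/-! ### Relative entropy, tilted measures and the Rényi divergence -/

section Basic

variable {ι : Type*} [Fintype ι]

omit [Fintype ι] in
theorem coe_finset_sum (s : Finset ι) (f : ι → ℝ) :
    ((∑ x ∈ s, f x : ℝ) : EReal) = ∑ x ∈ s, (f x : EReal) := by
  classical
  induction s using Finset.induction_on with
  | empty => simp
  | insert a s ha ih => simp [Finset.sum_insert ha, ih]

theorem relEntropy_term {p q : ℝ} (hp : 0 ≤ p) (hq : 0 ≤ q) (h : q = 0 → p = 0) :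
    (p : EReal) * ENNReal.log (ENNReal.ofReal p / ENNReal.ofReal q)
      = ((p * Real.log (p / q) : ℝ) : EReal) := by
  rcases hp.eq_or_lt with rfl | hp'
  · simp
  · have hq' : 0 < q := lt_of_le_of_ne hq fun h' => hp'.ne' (h h'.symm)
    rw [← ENNReal.ofReal_div_of_pos hq', ENNReal.log_ofReal_of_pos (div_pos hp' hq'),
      EReal.coe_mul]

theorem relEntropy_eq_coe {P Q : ι → ℝ} (hP : ∀ x, 0 ≤ P x) (hQ : ∀ x, 0 ≤ Q x)
    (h : ∀ x, Q x = 0 → P x = 0) : relEntropy P Q = ((klReal P Q : ℝ) : EReal) := by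
  rw [relEntropy, klReal, coe_finset_sum]
  exact Finset.sum_congr rfl fun x _ => relEntropy_term (hP x) (hQ x) (h x)

theorem relEntropy_eq_top {P Q : ι → ℝ} (hP : ∀ x, 0 ≤ P x) (hQ : ∀ x, 0 ≤ Q x)
    (h : ¬ ∀ x, Q x = 0 → P x = 0) : relEntropy P Q = ⊤ := by
  classical
  push Not at h
  obtain ⟨x, hx, hx'⟩ := h
  have hp : 0 < P x := lt_of_le_of_ne (hP x) (Ne.symm hx')
  -- In `EReal`, `⊤ + ⊥ = ⊥`, so one infinite term decides the sum only once every term is known to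
  -- differ from `⊥`.
  have key : ∀ y, (P y : EReal) * ENNReal.log (ENNReal.ofReal (P y) / ENNReal.ofReal (Q y))
      ≠ ⊥ := by
    intro y
    by_cases hy : Q y = 0 → P y = 0
    · rw [relEntropy_term (hP y) (hQ y) hy]; exact EReal.coe_ne_bot _
    · push Not at hy
      have hp : 0 < P y := lt_of_le_of_ne (hP y) (Ne.symm hy.2)
      rw [hy.1, ENNReal.ofReal_zero, ENNReal.div_zero (by simpa using hp), ENNReal.log_top,
        EReal.coe_mul_top_of_pos hp]
      simp
  have hne : ∀ s : Finset ι, ∑ y ∈ s,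
      (P y : EReal) * ENNReal.log (ENNReal.ofReal (P y) / ENNReal.ofReal (Q y)) ≠ ⊥ := by
    intro s
    induction s using Finset.induction_on with
    | empty => simp
    | insert a s ha ih =>
      rw [Finset.sum_insert ha]
      simp [EReal.add_eq_bot_iff, ih, key]
  rw [relEntropy, ← Finset.add_sum_erase _ _ (Finset.mem_univ x), hx, ENNReal.ofReal_zero,
    ENNReal.div_zero (by simpa using hp), ENNReal.log_top, EReal.coe_mul_top_of_pos hp]
  exact EReal.top_add_of_ne_bot (hne _)

theorem simplex_le_one {P : ι → ℝ} (hP : P ∈ stdSimplex ℝ ι) (x : ι) : P x ≤ 1 := by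
  rw [← hP.2]
  exact Finset.single_le_sum (f := P) (fun y _ => hP.1 y) (Finset.mem_univ x)

theorem simplex_exists_pos {P : ι → ℝ} (hP : P ∈ stdSimplex ℝ ι) : ∃ x, 0 < P x := by
  by_contra! h
  have : ∑ x, P x ≤ 0 := Finset.sum_nonpos fun x _ => h x
  linarith [hP.2]

/-- Gibbs' inequality for an unnormalized reference measure. -/
theorem neg_log_sum_le_klReal {R w : ι → ℝ} (hR : R ∈ stdSimplex ℝ ι) (hw : ∀ x, 0 ≤ w x)
    (h : ∀ x, w x = 0 → R x = 0) : -Real.log (∑ x, w x) ≤ klReal R w := by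
  obtain ⟨x₀, hx₀⟩ := simplex_exists_pos hR
  set S := ∑ x, w x with hS
  have hSpos : 0 < S := by
    refine Finset.sum_pos' (fun x _ => hw x) ⟨x₀, Finset.mem_univ _, ?_⟩
    exact lt_of_le_of_ne (hw _) fun h' => hx₀.ne' (h _ h'.symm)
  have key : ∀ x, R x - w x / S ≤ R x * Real.log (R x / w x) + R x * Real.log S := by
    intro x
    rcases (hR.1 x).eq_or_lt with h0 | hpos
    · rw [← h0]; simp; exact div_nonneg (hw x) hSpos.le
    · have hwx : 0 < w x := lt_of_le_of_ne (hw _) fun h' => hpos.ne' (h _ h'.symm)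
      have := Real.one_sub_inv_le_log_of_pos (x := R x / w x * S) (by positivity)
      rw [Real.log_mul (by positivity) hSpos.ne'] at this
      have h2 := mul_le_mul_of_nonneg_left this hpos.le
      have h3 : R x * (1 - (R x / w x * S)⁻¹) = R x - w x / S := by field_simp
      linarith
  have h1 := Finset.sum_le_sum (s := Finset.univ) fun x _ => key x
  rw [Finset.sum_sub_distrib, Finset.sum_add_distrib, ← Finset.sum_div, ← Finset.sum_mul, hR.2,
    ← hS, div_self hSpos.ne'] at h1
  unfold klReal
  linarith

/-- The equality case of Gibbs' inequality: where `w` is positive, the ratio of the normalized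
measure to `w` is constant. -/
theorem klReal_normalize {w : ι → ℝ} (hw : ∀ x, 0 ≤ w x) (hS : 0 < ∑ x, w x) :
    klReal (fun x => w x / ∑ y, w y) w = -Real.log (∑ x, w x) := by
  set S := ∑ x, w x with hSdef
  have : ∀ x, w x / S * Real.log (w x / S / w x) = w x / S * (-Real.log S) := by
    intro x
    rcases (hw x).eq_or_lt with h0 | hpos
    · rw [← h0]; simp
    · have : w x / S / w x = S⁻¹ := by field_simp
      rw [this, Real.log_inv]
  simp only [klReal, this]
  rw [← Finset.sum_mul, ← Finset.sum_div, ← hSdef, div_self hS.ne', one_mul]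

theorem normalize_mem {w : ι → ℝ} (hw : ∀ x, 0 ≤ w x) (hS : 0 < ∑ x, w x) :
    (fun x => w x / ∑ y, w y) ∈ stdSimplex ℝ ι :=
  ⟨fun x => div_nonneg (hw x) hS.le, by rw [← Finset.sum_div, div_self hS.ne']⟩

/-- The relative entropy bounds the squared Hellinger distance. -/
theorem hellinger_le_klReal {R P : ι → ℝ} (hR : R ∈ stdSimplex ℝ ι) (hP : P ∈ stdSimplex ℝ ι)
    (h : ∀ x, P x = 0 → R x = 0) : ∑ x, (√(R x) - √(P x)) ^ 2 ≤ klReal R P := by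
  have key : ∀ x, 2 * R x - 2 * (√(R x) * √(P x)) ≤ R x * Real.log (R x / P x) := by
    intro x
    rcases (hR.1 x).eq_or_lt with h0 | hpos
    · rw [← h0]; simp
    · have hPx : 0 < P x := lt_of_le_of_ne (hP.1 x) fun h' => hpos.ne' (h _ h'.symm)
      -- Applying `log t ≥ 1 - 1/t` to the square root, and then doubling, produces the cross term
      -- `√R √P`; at `R / P` itself it would give only nonnegativity.
      have h1 := Real.one_sub_inv_le_log_of_pos (x := √(R x / P x)) (by positivity)
      rw [Real.log_sqrt (by positivity)] at h1
      have h2 := mul_le_mul_of_nonneg_left h1 hpos.le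
      have h3 : R x * (1 - (√(R x / P x))⁻¹) = R x - √(R x) * √(P x) := by
        rw [Real.sqrt_div hpos.le, inv_div]
        have := Real.sq_sqrt hpos.le
        have h4 : 0 < √(R x) := by positivity
        field_simp
        linear_combination √(P x) * this
      linarith
  have e : ∀ x, (√(R x) - √(P x)) ^ 2 = R x + P x - 2 * (√(R x) * √(P x)) := by
    intro x
    linear_combination Real.sq_sqrt (hR.1 x) + Real.sq_sqrt (hP.1 x)
  simp only [e]
  have h1 := Finset.sum_le_sum (s := Finset.univ) fun x _ => key x
  rw [Finset.sum_sub_distrib, ← Finset.mul_sum, hR.2] at h1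
  rw [Finset.sum_sub_distrib, Finset.sum_add_distrib, hR.2, hP.2]
  unfold klReal
  linarith

theorem klReal_nonneg {R P : ι → ℝ} (hR : R ∈ stdSimplex ℝ ι) (hP : P ∈ stdSimplex ℝ ι)
    (h : ∀ x, P x = 0 → R x = 0) : 0 ≤ klReal R P :=
  (Finset.sum_nonneg fun _ _ => sq_nonneg _).trans (hellinger_le_klReal hR hP h)

theorem eq_of_klReal_le_zero {R P : ι → ℝ} (hR : R ∈ stdSimplex ℝ ι) (hP : P ∈ stdSimplex ℝ ι)
    (h : ∀ x, P x = 0 → R x = 0) (h0 : klReal R P ≤ 0) : R = P := by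
  have h1 := (hellinger_le_klReal hR hP h).trans h0
  funext x
  have h2 : (√(R x) - √(P x)) ^ 2 ≤ 0 := by
    refine le_trans ?_ h1
    exact Finset.single_le_sum (f := fun x => (√(R x) - √(P x)) ^ 2)
      (fun y _ => sq_nonneg _) (Finset.mem_univ x)
  have h3 : √(R x) = √(P x) := by nlinarith [sq_nonneg (√(R x) - √(P x))]
  exact (Real.sqrt_inj (hR.1 x) (hP.1 x)).1 h3

theorem klReal_self (P : ι → ℝ) : klReal P P = 0 := by
  refine Finset.sum_eq_zero fun x _ => ?_
  by_cases h : P x = 0 <;> simp [h]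

omit [Fintype ι] in
theorem tilt_nonneg {α : ℝ} {P Q : ι → ℝ} (hP : ∀ x, 0 ≤ P x) (hQ : ∀ x, 0 ≤ Q x) (x : ι) :
    0 ≤ tilt α P Q x :=
  mul_nonneg (Real.rpow_nonneg (hP x) _) (Real.rpow_nonneg (hQ x) _)

omit [Fintype ι] in
theorem tilt_eq_zero_iff {α : ℝ} (hα : 0 < α) (hα1 : α ≠ 1) {P Q : ι → ℝ} (hP : ∀ x, 0 ≤ P x)
    (hQ : ∀ x, 0 ≤ Q x) (x : ι) : tilt α P Q x = 0 ↔ P x = 0 ∨ Q x = 0 := by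
  rw [tilt, mul_eq_zero, Real.rpow_eq_zero (hP x) hα.ne',
    Real.rpow_eq_zero (hQ x) (sub_ne_zero.2 hα1.symm)]

/-- The weights `α` and `1 - α` sum to one, so `log (R / (P^α Q^(1-α)))` is the corresponding
average of `log (R / P)` and `log (R / Q)`. -/
theorem klReal_tilt {α : ℝ} (hα1 : α ≠ 1) {R P Q : ι → ℝ}
    (hR : ∀ x, 0 ≤ R x) (hP : ∀ x, 0 ≤ P x) (hQ : ∀ x, 0 ≤ Q x)
    (h1 : ∀ x, P x = 0 → R x = 0) (h2 : ∀ x, Q x = 0 → R x = 0) :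
    klReal R (tilt α P Q) = (1 - α) * (klReal R Q + α / (1 - α) * klReal R P) := by
  have hne : 1 - α ≠ 0 := sub_ne_zero.2 hα1.symm
  have : (1 - α) * (klReal R Q + α / (1 - α) * klReal R P)
      = (1 - α) * klReal R Q + α * klReal R P := by field_simp
  rw [this, klReal, klReal, klReal, Finset.mul_sum, Finset.mul_sum, ← Finset.sum_add_distrib]
  refine Finset.sum_congr rfl fun x _ => ?_
  rcases (hR x).eq_or_lt with h0 | hpos
  · rw [← h0]; simp
  · have hPx : 0 < P x := lt_of_le_of_ne (hP x) fun h' => hpos.ne' (h1 _ h'.symm)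
    have hQx : 0 < Q x := lt_of_le_of_ne (hQ x) fun h' => hpos.ne' (h2 _ h'.symm)
    have a := Real.rpow_pos_of_pos hPx α
    have b := Real.rpow_pos_of_pos hQx (1 - α)
    rw [tilt, Real.log_div hpos.ne' (by positivity), Real.log_div hpos.ne' hPx.ne',
      Real.log_div hpos.ne' hQx.ne', Real.log_mul a.ne' b.ne', Real.log_rpow hPx,
      Real.log_rpow hQx]
    ring

omit [Fintype ι] in
-- A negative power of zero is `0` in `ℝ` but `⊤` in `ENNReal`. The two readings agree if the
-- exponent `1 - α` is positive, or if `P` vanishes wherever `Q` does, since `0 * ⊤ = 0`.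
theorem ofReal_tilt {α : ℝ} (hα : 0 < α) {P Q : ι → ℝ} (hP : ∀ x, 0 ≤ P x)
    (hQ : ∀ x, 0 ≤ Q x) {x : ι} (h : α < 1 ∨ (Q x = 0 → P x = 0)) :
    ENNReal.ofReal (tilt α P Q x)
      = ENNReal.ofReal (P x) ^ α * ENNReal.ofReal (Q x) ^ (1 - α) := by
  rw [tilt, ENNReal.ofReal_mul (Real.rpow_nonneg (hP x) _),
    ENNReal.ofReal_rpow_of_nonneg (hP x) hα.le]
  rcases (hQ x).eq_or_lt with h0 | hpos
  · rcases h with h | h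
    · rw [ENNReal.ofReal_rpow_of_nonneg (hQ x) (by linarith)]
    · rw [h h0.symm, Real.zero_rpow hα.ne']; simp
  · rw [ENNReal.ofReal_rpow_of_pos hpos]

theorem renyiSum_eq_ofReal {α : ℝ} (hα : 0 < α) {P Q : ι → ℝ} (hP : ∀ x, 0 ≤ P x)
    (hQ : ∀ x, 0 ≤ Q x) (h : α < 1 ∨ ∀ x, Q x = 0 → P x = 0) :
    renyiSum α P Q = ENNReal.ofReal (∑ x, tilt α P Q x) := by
  rw [ENNReal.ofReal_sum_of_nonneg fun x _ => tilt_nonneg hP hQ x]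
  exact Finset.sum_congr rfl fun x _ => (ofReal_tilt hα hP hQ (h.imp_right fun h => h x)).symm

theorem renyiSum_eq_top {α : ℝ} (hα : 1 < α) {P Q : ι → ℝ} (hP : ∀ x, 0 ≤ P x)
    (h : ¬ ∀ x, Q x = 0 → P x = 0) : renyiSum α P Q = ⊤ := by
  push Not at h
  obtain ⟨x, hx, hx'⟩ := h
  have hp : 0 < P x := lt_of_le_of_ne (hP x) (Ne.symm hx')
  refine ENNReal.sum_eq_top.2 ⟨x, Finset.mem_univ _, ?_⟩
  rw [hx, ENNReal.ofReal_zero, ENNReal.zero_rpow_of_neg (by linarith), ENNReal.mul_top]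
  simp [hp]

theorem renyiDiv_of_ne_one {α : ℝ} (hα1 : α ≠ 1) (P Q : ι → ℝ) :
    renyiDiv α P Q = (((α - 1)⁻¹ : ℝ) : EReal) * ENNReal.log (renyiSum α P Q) := by
  rw [renyiDiv, if_neg hα1, renyiSum]

theorem renyiDiv_eq_coe {α : ℝ} (hα : 0 < α) (hα1 : α ≠ 1) {P Q : ι → ℝ} (hP : ∀ x, 0 ≤ P x)
    (hQ : ∀ x, 0 ≤ Q x) (h : α < 1 ∨ ∀ x, Q x = 0 → P x = 0) (hS : 0 < ∑ x, tilt α P Q x) :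
    renyiDiv α P Q = (((α - 1)⁻¹ * Real.log (∑ x, tilt α P Q x) : ℝ) : EReal) := by
  rw [renyiDiv_of_ne_one hα1, renyiSum_eq_ofReal hα hP hQ h, ENNReal.log_ofReal_of_pos hS,
    EReal.coe_mul]

theorem renyiDiv_eq_top_of_lt {α : ℝ} (hα : 1 < α) {P Q : ι → ℝ} (hP : ∀ x, 0 ≤ P x)
    (h : ¬ ∀ x, Q x = 0 → P x = 0) : renyiDiv α P Q = ⊤ := by
  rw [renyiDiv_of_ne_one hα.ne', renyiSum_eq_top hα hP h, ENNReal.log_top,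
    EReal.coe_mul_top_of_pos (inv_pos.2 (by linarith))]

theorem renyiDiv_eq_top_of_sum_eq_zero {α : ℝ} (hα : 0 < α) (hα1 : α < 1) {P Q : ι → ℝ}
    (hP : ∀ x, 0 ≤ P x) (hQ : ∀ x, 0 ≤ Q x) (hS : ∑ x, tilt α P Q x = 0) :
    renyiDiv α P Q = ⊤ := by
  rw [renyiDiv_of_ne_one hα1.ne, renyiSum_eq_ofReal hα hP hQ (Or.inl hα1), hS,
    ENNReal.ofReal_zero, ENNReal.log_zero,
    EReal.coe_mul_bot_of_neg (inv_lt_zero.2 (by linarith))]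

theorem tilt_sum_pos {α : ℝ} (hα : 0 < α) (hα1 : α ≠ 1) {R P Q : ι → ℝ}
    (hR : R ∈ stdSimplex ℝ ι) (hP : ∀ x, 0 ≤ P x) (hQ : ∀ x, 0 ≤ Q x)
    (h1 : ∀ x, P x = 0 → R x = 0) (h2 : ∀ x, Q x = 0 → R x = 0) :
    0 < ∑ x, tilt α P Q x := by
  obtain ⟨x, hx⟩ := simplex_exists_pos hR
  refine Finset.sum_pos' (fun x _ => tilt_nonneg hP hQ x) ⟨x, Finset.mem_univ _, ?_⟩
  refine lt_of_le_of_ne (tilt_nonneg hP hQ x) fun h' => ?_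
  rcases (tilt_eq_zero_iff hα hα1 hP hQ x).1 h'.symm with h | h
  · exact hx.ne' (h1 x h)
  · exact hx.ne' (h2 x h)

/-- Variational upper bound on the Rényi divergence of order below one. -/
theorem renyiDiv_le_of_lt_one {α : ℝ} (hα : 0 < α) (hα1 : α < 1) {R P Q : ι → ℝ}
    (hR : R ∈ stdSimplex ℝ ι) (hP : ∀ x, 0 ≤ P x) (hQ : ∀ x, 0 ≤ Q x)
    (h1 : ∀ x, P x = 0 → R x = 0) (h2 : ∀ x, Q x = 0 → R x = 0) :
    renyiDiv α P Q ≤ ((klReal R Q + α / (1 - α) * klReal R P : ℝ) : EReal) := by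
  have hS := tilt_sum_pos hα hα1.ne hR hP hQ h1 h2
  rw [renyiDiv_eq_coe hα hα1.ne hP hQ (Or.inl hα1) hS, EReal.coe_le_coe_iff]
  have h3 := neg_log_sum_le_klReal (w := tilt α P Q) hR (tilt_nonneg hP hQ) fun x hx =>
    ((tilt_eq_zero_iff hα hα1.ne hP hQ x).1 hx).elim (h1 x) (h2 x)
  rw [klReal_tilt hα1.ne hR.1 hP hQ h1 h2] at h3
  have h4 : 0 < 1 - α := by linarith
  have h5 : (α - 1)⁻¹ = -(1 - α)⁻¹ := by rw [← inv_neg]; ring_nf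
  rw [h5, neg_mul, ← mul_neg, inv_mul_le_iff₀ h4]
  exact h3

/-- Variational lower bound on the Rényi divergence of order above one. -/
theorem le_renyiDiv_of_one_lt {α : ℝ} (hα : 1 < α) {R P Q : ι → ℝ}
    (hR : R ∈ stdSimplex ℝ ι) (hP : ∀ x, 0 ≤ P x) (hQ : ∀ x, 0 ≤ Q x)
    (h1 : ∀ x, P x = 0 → R x = 0) :
    ((klReal R Q + α / (1 - α) * klReal R P : ℝ) : EReal) ≤ renyiDiv α P Q := by
  have hα0 : 0 < α := by linarith
  by_cases h : ∀ x, Q x = 0 → P x = 0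
  · have h2 : ∀ x, Q x = 0 → R x = 0 := fun x hx => h1 x (h x hx)
    have hS := tilt_sum_pos hα0 hα.ne' hR hP hQ h1 h2
    rw [renyiDiv_eq_coe hα0 hα.ne' hP hQ (Or.inr h) hS, EReal.coe_le_coe_iff]
    have h3 := neg_log_sum_le_klReal (w := tilt α P Q) hR (tilt_nonneg hP hQ) fun x hx =>
      ((tilt_eq_zero_iff hα0 hα.ne' hP hQ x).1 hx).elim (h1 x) (h2 x)
    rw [klReal_tilt hα.ne' hR.1 hP hQ h1 h2] at h3
    have h4 : 0 < α - 1 := by linarith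
    rw [le_inv_mul_iff₀ h4]
    linarith
  · rw [renyiDiv_eq_top_of_lt hα hP h]
    exact le_top

/-- If the Rényi divergence is finite, it is given by the variational expression at the normalized
tilted measure. -/
theorem renyiDiv_eq_normalize_tilt {α : ℝ} (hα : 0 < α) (hα1 : α ≠ 1) {P Q : ι → ℝ}
    (hP : P ∈ stdSimplex ℝ ι) (hQ : ∀ x, 0 ≤ Q x) (hfin : renyiDiv α P Q ≠ ⊤) :
    (α < 1 ∨ ∀ x, Q x = 0 → P x = 0) ∧ 0 < ∑ x, tilt α P Q x ∧
    renyiDiv α P Q = ((klReal (fun x => tilt α P Q x / ∑ y, tilt α P Q y) Q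
      + α / (1 - α) * klReal (fun x => tilt α P Q x / ∑ y, tilt α P Q y) P : ℝ) : EReal) := by
  have hor : α < 1 ∨ ∀ x, Q x = 0 → P x = 0 := by
    by_contra! h
    exact hfin (renyiDiv_eq_top_of_lt (lt_of_le_of_ne h.1 hα1.symm) hP.1 (by push Not; exact h.2))
  have hS : 0 < ∑ x, tilt α P Q x := by
    rcases hor with h | h
    · refine lt_of_le_of_ne (Finset.sum_nonneg fun x _ => tilt_nonneg hP.1 hQ x) fun h' => ?_
      exact hfin (renyiDiv_eq_top_of_sum_eq_zero hα h hP.1 hQ h'.symm)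
    · exact tilt_sum_pos hα hα1 hP hP.1 hQ (fun _ h => h) h
  refine ⟨hor, hS, ?_⟩
  have hz : ∀ x, (P x = 0 ∨ Q x = 0) → tilt α P Q x / ∑ y, tilt α P Q y = 0 := fun x hx => by
    rw [(tilt_eq_zero_iff hα hα1 hP.1 hQ x).2 hx, zero_div]
  have hk := klReal_normalize (w := tilt α P Q) (tilt_nonneg hP.1 hQ) hS
  rw [klReal_tilt hα1 (normalize_mem (tilt_nonneg hP.1 hQ) hS).1 hP.1 hQ
    (fun x hx => hz x (Or.inl hx)) (fun x hx => hz x (Or.inr hx))] at hk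
  rw [renyiDiv_eq_coe hα hα1 hP.1 hQ hor hS, EReal.coe_eq_coe_iff]
  have : Real.log (∑ x, tilt α P Q x) = (α - 1) * (klReal (fun x => tilt α P Q x / ∑ y, tilt α P Q y) Q
      + α / (1 - α) * klReal (fun x => tilt α P Q x / ∑ y, tilt α P Q y) P) := by linarith
  rw [this, inv_mul_cancel_left₀ (sub_ne_zero.2 hα1)]

/-- Nonnegativity of the Rényi divergence and its equality case. -/
theorem renyiDiv_nonneg {α : ℝ} (hα : 0 < α) {P Q : ι → ℝ} (hP : P ∈ stdSimplex ℝ ι)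
    (hQ : Q ∈ stdSimplex ℝ ι) : 0 ≤ renyiDiv α P Q ∧ (renyiDiv α P Q = 0 → P = Q) := by
  rcases lt_trichotomy α 1 with h1 | h1 | h1
  -- Below order one the divergence is a positive combination of `D(R‖Q)` and `D(R‖P)` at the
  -- normalized tilt `R`; if it vanishes, `R` equals both `P` and `Q`.
  · by_cases htop : renyiDiv α P Q = ⊤
    · simp [htop]
    obtain ⟨hor, hS, he⟩ := renyiDiv_eq_normalize_tilt hα h1.ne hP hQ.1 htop
    set R := fun x => tilt α P Q x / ∑ y, tilt α P Q y
    have hR : R ∈ stdSimplex ℝ ι := normalize_mem (tilt_nonneg hP.1 hQ.1) hS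
    have hz : ∀ x, (P x = 0 ∨ Q x = 0) → R x = 0 := fun x hx => by
      simp only [R]; rw [(tilt_eq_zero_iff hα h1.ne hP.1 hQ.1 x).2 hx, zero_div]
    have a := klReal_nonneg hR hP fun x hx => hz x (Or.inl hx)
    have b := klReal_nonneg hR hQ fun x hx => hz x (Or.inr hx)
    have c : 0 < α / (1 - α) := div_pos hα (by linarith)
    rw [he]
    refine ⟨by exact_mod_cast add_nonneg b (mul_nonneg c.le a), fun h0 => ?_⟩
    have h0' : klReal R Q + α / (1 - α) * klReal R P = 0 := by exact_mod_cast h0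
    have h2 : klReal R P ≤ 0 := by
      by_contra! h
      have := mul_pos c h
      linarith
    have h3 : klReal R Q ≤ 0 := by
      have := mul_nonneg c.le a
      linarith
    rw [← eq_of_klReal_le_zero hR hP (fun x hx => hz x (Or.inl hx)) h2,
      ← eq_of_klReal_le_zero hR hQ (fun x hx => hz x (Or.inr hx)) h3]
  · subst h1
    have e : renyiDiv 1 P Q = relEntropy P Q := by simp [renyiDiv]
    rw [e]
    by_cases h : ∀ x, Q x = 0 → P x = 0
    · rw [relEntropy_eq_coe hP.1 hQ.1 h]
      refine ⟨by exact_mod_cast klReal_nonneg hP hQ h, fun h0 => ?_⟩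
      exact eq_of_klReal_le_zero hP hQ h (le_of_eq (by exact_mod_cast h0))
    · simp [relEntropy_eq_top hP.1 hQ.1 h]
  -- Above order one, testing with `R = P` gives `D(P‖Q) ≤ D_α(P‖Q)`.
  · by_cases h : ∀ x, Q x = 0 → P x = 0
    · have := le_renyiDiv_of_one_lt h1 hP hP.1 hQ.1 fun _ h => h
      rw [klReal_self, mul_zero, add_zero] at this
      have h2 := klReal_nonneg hP hQ h
      refine ⟨le_trans (by exact_mod_cast h2) this, fun h0 => ?_⟩
      rw [h0] at this
      exact eq_of_klReal_le_zero hP hQ h (by exact_mod_cast this)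
    · simp [renyiDiv_eq_top_of_lt h1 hP.1 h]

theorem renyiDiv_self {α : ℝ} (hα : 0 < α) {P : ι → ℝ} (hP : P ∈ stdSimplex ℝ ι) :
    renyiDiv α P P = 0 := by
  by_cases h1 : α = 1
  · subst h1
    have e : renyiDiv 1 P P = relEntropy P P := by simp [renyiDiv]
    rw [e, relEntropy_eq_coe hP.1 hP.1 (fun _ h => h), klReal_self]; simp
  · have : ∑ x, tilt α P P x = 1 := by
      rw [← hP.2]
      refine Finset.sum_congr rfl fun x _ => ?_
      rcases (hP.1 x).eq_or_lt with h0 | hpos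
      · rw [← h0, tilt_eq_zero_iff hα h1 hP.1 hP.1]; simp [← h0]
      · rw [tilt, ← Real.rpow_add hpos]; simp
    rw [renyiDiv_eq_coe hα h1 hP.1 hP.1 (Or.inr fun _ h => h) (by rw [this]; exact one_pos), this]
    simp

end Basic

/-! ### Mutual information, product measures and first properties of `J_α` -/

/-- The real-valued mutual information of a joint probability mass function. -/
noncomputable def miReal {𝒳 𝒴 : Type*} [Fintype 𝒳] [Fintype 𝒴] (R : 𝒳 × 𝒴 → ℝ) : ℝ :=
  klReal R (prodPmf (margFst R) (margSnd R))

section Joint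

variable {𝒳 𝒴 : Type*} [Fintype 𝒳] [Fintype 𝒴]

theorem margFst_mem {R : 𝒳 × 𝒴 → ℝ} (hR : R ∈ stdSimplex ℝ (𝒳 × 𝒴)) :
    margFst R ∈ stdSimplex ℝ 𝒳 :=
  ⟨fun x => Finset.sum_nonneg fun y _ => hR.1 _, by
    rw [← hR.2, Fintype.sum_prod_type]; rfl⟩

theorem margSnd_mem {R : 𝒳 × 𝒴 → ℝ} (hR : R ∈ stdSimplex ℝ (𝒳 × 𝒴)) :
    margSnd R ∈ stdSimplex ℝ 𝒴 :=
  ⟨fun x => Finset.sum_nonneg fun y _ => hR.1 _, by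
    rw [← hR.2, Fintype.sum_prod_type_right]; rfl⟩

theorem prodPmf_mem {Q : 𝒳 → ℝ} {T : 𝒴 → ℝ} (hQ : Q ∈ stdSimplex ℝ 𝒳)
    (hT : T ∈ stdSimplex ℝ 𝒴) : prodPmf Q T ∈ stdSimplex ℝ (𝒳 × 𝒴) :=
  ⟨fun p => mul_nonneg (hQ.1 _) (hT.1 _), by
    rw [Fintype.sum_prod_type]
    simp only [prodPmf]
    simp [← Finset.mul_sum, hQ.2, hT.2]⟩

omit [Fintype 𝒳] in
theorem eq_zero_of_margFst {R : 𝒳 × 𝒴 → ℝ} (hR : ∀ p, 0 ≤ R p) {p : 𝒳 × 𝒴}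
    (h : margFst R p.1 = 0) : R p = 0 :=
  (Finset.sum_eq_zero_iff_of_nonneg fun _ _ => hR _).1 h p.2 (Finset.mem_univ _)

omit [Fintype 𝒴] in
theorem eq_zero_of_margSnd {R : 𝒳 × 𝒴 → ℝ} (hR : ∀ p, 0 ≤ R p) {p : 𝒳 × 𝒴}
    (h : margSnd R p.2 = 0) : R p = 0 :=
  (Finset.sum_eq_zero_iff_of_nonneg fun _ _ => hR _).1 h p.1 (Finset.mem_univ _)

theorem eq_zero_of_prodPmf_marg {R : 𝒳 × 𝒴 → ℝ} (hR : ∀ p, 0 ≤ R p) (p : 𝒳 × 𝒴)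
    (h : prodPmf (margFst R) (margSnd R) p = 0) : R p = 0 :=
  (mul_eq_zero.1 h).elim (eq_zero_of_margFst hR) (eq_zero_of_margSnd hR)

theorem mutualInfo_eq_coe {R : 𝒳 × 𝒴 → ℝ} (hR : R ∈ stdSimplex ℝ (𝒳 × 𝒴)) :
    mutualInfo R = ((miReal R : ℝ) : EReal) :=
  relEntropy_eq_coe hR.1 (prodPmf_mem (margFst_mem hR) (margSnd_mem hR)).1
    (eq_zero_of_prodPmf_marg hR.1)

omit [Fintype 𝒳] in
theorem margFst_eq_zero {R : 𝒳 × 𝒴 → ℝ} {Q : 𝒳 → ℝ} {T : 𝒴 → ℝ}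
    (h : ∀ p, prodPmf Q T p = 0 → R p = 0) (x : 𝒳) (hx : Q x = 0) : margFst R x = 0 :=
  Finset.sum_eq_zero fun y _ => h (x, y) (by simp [prodPmf, hx])

omit [Fintype 𝒴] in
theorem margSnd_eq_zero {R : 𝒳 × 𝒴 → ℝ} {Q : 𝒳 → ℝ} {T : 𝒴 → ℝ}
    (h : ∀ p, prodPmf Q T p = 0 → R p = 0) (y : 𝒴) (hy : T y = 0) : margSnd R y = 0 :=
  Finset.sum_eq_zero fun x _ => h (x, y) (by simp [prodPmf, hy])

/-- The compensation identity for the relative entropy to a product. -/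
theorem klReal_prodPmf {R : 𝒳 × 𝒴 → ℝ} (hR : ∀ p, 0 ≤ R p) {Q : 𝒳 → ℝ} {T : 𝒴 → ℝ}
    (h : ∀ p, prodPmf Q T p = 0 → R p = 0) :
    klReal R (prodPmf Q T)
      = miReal R + klReal (margFst R) Q + klReal (margSnd R) T := by
  have e1 : klReal (margFst R) Q = ∑ p : 𝒳 × 𝒴, R p * Real.log (margFst R p.1 / Q p.1) := by
    rw [Fintype.sum_prod_type]
    exact Finset.sum_congr rfl fun x _ => by simp only [← Finset.sum_mul]; rfl
  have e2 : klReal (margSnd R) T = ∑ p : 𝒳 × 𝒴, R p * Real.log (margSnd R p.2 / T p.2) := by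
    rw [Fintype.sum_prod_type_right]
    exact Finset.sum_congr rfl fun x _ => by simp only [← Finset.sum_mul]; rfl
  rw [e1, e2, miReal, klReal, klReal, ← Finset.sum_add_distrib, ← Finset.sum_add_distrib]
  refine Finset.sum_congr rfl fun p _ => ?_
  by_cases h0 : R p = 0
  · simp [h0]
  · have a : Q p.1 * T p.2 ≠ 0 := fun h' => h0 (h p h')
    have b : margFst R p.1 ≠ 0 := fun h' => h0 (eq_zero_of_margFst hR h')
    have c : margSnd R p.2 ≠ 0 := fun h' => h0 (eq_zero_of_margSnd hR h')
    have a1 := left_ne_zero_of_mul a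
    have a2 := right_ne_zero_of_mul a
    rw [prodPmf, prodPmf, Real.log_div h0 a, Real.log_div h0 (mul_ne_zero b c),
      Real.log_div b a1, Real.log_div c a2, Real.log_mul a1 a2, Real.log_mul b c]
    ring

theorem miReal_le_klReal {R : 𝒳 × 𝒴 → ℝ} (hR : R ∈ stdSimplex ℝ (𝒳 × 𝒴)) {Q : 𝒳 → ℝ}
    {T : 𝒴 → ℝ} (hQ : Q ∈ stdSimplex ℝ 𝒳) (hT : T ∈ stdSimplex ℝ 𝒴)
    (h : ∀ p, prodPmf Q T p = 0 → R p = 0) : miReal R ≤ klReal R (prodPmf Q T) := by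
  rw [klReal_prodPmf hR.1 h]
  have a := klReal_nonneg (margFst_mem hR) hQ (margFst_eq_zero h)
  have b := klReal_nonneg (margSnd_mem hR) hT (margSnd_eq_zero h)
  linarith

theorem miReal_nonneg {R : 𝒳 × 𝒴 → ℝ} (hR : R ∈ stdSimplex ℝ (𝒳 × 𝒴)) : 0 ≤ miReal R :=
  klReal_nonneg hR (prodPmf_mem (margFst_mem hR) (margSnd_mem hR))
    (eq_zero_of_prodPmf_marg hR.1)

/-- Each entropy term is continuous and concave, unlike the logarithmic ratios; this form serves
continuity and strict concavity. -/
theorem miReal_eq_negMulLog {R : 𝒳 × 𝒴 → ℝ} (hR : ∀ p, 0 ≤ R p) :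
    miReal R = ∑ x, Real.negMulLog (margFst R x) + ∑ y, Real.negMulLog (margSnd R y)
      - ∑ p, Real.negMulLog (R p) := by
  have e1 : ∑ x, Real.negMulLog (margFst R x)
      = ∑ p : 𝒳 × 𝒴, -(R p * Real.log (margFst R p.1)) := by
    rw [Fintype.sum_prod_type]
    refine Finset.sum_congr rfl fun x _ => ?_
    simp only [Finset.sum_neg_distrib, ← Finset.sum_mul, Real.negMulLog, neg_mul]; rfl
  have e2 : ∑ y, Real.negMulLog (margSnd R y)
      = ∑ p : 𝒳 × 𝒴, -(R p * Real.log (margSnd R p.2)) := by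
    rw [Fintype.sum_prod_type_right]
    refine Finset.sum_congr rfl fun x _ => ?_
    simp only [Finset.sum_neg_distrib, ← Finset.sum_mul, Real.negMulLog, neg_mul]; rfl
  rw [e1, e2, miReal, klReal, ← Finset.sum_add_distrib, ← Finset.sum_sub_distrib]
  refine Finset.sum_congr rfl fun p _ => ?_
  by_cases h0 : R p = 0
  · simp [h0]
  · have b : margFst R p.1 ≠ 0 := fun h' => h0 (eq_zero_of_margFst hR h')
    have c : margSnd R p.2 ≠ 0 := fun h' => h0 (eq_zero_of_margSnd hR h')
    rw [prodPmf, Real.log_div h0 (mul_ne_zero b c), Real.log_mul b c, Real.negMulLog]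
    ring

theorem uniform_mem [Nonempty 𝒳] : (fun _ : 𝒳 => (Fintype.card 𝒳 : ℝ)⁻¹) ∈ stdSimplex ℝ 𝒳 :=
  ⟨fun _ => by positivity, by simp⟩

/-- Comparison with the product of the uniform law and `R_Y`: since `R(x,y) ≤ R_Y(y)`, the ratio
inside the logarithm is at most `|𝒳|`. -/
theorem miReal_le_log_card {R : 𝒳 × 𝒴 → ℝ} (hR : R ∈ stdSimplex ℝ (𝒳 × 𝒴)) :
    miReal R ≤ Real.log (Fintype.card 𝒳) := by
  obtain ⟨p₀, -⟩ := simplex_exists_pos hR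
  have : Nonempty 𝒳 := ⟨p₀.1⟩
  have hc : (0 : ℝ) < Fintype.card 𝒳 := by exact_mod_cast Fintype.card_pos
  refine (miReal_le_klReal hR (uniform_mem (𝒳 := 𝒳)) (margSnd_mem hR) fun p hp => ?_).trans ?_
  · rcases mul_eq_zero.1 hp with h | h
    · exact absurd h (by positivity)
    · exact eq_zero_of_margSnd hR.1 h
  · have : Real.log (Fintype.card 𝒳) = ∑ p, R p * Real.log (Fintype.card 𝒳) := by
      rw [← Finset.sum_mul, hR.2, one_mul]
    rw [this]
    refine Finset.sum_le_sum fun p _ => ?_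
    rcases (hR.1 p).eq_or_lt with h0 | hpos
    · rw [← h0]; simp
    · refine mul_le_mul_of_nonneg_left ?_ hpos.le
      have hle : R p ≤ margSnd R p.2 :=
        Finset.single_le_sum (f := fun x => R (x, p.2)) (fun x _ => hR.1 _)
          (Finset.mem_univ p.1)
      have hm : 0 < margSnd R p.2 := hpos.trans_le hle
      refine Real.log_le_log (by simp only [prodPmf]; positivity) ?_
      rw [prodPmf, div_le_iff₀ (by positivity)]
      field_simp
      exact hle

theorem renyiDiv_comp_equiv {ι κ : Type*} [Fintype ι] [Fintype κ] (e : κ ≃ ι) (α : ℝ)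
    (R P : ι → ℝ) : renyiDiv α (R ∘ e) (P ∘ e) = renyiDiv α R P := by
  unfold renyiDiv relEntropy
  congr 1
  · exact e.sum_comp fun x =>
      (R x : EReal) * ENNReal.log (ENNReal.ofReal (R x) / ENNReal.ofReal (P x))
  · congr 2
    exact e.sum_comp fun x => ENNReal.ofReal (R x) ^ α * ENNReal.ofReal (P x) ^ (1 - α)

theorem comp_swap_mem {R : 𝒳 × 𝒴 → ℝ} (hR : R ∈ stdSimplex ℝ (𝒳 × 𝒴)) :
    R ∘ Prod.swap ∈ stdSimplex ℝ (𝒴 × 𝒳) :=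
  ⟨fun p => hR.1 _, by rw [← hR.2]; exact (Equiv.prodComm 𝒴 𝒳).sum_comp R⟩

omit [Fintype 𝒳] [Fintype 𝒴] in
theorem prodPmf_swap (Q : 𝒳 → ℝ) (T : 𝒴 → ℝ) : prodPmf T Q = prodPmf Q T ∘ Prod.swap := by
  funext p; simp [prodPmf, mul_comm]

theorem renyiDiv_swap (α : ℝ) (P : 𝒳 × 𝒴 → ℝ) (Q : 𝒳 → ℝ) (T : 𝒴 → ℝ) :
    renyiDiv α (P ∘ Prod.swap) (prodPmf T Q) = renyiDiv α P (prodPmf Q T) := by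
  rw [prodPmf_swap]
  exact renyiDiv_comp_equiv (Equiv.prodComm 𝒴 𝒳) α P _

theorem renyiJ_le {α : ℝ} {P : 𝒳 × 𝒴 → ℝ} {Q : 𝒳 → ℝ} {T : 𝒴 → ℝ} (hQ : Q ∈ stdSimplex ℝ 𝒳)
    (hT : T ∈ stdSimplex ℝ 𝒴) : renyiJ α P ≤ renyiDiv α P (prodPmf Q T) :=
  (iInf₂_le Q hQ).trans (iInf₂_le T hT)

theorem le_renyiJ {α : ℝ} {P : 𝒳 × 𝒴 → ℝ} {c : EReal}
    (h : ∀ Q ∈ stdSimplex ℝ 𝒳, ∀ T ∈ stdSimplex ℝ 𝒴, c ≤ renyiDiv α P (prodPmf Q T)) :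
    c ≤ renyiJ α P :=
  le_iInf₂ fun Q hQ => le_iInf₂ fun T hT => h Q hQ T hT

theorem renyiJ_swap (α : ℝ) (P : 𝒳 × 𝒴 → ℝ) : renyiJ α (P ∘ Prod.swap) = renyiJ α P := by
  refine le_antisymm (le_renyiJ fun Q hQ T hT => ?_) (le_renyiJ fun T hT Q hQ => ?_)
  · rw [← renyiDiv_swap]; exact renyiJ_le hT hQ
  · rw [renyiDiv_swap]; exact renyiJ_le hQ hT

/-- Continuity with values in `EReal`, including at infinite values, so that compactness of the
simplices yields a minimizer. Order one is excluded; there the marginals are explicit minimizers. -/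
theorem continuous_renyiDiv_right {ι : Type*} [Fintype ι] {α : ℝ} (hα : 0 < α) (hα1 : α ≠ 1)
    (P : ι → ℝ) : Continuous fun Q : ι → ℝ => renyiDiv α P Q := by
  simp only [renyiDiv_of_ne_one hα1]
  have h1 : Continuous fun Q : ι → ℝ => renyiSum α P Q := by
    refine continuous_finsetSum _ fun x _ => ?_
    have hc : Continuous fun Q : ι → ℝ => ENNReal.ofReal (Q x) ^ (1 - α) :=
      (ENNReal.continuous_rpow_const).comp (ENNReal.continuous_ofReal.comp (continuous_apply x))
    exact (ENNReal.continuous_const_mul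
      (ENNReal.rpow_ne_top_of_nonneg hα.le ENNReal.ofReal_ne_top)).comp hc
  have h2 : Continuous fun Q : ι → ℝ => ENNReal.log (renyiSum α P Q) :=
    ENNReal.continuous_log.comp h1
  have h0 : (((α - 1)⁻¹ : ℝ) : EReal) ≠ 0 := by
    exact_mod_cast inv_ne_zero (sub_ne_zero.2 hα1)
  refine continuous_iff_continuousAt.2 fun Q => ?_
  have h3 : ContinuousAt (fun Q : ι → ℝ =>
      ((((α - 1)⁻¹ : ℝ) : EReal), ENNReal.log (renyiSum α P Q))) Q :=
    continuousAt_const.prodMk h2.continuousAt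
  exact ContinuousAt.comp (f := fun Q : ι → ℝ =>
      ((((α - 1)⁻¹ : ℝ) : EReal), ENNReal.log (renyiSum α P Q)))
    (g := fun p : EReal × EReal => p.1 * p.2) (EReal.continuousAt_mul
    (Or.inl h0) (Or.inl h0) (Or.inl (EReal.coe_ne_bot _)) (Or.inl (EReal.coe_ne_top _))) h3

theorem renyiDiv_one {ι : Type*} [Fintype ι] (P Q : ι → ℝ) :
    renyiDiv 1 P Q = relEntropy P Q := by
  simp [renyiDiv]

theorem renyiJ_one {P : 𝒳 × 𝒴 → ℝ} (hP : P ∈ stdSimplex ℝ (𝒳 × 𝒴)) :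
    renyiJ 1 P = ((miReal P : ℝ) : EReal) := by
  refine le_antisymm ?_ (le_renyiJ fun Q hQ T hT => ?_)
  · refine (renyiJ_le (margFst_mem hP) (margSnd_mem hP)).trans_eq ?_
    rw [renyiDiv_one, ← mutualInfo_eq_coe hP, mutualInfo]
  · rw [renyiDiv_one]
    by_cases h : ∀ p, prodPmf Q T p = 0 → P p = 0
    · rw [relEntropy_eq_coe hP.1 (prodPmf_mem hQ hT).1 h]
      exact_mod_cast miReal_le_klReal hP hQ hT h
    · rw [relEntropy_eq_top hP.1 (prodPmf_mem hQ hT).1 h]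
      exact le_top

/-- The minimum in the definition of `renyiJ` is attained. -/
theorem exists_renyiJ_eq {α : ℝ} (hα : 0 < α) {P : 𝒳 × 𝒴 → ℝ}
    (hP : P ∈ stdSimplex ℝ (𝒳 × 𝒴)) :
    ∃ Q ∈ stdSimplex ℝ 𝒳, ∃ T ∈ stdSimplex ℝ 𝒴, renyiJ α P = renyiDiv α P (prodPmf Q T) := by
  by_cases h1 : α = 1
  · subst h1
    refine ⟨_, margFst_mem hP, _, margSnd_mem hP, ?_⟩
    rw [renyiJ_one hP, renyiDiv_one, ← mutualInfo_eq_coe hP, mutualInfo]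
  · have hc : Continuous fun q : (𝒳 → ℝ) × (𝒴 → ℝ) => renyiDiv α P (prodPmf q.1 q.2) := by
      refine (continuous_renyiDiv_right hα h1 P).comp ?_
      unfold prodPmf
      fun_prop
    obtain ⟨q, hq, hmin⟩ := ((isCompact_stdSimplex ℝ 𝒳).prod
      (isCompact_stdSimplex ℝ 𝒴)).exists_isMinOn
        ⟨(margFst P, margSnd P), margFst_mem hP, margSnd_mem hP⟩ hc.continuousOn
    refine ⟨q.1, hq.1, q.2, hq.2, le_antisymm (renyiJ_le hq.1 hq.2)
      (le_renyiJ fun Q hQ T hT => ?_)⟩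
    exact isMinOn_iff.1 hmin (Q, T) ⟨hQ, hT⟩

theorem renyiJ_nonneg {α : ℝ} (hα : 0 < α) {P : 𝒳 × 𝒴 → ℝ}
    (hP : P ∈ stdSimplex ℝ (𝒳 × 𝒴)) : 0 ≤ renyiJ α P :=
  le_renyiJ fun _ hQ _ hT => (renyiDiv_nonneg hα hP (prodPmf_mem hQ hT)).1

theorem renyiJ_ne_top {α : ℝ} (hα : 0 < α) {P : 𝒳 × 𝒴 → ℝ}
    (hP : P ∈ stdSimplex ℝ (𝒳 × 𝒴)) : renyiJ α P ≠ ⊤ := by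
  by_cases h1 : α = 1
  · subst h1
    rw [renyiJ_one hP]
    exact EReal.coe_ne_top _
  · refine ne_top_of_le_ne_top ?_ (renyiJ_le (margFst_mem hP) (margSnd_mem hP))
    have hM := (prodPmf_mem (margFst_mem hP) (margSnd_mem hP)).1
    rw [renyiDiv_eq_coe hα h1 hP.1 hM (Or.inr (eq_zero_of_prodPmf_marg hP.1))
      (tilt_sum_pos hα h1 hP hP.1 hM (fun _ h => h) (eq_zero_of_prodPmf_marg hP.1))]
    exact EReal.coe_ne_top _

theorem coe_toReal_renyiJ {α : ℝ} (hα : 0 < α) {P : 𝒳 × 𝒴 → ℝ}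
    (hP : P ∈ stdSimplex ℝ (𝒳 × 𝒴)) : (((renyiJ α P).toReal : ℝ) : EReal) = renyiJ α P :=
  EReal.coe_toReal (renyiJ_ne_top hα hP)
    (ne_bot_of_le_ne_bot (by simp) (renyiJ_nonneg hα hP))

theorem renyiJ_eq_zero_iff {α : ℝ} (hα : 0 < α) {P : 𝒳 × 𝒴 → ℝ}
    (hP : P ∈ stdSimplex ℝ (𝒳 × 𝒴)) :
    renyiJ α P = 0 ↔ P = prodPmf (margFst P) (margSnd P) := by
  refine ⟨fun h => ?_, fun h => le_antisymm ?_ (renyiJ_nonneg hα hP)⟩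
  · obtain ⟨Q, hQ, T, hT, e⟩ := exists_renyiJ_eq hα hP
    have hPQ := (renyiDiv_nonneg hα hP (prodPmf_mem hQ hT)).2 (e ▸ h)
    have h1 : margFst P = Q := by
      funext x; simp [hPQ, margFst, prodPmf, ← Finset.mul_sum, hT.2]
    have h2 : margSnd P = T := by
      funext x; simp [hPQ, margSnd, prodPmf, ← Finset.sum_mul, hQ.2]
    rw [h1, h2]; exact hPQ
  · have := renyiJ_le (α := α) (P := P) (margFst_mem hP) (margSnd_mem hP)
    rwa [← h, renyiDiv_self hα hP] at this

end Joint

/-! ### Variational formula below order one, weak duality above it -/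

section Dual

variable {𝒳 𝒴 : Type*} [Fintype 𝒳] [Fintype 𝒴]

theorem dualObjective_eq_coe {α : ℝ} {P R : 𝒳 × 𝒴 → ℝ} (hP : P ∈ stdSimplex ℝ (𝒳 × 𝒴))
    (hR : R ∈ stdSimplex ℝ (𝒳 × 𝒴)) (h : ∀ p, P p = 0 → R p = 0) :
    dualObjective α P R = ((miReal R + α / (1 - α) * klReal R P : ℝ) : EReal) := by
  rw [dualObjective, mutualInfo_eq_coe hR, relEntropy_eq_coe hR.1 hP.1 h]
  norm_cast

theorem dualObjective_eq_top {α : ℝ} (hα : 0 < α) (hα1 : α < 1) {P R : 𝒳 × 𝒴 → ℝ}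
    (hP : P ∈ stdSimplex ℝ (𝒳 × 𝒴)) (hR : R ∈ stdSimplex ℝ (𝒳 × 𝒴))
    (h : ¬ ∀ p, P p = 0 → R p = 0) : dualObjective α P R = ⊤ := by
  rw [dualObjective, mutualInfo_eq_coe hR, relEntropy_eq_top hR.1 hP.1 h,
    EReal.coe_mul_top_of_pos (div_pos hα (by linarith)), EReal.coe_add_top]

theorem dualObjective_eq_bot {α : ℝ} (hα : 1 < α) {P R : 𝒳 × 𝒴 → ℝ}
    (hP : P ∈ stdSimplex ℝ (𝒳 × 𝒴)) (hR : R ∈ stdSimplex ℝ (𝒳 × 𝒴))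
    (h : ¬ ∀ p, P p = 0 → R p = 0) : dualObjective α P R = ⊥ := by
  rw [dualObjective, mutualInfo_eq_coe hR, relEntropy_eq_top hR.1 hP.1 h,
    EReal.coe_mul_top_of_neg (div_neg_of_pos_of_neg (by linarith) (by linarith)), EReal.add_bot]

theorem renyiJ_le_of_lt_one {α : ℝ} (hα : 0 < α) (hα1 : α < 1) {P R : 𝒳 × 𝒴 → ℝ}
    (hP : P ∈ stdSimplex ℝ (𝒳 × 𝒴)) (hR : R ∈ stdSimplex ℝ (𝒳 × 𝒴))
    (h : ∀ p, P p = 0 → R p = 0) :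
    renyiJ α P ≤ ((miReal R + α / (1 - α) * klReal R P : ℝ) : EReal) :=
  (renyiJ_le (margFst_mem hR) (margSnd_mem hR)).trans
    (renyiDiv_le_of_lt_one hα hα1 hR hP.1 (prodPmf_mem (margFst_mem hR) (margSnd_mem hR)).1 h
      (eq_zero_of_prodPmf_marg hR.1))

/-- The variational formula for orders below one, with a minimizer dominated by `P`. -/
theorem exists_renyiJ_eq_of_lt_one {α : ℝ} (hα : 0 < α) (hα1 : α < 1) {P : 𝒳 × 𝒴 → ℝ}
    (hP : P ∈ stdSimplex ℝ (𝒳 × 𝒴)) :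
    ∃ R ∈ stdSimplex ℝ (𝒳 × 𝒴), (∀ p, P p = 0 → R p = 0) ∧
      renyiJ α P = ((miReal R + α / (1 - α) * klReal R P : ℝ) : EReal) := by
  obtain ⟨Q, hQ, T, hT, e⟩ := exists_renyiJ_eq hα hP
  have hM := (prodPmf_mem hQ hT).1
  obtain ⟨-, hS, he⟩ := renyiDiv_eq_normalize_tilt hα hα1.ne hP hM
    (e ▸ renyiJ_ne_top hα hP)
  -- The minimizer is the normalized tilt of an optimal product. Replacing `D(R‖Q T)` by the mutual
  -- information of `R` can only lower the value, and the upper bound closes the chain.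
  set R := fun x => tilt α P (prodPmf Q T) x / ∑ y, tilt α P (prodPmf Q T) y with hRdef
  have hR : R ∈ stdSimplex ℝ (𝒳 × 𝒴) := normalize_mem (tilt_nonneg hP.1 hM) hS
  have hz : ∀ x, (P x = 0 ∨ prodPmf Q T x = 0) → R x = 0 := fun x hx => by
    simp only [R]; rw [(tilt_eq_zero_iff hα hα1.ne hP.1 hM x).2 hx, zero_div]
  have h1 : ∀ p, P p = 0 → R p = 0 := fun x hx => hz x (Or.inl hx)
  refine ⟨R, hR, h1, le_antisymm (renyiJ_le_of_lt_one hα hα1 hP hR h1) ?_⟩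
  rw [e, he, EReal.coe_le_coe_iff]
  gcongr
  exact miReal_le_klReal hR hQ hT fun x hx => hz x (Or.inr hx)

theorem isLeast_dualObjective {α : ℝ} (hα : 0 < α) (hα1 : α < 1) {P : 𝒳 × 𝒴 → ℝ}
    (hP : P ∈ stdSimplex ℝ (𝒳 × 𝒴)) :
    IsLeast (dualObjective α P '' stdSimplex ℝ (𝒳 × 𝒴)) (renyiJ α P) := by
  constructor
  · obtain ⟨R, hR, h, e⟩ := exists_renyiJ_eq_of_lt_one hα hα1 hP
    exact ⟨R, hR, by rw [e, dualObjective_eq_coe hP hR h]⟩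
  · rintro _ ⟨R, hR, rfl⟩
    by_cases h : ∀ p, P p = 0 → R p = 0
    · rw [dualObjective_eq_coe hP hR h]
      exact renyiJ_le_of_lt_one hα hα1 hP hR h
    · rw [dualObjective_eq_top hα hα1 hP hR h]
      exact le_top

/-- Weak duality: every `R` bounds every product from below, because `I_R ≤ D(R‖Q T)`. If the
product does not dominate `P`, its divergence is `⊤`. -/
theorem le_renyiJ_of_one_lt {α : ℝ} (hα : 1 < α) {P R : 𝒳 × 𝒴 → ℝ}
    (hP : P ∈ stdSimplex ℝ (𝒳 × 𝒴)) (hR : R ∈ stdSimplex ℝ (𝒳 × 𝒴))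
    (h : ∀ p, P p = 0 → R p = 0) :
    ((miReal R + α / (1 - α) * klReal R P : ℝ) : EReal) ≤ renyiJ α P := by
  refine le_renyiJ fun Q hQ T hT => ?_
  have hM := (prodPmf_mem hQ hT).1
  by_cases h2 : ∀ p, prodPmf Q T p = 0 → P p = 0
  · refine le_trans ?_ (le_renyiDiv_of_one_lt hα hR hP.1 hM h)
    rw [EReal.coe_le_coe_iff]
    gcongr
    exact miReal_le_klReal hR hQ hT fun p hp => h p (h2 p hp)
  · rw [renyiDiv_eq_top_of_lt hα hP.1 h2]
    exact le_top

theorem dualObjective_le_renyiJ {α : ℝ} (hα : 1 < α) {P R : 𝒳 × 𝒴 → ℝ}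
    (hP : P ∈ stdSimplex ℝ (𝒳 × 𝒴)) (hR : R ∈ stdSimplex ℝ (𝒳 × 𝒴)) :
    dualObjective α P R ≤ renyiJ α P := by
  by_cases h : ∀ p, P p = 0 → R p = 0
  · rw [dualObjective_eq_coe hP hR h]
    exact le_renyiJ_of_one_lt hα hP hR h
  · rw [dualObjective_eq_bot hα hP hR h]
    exact bot_le

end Dual

/-! ### Sibson's identity and the optimal factor -/

section Sibson

/-- Distributivity can fail in `EReal` when opposite infinities meet; a real multiplier and one
finite summand prevent this. -/
theorem coe_mul_coe_add (c u : ℝ) (v : EReal) :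
    (c : EReal) * ((u : EReal) + v) = (c : EReal) * (u : EReal) + (c : EReal) * v := by
  rcases lt_trichotomy c 0 with h | h | h
  · induction v with
    | bot => rw [EReal.add_bot, EReal.coe_mul_bot_of_neg h, ← EReal.coe_mul, EReal.coe_add_top]
    | top => rw [EReal.coe_add_top, EReal.coe_mul_top_of_neg h, EReal.add_bot]
    | coe v => norm_cast; ring
  · simp [h]
  · induction v with
    | bot => rw [EReal.add_bot, EReal.coe_mul_bot_of_pos h, EReal.add_bot]
    | top => rw [EReal.coe_add_top, EReal.coe_mul_top_of_pos h, ← EReal.coe_mul, EReal.coe_add_top]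
    | coe v => norm_cast; ring

theorem coe_mul_cancel {c : ℝ} (hc : c ≠ 0) {v w : EReal} (h : (c : EReal) * v = (c : EReal) * w) :
    v = w := by
  have := congrArg (((c⁻¹ : ℝ) : EReal) * ·) h
  simpa only [← mul_assoc, ← EReal.coe_mul, inv_mul_cancel₀ hc, EReal.coe_one, one_mul] using this

theorem exists_coe_of_coe_mul {c : ℝ} (hc : c ≠ 0) {v : EReal} (hbot : (c : EReal) * v ≠ ⊥)
    (htop : (c : EReal) * v ≠ ⊤) : ∃ u : ℝ, v = u := by
  induction v with
  | bot =>
    rcases lt_or_gt_of_ne hc with h | h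
    · exact absurd (EReal.coe_mul_bot_of_neg h) htop
    · exact absurd (EReal.coe_mul_bot_of_pos h) hbot
  | top =>
    rcases lt_or_gt_of_ne hc with h | h
    · exact absurd (EReal.coe_mul_top_of_neg h) hbot
    · exact absurd (EReal.coe_mul_top_of_pos h) htop
  | coe v => exact ⟨v, rfl⟩

theorem mul_log_mono {c : ℝ} (hc : 0 ≤ c) {x y : ENNReal} (h : x ≤ y) :
    (c : EReal) * ENNReal.log x ≤ (c : EReal) * ENNReal.log y :=
  mul_le_mul_of_nonneg_left (ENNReal.log_le_log h) (by exact_mod_cast hc)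

theorem mul_log_anti {c : ℝ} (hc : c ≤ 0) {x y : ENNReal} (h : x ≤ y) :
    (c : EReal) * ENNReal.log y ≤ (c : EReal) * ENNReal.log x := by
  have := mul_log_mono (neg_nonneg.2 hc) h
  rwa [EReal.coe_neg, EReal.neg_mul, EReal.neg_mul, EReal.neg_le_neg_iff] at this

variable {ι : Type*} [Fintype ι]

/-- The normalization of `A ^ (1 / α)`. -/
noncomputable def escort (α : ℝ) (A : ι → ENNReal) : ι → ℝ :=
  fun x => (A x ^ (1 / α) / ∑ y, A y ^ (1 / α)).toReal

theorem ofReal_escort {α : ℝ} {A : ι → ENNReal} (h0 : ∑ y, A y ^ (1 / α) ≠ 0)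
    (h1 : ∑ y, A y ^ (1 / α) ≠ ⊤) (x : ι) :
    ENNReal.ofReal (escort α A x) = A x ^ (1 / α) / ∑ y, A y ^ (1 / α) := by
  rw [escort, ENNReal.ofReal_toReal]
  exact ENNReal.div_ne_top (ENNReal.sum_ne_top.1 h1 x (Finset.mem_univ x)) h0

theorem escort_mem {α : ℝ} {A : ι → ENNReal} (h0 : ∑ y, A y ^ (1 / α) ≠ 0)
    (h1 : ∑ y, A y ^ (1 / α) ≠ ⊤) : escort α A ∈ stdSimplex ℝ ι := by
  refine ⟨fun x => ENNReal.toReal_nonneg, ?_⟩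
  simp only [escort]
  rw [← ENNReal.toReal_sum fun x _ =>
    ENNReal.div_ne_top (ENNReal.sum_ne_top.1 h1 x (Finset.mem_univ x)) h0]
  simp only [div_eq_mul_inv]
  rw [← Finset.sum_mul, ENNReal.mul_inv_cancel (by simpa using h0) (by simpa using h1)]
  simp

/-- Inverting the normalization writes the weights as a constant times `escort^α`, so `∑ A T^(1-α)`
becomes a constant times the Rényi sum of the escort against `T`. -/
theorem eq_mul_escort {α : ℝ} (hα : 0 < α) {A : ι → ENNReal} (h0 : ∑ y, A y ^ (1 / α) ≠ 0)
    (h1 : ∑ y, A y ^ (1 / α) ≠ ⊤) (x : ι) :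
    A x = (∑ y, A y ^ (1 / α)) ^ α * ENNReal.ofReal (escort α A x) ^ α := by
  rw [ofReal_escort h0 h1, ← ENNReal.mul_rpow_of_nonneg _ _ hα.le,
    ENNReal.mul_div_cancel h0 h1, ← ENNReal.rpow_mul, one_div, inv_mul_cancel₀ hα.ne',
    ENNReal.rpow_one]

/-- Sibson's identity. -/
theorem mul_log_sum_eq {α : ℝ} (hα : 0 < α) (hα1 : α ≠ 1) {A : ι → ENNReal}
    (h0 : ∑ y, A y ^ (1 / α) ≠ 0) (h1 : ∑ y, A y ^ (1 / α) ≠ ⊤) (T : ι → ℝ) :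
    (((α - 1)⁻¹ : ℝ) : EReal) * ENNReal.log (∑ x, A x * ENNReal.ofReal (T x) ^ (1 - α))
      = ((α / (α - 1) : ℝ) : EReal) * ENNReal.log (∑ y, A y ^ (1 / α))
        + renyiDiv α (escort α A) T := by
  have e : ∑ x, A x * ENNReal.ofReal (T x) ^ (1 - α)
      = (∑ y, A y ^ (1 / α)) ^ α * renyiSum α (escort α A) T := by
    rw [renyiSum, Finset.mul_sum]
    refine Finset.sum_congr rfl fun x _ => ?_
    conv_lhs => rw [eq_mul_escort hα h0 h1 x]
    rw [mul_assoc]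
  rw [e, ENNReal.log_mul_add, ENNReal.log_rpow, renyiDiv_of_ne_one hα1,
    ENNReal.log_pos_real h0 h1]
  rw [← EReal.coe_mul, coe_mul_coe_add, ← EReal.coe_mul, ← EReal.coe_mul]
  congr 2
  field_simp

/-- Minimization of `(α - 1)⁻¹ * log ∑ A * T ^ (1 - α)` over probability mass functions `T`. -/
theorem isLeast_mul_log_sum [Nonempty ι] {α : ℝ} (hα : 0 < α) (hα1 : α ≠ 1) {A : ι → ENNReal}
    (hA : α < 1 → ∀ x, A x ≠ ⊤) :
    IsLeast ((fun T : ι → ℝ => (((α - 1)⁻¹ : ℝ) : EReal)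
        * ENNReal.log (∑ x, A x * ENNReal.ofReal (T x) ^ (1 - α))) '' stdSimplex ℝ ι)
      (((α / (α - 1) : ℝ) : EReal) * ENNReal.log (∑ y, A y ^ (1 / α))) := by
  by_cases h0 : ∑ y, A y ^ (1 / α) = 0
  · have hA0 : ∀ x, A x = 0 := fun x => by
      have := (Finset.sum_eq_zero_iff.1 h0) x (Finset.mem_univ x)
      exact (ENNReal.rpow_eq_zero_iff_of_pos (by positivity)).1 this
    have e : ∀ T : ι → ℝ, (((α - 1)⁻¹ : ℝ) : EReal)
        * ENNReal.log (∑ x, A x * ENNReal.ofReal (T x) ^ (1 - α))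
        = ((α / (α - 1) : ℝ) : EReal) * ENNReal.log (∑ y, A y ^ (1 / α)) := by
      intro T
      rw [h0]
      simp only [hA0, zero_mul, Finset.sum_const_zero, ENNReal.log_zero]
      rcases lt_or_gt_of_ne (sub_ne_zero.2 hα1) with h | h
      · rw [EReal.coe_mul_bot_of_neg (inv_lt_zero.2 h),
          EReal.coe_mul_bot_of_neg (div_neg_of_pos_of_neg hα h)]
      · rw [EReal.coe_mul_bot_of_pos (inv_pos.2 h), EReal.coe_mul_bot_of_pos (div_pos hα h)]
    refine ⟨⟨_, uniform_mem (𝒳 := ι), e _⟩, ?_⟩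
    rintro _ ⟨T, -, rfl⟩
    exact (e T).ge
  -- Some weight is infinite, which the hypothesis permits only for `α > 1`. A negative power of a
  -- finite number never vanishes, so the objective is `⊤` for every `T`.
  by_cases h1 : ∑ y, A y ^ (1 / α) = ⊤
  · obtain ⟨x, -, hx⟩ := ENNReal.sum_eq_top.1 h1
    have hAx : A x = ⊤ := (ENNReal.rpow_eq_top_iff_of_pos (by positivity)).1 hx
    have h : 1 < α := by
      by_contra! h
      exact hA (lt_of_le_of_ne h hα1) x hAx
    have e : ∀ T ∈ stdSimplex ℝ ι, (((α - 1)⁻¹ : ℝ) : EReal)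
        * ENNReal.log (∑ x, A x * ENNReal.ofReal (T x) ^ (1 - α))
        = ((α / (α - 1) : ℝ) : EReal) * ENNReal.log (∑ y, A y ^ (1 / α)) := by
      intro T hT
      have : ∑ x, A x * ENNReal.ofReal (T x) ^ (1 - α) = ⊤ := by
        refine ENNReal.sum_eq_top.2 ⟨x, Finset.mem_univ x, ?_⟩
        rw [hAx, ENNReal.top_mul]
        simp [ENNReal.rpow_eq_zero_iff, h.le]
      rw [h1, this, ENNReal.log_top, EReal.coe_mul_top_of_pos (inv_pos.2 (by linarith)),
        EReal.coe_mul_top_of_pos (div_pos hα (by linarith))]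
    refine ⟨⟨_, uniform_mem (𝒳 := ι), e _ uniform_mem⟩, ?_⟩
    rintro _ ⟨T, hT, rfl⟩
    exact (e T hT).ge
  · refine ⟨⟨escort α A, escort_mem h0 h1, ?_⟩, ?_⟩
    · simp only
      rw [mul_log_sum_eq hα hα1 h0 h1, renyiDiv_self hα (escort_mem h0 h1), add_zero]
    · rintro _ ⟨T, hT, rfl⟩
      simp only
      rw [mul_log_sum_eq hα hα1 h0 h1]
      exact le_add_of_nonneg_right (renyiDiv_nonneg hα (escort_mem h0 h1) hT).1

end Sibson

/-! ### Minimization over one factor, and the variational formula above order one -/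

section Reduced

variable {𝒳 𝒴 : Type*} [Fintype 𝒳] [Fintype 𝒴]

/-- The sum over the first coordinate in the reduced objective. -/
noncomputable def innerSum (α : ℝ) (P : 𝒳 × 𝒴 → ℝ) (Q : 𝒳 → ℝ) : 𝒴 → ENNReal :=
  fun y => ∑ x, ENNReal.ofReal (P (x, y)) ^ α * ENNReal.ofReal (Q x) ^ (1 - α)

theorem ofReal_mul_rpow {a b : ℝ} (ha : 0 ≤ a) (r : ℝ) :
    ENNReal.ofReal (a * b) ^ r = ENNReal.ofReal a ^ r * ENNReal.ofReal b ^ r := by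
  rw [ENNReal.ofReal_mul ha, ENNReal.mul_rpow_of_ne_top ENNReal.ofReal_ne_top
    ENNReal.ofReal_ne_top]

theorem renyiSum_prodPmf (α : ℝ) (P : 𝒳 × 𝒴 → ℝ) {Q : 𝒳 → ℝ} (hQ : ∀ x, 0 ≤ Q x) (T : 𝒴 → ℝ) :
    renyiSum α P (prodPmf Q T)
      = ∑ y, innerSum α P Q y * ENNReal.ofReal (T y) ^ (1 - α) := by
  rw [renyiSum, Fintype.sum_prod_type_right]
  refine Finset.sum_congr rfl fun y _ => ?_
  rw [innerSum, Finset.sum_mul]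
  refine Finset.sum_congr rfl fun x _ => ?_
  rw [prodPmf, ofReal_mul_rpow (hQ x), mul_assoc]

/-- With `Q` fixed, the divergence is Sibson's functional of `T` with weights `innerSum α P Q`. -/
theorem isLeast_reducedObjective {α : ℝ} (hα : 0 < α) (hα1 : α ≠ 1) {P : 𝒳 × 𝒴 → ℝ}
    (hP : P ∈ stdSimplex ℝ (𝒳 × 𝒴)) {Q : 𝒳 → ℝ} (hQ : ∀ x, 0 ≤ Q x) :
    IsLeast ((fun T => renyiDiv α P (prodPmf Q T)) '' stdSimplex ℝ 𝒴)
      (reducedObjective α P Q) := by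
  obtain ⟨p, -⟩ := simplex_exists_pos hP
  have : Nonempty 𝒴 := ⟨p.2⟩
  have e : (fun T => renyiDiv α P (prodPmf Q T)) = fun T : 𝒴 → ℝ => (((α - 1)⁻¹ : ℝ) : EReal)
        * ENNReal.log (∑ x, innerSum α P Q x * ENNReal.ofReal (T x) ^ (1 - α)) := by
    funext T
    rw [renyiDiv_of_ne_one hα1, renyiSum_prodPmf α P hQ T]
  rw [e]
  refine isLeast_mul_log_sum hα hα1 fun h y => ENNReal.sum_ne_top.2 fun x _ => ?_
  exact ENNReal.mul_ne_top (ENNReal.rpow_ne_top_of_nonneg hα.le ENNReal.ofReal_ne_top)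
    (ENNReal.rpow_ne_top_of_nonneg (by linarith) ENNReal.ofReal_ne_top)

theorem isLeast_renyiJ_reducedObjective {α : ℝ} (hα : 0 < α) (hα1 : α ≠ 1) {P : 𝒳 × 𝒴 → ℝ}
    (hP : P ∈ stdSimplex ℝ (𝒳 × 𝒴)) :
    IsLeast (reducedObjective α P '' stdSimplex ℝ 𝒳) (renyiJ α P) := by
  have hlb : ∀ Q ∈ stdSimplex ℝ 𝒳, renyiJ α P ≤ reducedObjective α P Q := by
    intro Q hQ
    obtain ⟨T, hT, e⟩ := (isLeast_reducedObjective hα hα1 hP hQ.1).1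
    rw [← e]
    exact renyiJ_le hQ hT
  refine ⟨?_, ?_⟩
  · obtain ⟨Q, hQ, T, hT, e⟩ := exists_renyiJ_eq hα hP
    refine ⟨Q, hQ, le_antisymm ?_ (hlb Q hQ)⟩
    rw [e]
    exact (isLeast_reducedObjective hα hα1 hP hQ.1).2 ⟨T, hT, rfl⟩
  · rintro _ ⟨Q, hQ, rfl⟩
    exact hlb Q hQ

/-- At a minimizing `T`, the normalized tilted measure has second marginal `T`. -/
theorem margSnd_normalize_tilt {α : ℝ} (hα : 0 < α) (hα1 : α ≠ 1) {P : 𝒳 × 𝒴 → ℝ}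
    (hP : P ∈ stdSimplex ℝ (𝒳 × 𝒴)) {Q : 𝒳 → ℝ} {T : 𝒴 → ℝ} (hQ : Q ∈ stdSimplex ℝ 𝒳)
    (hT : T ∈ stdSimplex ℝ 𝒴) (h : renyiJ α P = renyiDiv α P (prodPmf Q T)) :
    margSnd (fun p => tilt α P (prodPmf Q T) p / ∑ q, tilt α P (prodPmf Q T) q) = T := by
  have hM := (prodPmf_mem hQ hT).1
  obtain ⟨hor, hS, -⟩ := renyiDiv_eq_normalize_tilt hα hα1 hP hM (h ▸ renyiJ_ne_top hα hP)
  have hmem := normalize_mem (tilt_nonneg (α := α) hP.1 hM) hS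
  set A := innerSum α P Q with hAdef
  have hred : reducedObjective α P Q = renyiJ α P := by
    refine le_antisymm ?_ ((isLeast_renyiJ_reducedObjective hα hα1 hP).2 ⟨Q, hQ, rfl⟩)
    rw [h]
    exact (isLeast_reducedObjective hα hα1 hP hQ.1).2 ⟨T, hT, rfl⟩
  have hfin : ((α / (α - 1) : ℝ) : EReal) * ENNReal.log (∑ y, A y ^ (1 / α))
      = (((renyiJ α P).toReal : ℝ) : EReal) := by
    rw [coe_toReal_renyiJ hα hP, ← hred]; rfl
  have hne : α - 1 ≠ 0 := sub_ne_zero.2 hα1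
  have h0 : ∑ y, A y ^ (1 / α) ≠ 0 := by
    intro h0
    rw [h0, ENNReal.log_zero] at hfin
    rcases lt_or_gt_of_ne hne with h | h
    · rw [EReal.coe_mul_bot_of_neg (div_neg_of_pos_of_neg hα h)] at hfin
      exact EReal.coe_ne_top _ hfin.symm
    · rw [EReal.coe_mul_bot_of_pos (div_pos hα h)] at hfin
      exact EReal.coe_ne_bot _ hfin.symm
  have h1 : ∑ y, A y ^ (1 / α) ≠ ⊤ := by
    intro h0
    rw [h0, ENNReal.log_top] at hfin
    rcases lt_or_gt_of_ne hne with h | h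
    · rw [EReal.coe_mul_top_of_neg (div_neg_of_pos_of_neg hα h)] at hfin
      exact EReal.coe_ne_bot _ hfin.symm
    · rw [EReal.coe_mul_top_of_pos (div_pos hα h)] at hfin
      exact EReal.coe_ne_top _ hfin.symm
  -- Uniqueness of the optimal factor: both sides of Sibson's identity have the same finite value at
  -- `T`, leaving `D_α(escort‖T) = 0`.
  have hE : escort α A = T := by
    have e := mul_log_sum_eq hα hα1 h0 h1 T
    rw [hfin, ← renyiSum_prodPmf α P hQ.1 T, ← renyiDiv_of_ne_one hα1, ← h,
      ← coe_toReal_renyiJ hα hP] at e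
    have h3 := (renyiDiv_nonneg hα (escort_mem h0 h1) hT)
    refine h3.2 ?_
    generalize renyiDiv α (escort α A) T = v at e h3
    induction v with
    | bot => simp at h3
    | top => rw [EReal.coe_add_top] at e; exact absurd e (EReal.coe_ne_top _)
    | coe v =>
      norm_cast at e ⊢
      rw [EReal.toReal_coe] at e
      linarith
  -- The inner sum is a constant times `T^α`, and the tilt contributes `T^(1-α)`, so the marginal is
  -- proportional to `T`. Both being PMFs after normalization, the factor is one.
  have key : ∀ y, margSnd (tilt α P (prodPmf Q T)) y
      = ((∑ y, A y ^ (1 / α)) ^ α).toReal * T y := by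
    intro y
    have e : ENNReal.ofReal (margSnd (tilt α P (prodPmf Q T)) y)
        = (∑ y, A y ^ (1 / α)) ^ α * ENNReal.ofReal (T y) := by
      rw [margSnd, ENNReal.ofReal_sum_of_nonneg fun x _ => tilt_nonneg hP.1 hM _]
      have : ∀ x, ENNReal.ofReal (tilt α P (prodPmf Q T) (x, y))
          = ENNReal.ofReal (P (x, y)) ^ α * ENNReal.ofReal (Q x) ^ (1 - α)
            * ENNReal.ofReal (T y) ^ (1 - α) := fun x => by
        rw [ofReal_tilt hα hP.1 hM (hor.imp_right fun h => h _), prodPmf, ofReal_mul_rpow (hQ.1 x),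
          mul_assoc]
      simp only [this]
      rw [← Finset.sum_mul]
      change A y * _ = _
      rw [eq_mul_escort hα h0 h1 y, hE, mul_assoc]
      congr 1
      rcases (hT.1 y).eq_or_lt with hz | hpos
      · rw [← hz]; simp [hα]
      · rw [← ENNReal.rpow_add _ _ (by simpa using hpos) ENNReal.ofReal_ne_top]
        simp
    have e2 := congrArg ENNReal.toReal e
    have hm : 0 ≤ margSnd (tilt α P (prodPmf Q T)) y :=
      Finset.sum_nonneg fun x _ => tilt_nonneg hP.1 hM _
    rwa [ENNReal.toReal_ofReal hm,
      ENNReal.toReal_mul, ENNReal.toReal_ofReal (hT.1 y)] at e2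
  have key2 : ∀ y, margSnd (fun p => tilt α P (prodPmf Q T) p / ∑ q, tilt α P (prodPmf Q T) q) y
      = ((∑ y, A y ^ (1 / α)) ^ α).toReal / (∑ q, tilt α P (prodPmf Q T) q) * T y := by
    intro y
    rw [div_mul_eq_mul_div, ← key y, margSnd, margSnd, Finset.sum_div]
  have hsum := (margSnd_mem hmem).2
  simp only [key2] at hsum
  rw [← Finset.mul_sum, hT.2, mul_one] at hsum
  funext y
  rw [key2, hsum, one_mul]

theorem margFst_normalize_tilt {α : ℝ} (hα : 0 < α) (hα1 : α ≠ 1) {P : 𝒳 × 𝒴 → ℝ}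
    (hP : P ∈ stdSimplex ℝ (𝒳 × 𝒴)) {Q : 𝒳 → ℝ} {T : 𝒴 → ℝ} (hQ : Q ∈ stdSimplex ℝ 𝒳)
    (hT : T ∈ stdSimplex ℝ 𝒴) (h : renyiJ α P = renyiDiv α P (prodPmf Q T)) :
    margFst (fun p => tilt α P (prodPmf Q T) p / ∑ q, tilt α P (prodPmf Q T) q) = Q := by
  rw [← renyiJ_swap, ← renyiDiv_swap] at h
  have := margSnd_normalize_tilt hα hα1 (comp_swap_mem hP) hT hQ h
  rw [prodPmf_swap] at this
  have e : ∑ q, tilt α (P ∘ Prod.swap) (prodPmf Q T ∘ Prod.swap) q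
      = ∑ q, tilt α P (prodPmf Q T) q :=
    (Equiv.prodComm 𝒴 𝒳).sum_comp fun q => tilt α P (prodPmf Q T) q
  rw [e] at this
  exact this

/-- The variational formula for orders above one, with the maximizer related to a minimizing
product measure. -/
theorem exists_renyiJ_eq_of_one_lt {α : ℝ} (hα : 1 < α) {P : 𝒳 × 𝒴 → ℝ}
    (hP : P ∈ stdSimplex ℝ (𝒳 × 𝒴)) :
    ∃ R ∈ stdSimplex ℝ (𝒳 × 𝒴), (∀ p, P p = 0 → R p = 0) ∧
      renyiJ α P = ((miReal R + α / (1 - α) * klReal R P : ℝ) : EReal) ∧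
      renyiJ α P = renyiDiv α P (prodPmf (margFst R) (margSnd R)) := by
  have hα0 : 0 < α := by linarith
  obtain ⟨Q, hQ, T, hT, e⟩ := exists_renyiJ_eq hα0 hP
  have hM := (prodPmf_mem hQ hT).1
  obtain ⟨-, hS, he⟩ := renyiDiv_eq_normalize_tilt hα0 hα.ne' hP hM
    (e ▸ renyiJ_ne_top hα0 hP)
  refine ⟨_, normalize_mem (tilt_nonneg hP.1 hM) hS, fun p hp => ?_, ?_, ?_⟩
  · rw [(tilt_eq_zero_iff hα0 hα.ne' hP.1 hM p).2 (Or.inl hp), zero_div]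
  -- Since the marginals of the tilt are `Q` and `T`, its relative entropy to the product is its
  -- mutual information.
  · rw [miReal, margFst_normalize_tilt hα0 hα.ne' hP hQ hT e,
      margSnd_normalize_tilt hα0 hα.ne' hP hQ hT e, e]
    exact he
  · rw [margFst_normalize_tilt hα0 hα.ne' hP hQ hT e,
      margSnd_normalize_tilt hα0 hα.ne' hP hQ hT e]
    exact e

theorem isGreatest_dualObjective {α : ℝ} (hα : 1 < α) {P : 𝒳 × 𝒴 → ℝ}
    (hP : P ∈ stdSimplex ℝ (𝒳 × 𝒴)) :
    IsGreatest (dualObjective α P '' stdSimplex ℝ (𝒳 × 𝒴)) (renyiJ α P) := by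
  constructor
  · obtain ⟨R, hR, h, e, -⟩ := exists_renyiJ_eq_of_one_lt hα hP
    exact ⟨R, hR, by rw [e, dualObjective_eq_coe hP hR h]⟩
  · rintro _ ⟨R, hR, rfl⟩
    exact dualObjective_le_renyiJ hα hP hR

end Reduced

/-! ### Strict concavity of the dual objective and its maximizer -/

section StrictConcavity

variable {𝒳 𝒴 : Type*} [Fintype 𝒳] [Fintype 𝒴]

/-- The joint entropy enters with coefficient `-1` from the mutual information and `α/(α-1)` from
the relative entropy, in total `1/(α-1) > 0`. -/
theorem dual_eq_negMulLog {α : ℝ} (hα : 1 < α) {P R : 𝒳 × 𝒴 → ℝ}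
    (hR : ∀ p, 0 ≤ R p) (h : ∀ p, P p = 0 → R p = 0) :
    miReal R + α / (1 - α) * klReal R P
      = ∑ x, Real.negMulLog (margFst R x) + ∑ y, Real.negMulLog (margSnd R y)
        + ∑ p, ((α - 1)⁻¹ * Real.negMulLog (R p) + α / (α - 1) * (R p * Real.log (P p))) := by
  have hk : klReal R P = -∑ p, Real.negMulLog (R p) - ∑ p, R p * Real.log (P p) := by
    rw [klReal, ← Finset.sum_neg_distrib, ← Finset.sum_sub_distrib]
    refine Finset.sum_congr rfl fun p _ => ?_
    by_cases h0 : R p = 0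
    · simp [h0]
    · rw [Real.log_div h0 fun h' => h0 (h p h'), Real.negMulLog]
      ring
  have h1 : α - 1 ≠ 0 := by linarith
  have h2 : α / (1 - α) = -(α / (α - 1)) := by rw [← div_neg]; ring_nf
  rw [miReal_eq_negMulLog hR, hk, Finset.sum_add_distrib, ← Finset.mul_sum, ← Finset.mul_sum, h2]
  generalize ∑ x, Real.negMulLog (margFst R x) = a
  generalize ∑ x, Real.negMulLog (margSnd R x) = b
  generalize ∑ x, Real.negMulLog (R x) = c
  generalize ∑ p, R p * Real.log (P p) = d
  field_simp
  ring

/-- The marginal entropies are only used as concave, since distinct joint laws may share marginals;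
strictness comes from the joint entropy at a point where the two laws differ. -/
theorem dual_lt_of_ne {α : ℝ} (hα : 1 < α) {P R S : 𝒳 × 𝒴 → ℝ}
    (hR : ∀ p, 0 ≤ R p) (hR0 : ∀ p, P p = 0 → R p = 0)
    (hS : ∀ p, 0 ≤ S p) (hS0 : ∀ p, P p = 0 → S p = 0) (hne : R ≠ S) {a b : ℝ} (ha : 0 < a)
    (hb : 0 < b) (hab : a + b = 1) :
    a * (miReal R + α / (1 - α) * klReal R P) + b * (miReal S + α / (1 - α) * klReal S P)
      < miReal (a • R + b • S) + α / (1 - α) * klReal (a • R + b • S) P := by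
  have hm : ∀ p, 0 ≤ (a • R + b • S) p := fun p =>
    add_nonneg (mul_nonneg ha.le (hR p)) (mul_nonneg hb.le (hS p))
  rw [dual_eq_negMulLog hα hR hR0, dual_eq_negMulLog hα hS hS0, dual_eq_negMulLog hα hm
    fun p hp => by simp [hR0 p hp, hS0 p hp]]
  have conc : ∀ u v : ℝ, 0 ≤ u → 0 ≤ v →
      a * Real.negMulLog u + b * Real.negMulLog v ≤ Real.negMulLog (a * u + b * v) :=
    fun u v hu hv => Real.concaveOn_negMulLog.2 hu hv ha.le hb.le hab
  have e1 : ∑ x, (a * Real.negMulLog (margFst R x) + b * Real.negMulLog (margFst S x))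
      ≤ ∑ x, Real.negMulLog (margFst (a • R + b • S) x) := by
    refine Finset.sum_le_sum fun x _ => ?_
    have : margFst (a • R + b • S) x = a * margFst R x + b * margFst S x := by
      simp [margFst, Finset.sum_add_distrib, Finset.mul_sum]
    rw [this]
    exact conc _ _ (Finset.sum_nonneg fun _ _ => hR _) (Finset.sum_nonneg fun _ _ => hS _)
  have e2 : ∑ x, (a * Real.negMulLog (margSnd R x) + b * Real.negMulLog (margSnd S x))
      ≤ ∑ x, Real.negMulLog (margSnd (a • R + b • S) x) := by
    refine Finset.sum_le_sum fun x _ => ?_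
    have : margSnd (a • R + b • S) x = a * margSnd R x + b * margSnd S x := by
      simp [margSnd, Finset.sum_add_distrib, Finset.mul_sum]
    rw [this]
    exact conc _ _ (Finset.sum_nonneg fun _ _ => hR _) (Finset.sum_nonneg fun _ _ => hS _)
  have hα' : 0 < (α - 1)⁻¹ := inv_pos.2 (by linarith)
  have e3 : ∑ p, (a * ((α - 1)⁻¹ * Real.negMulLog (R p) + α / (α - 1) * (R p * Real.log (P p)))
        + b * ((α - 1)⁻¹ * Real.negMulLog (S p) + α / (α - 1) * (S p * Real.log (P p))))
      < ∑ p, ((α - 1)⁻¹ * Real.negMulLog ((a • R + b • S) p)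
        + α / (α - 1) * ((a • R + b • S) p * Real.log (P p))) := by
    have ev : ∀ p, (a • R + b • S) p = a * R p + b * S p := fun p => by simp
    obtain ⟨p, hp⟩ := Function.ne_iff.1 hne
    refine Finset.sum_lt_sum (fun q _ => ?_) ⟨p, Finset.mem_univ p, ?_⟩
    · have := mul_le_mul_of_nonneg_left (conc _ _ (hR q) (hS q)) hα'.le
      rw [ev]
      linear_combination this
    · have := mul_lt_mul_of_pos_left
        (Real.strictConcaveOn_negMulLog.2 (hR p) (hS p) hp ha hb hab) hα'
      simp only [smul_eq_mul] at this
      rw [ev]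
      linear_combination this
  rw [Finset.sum_add_distrib, ← Finset.mul_sum, ← Finset.mul_sum] at e1 e2 e3
  linarith

theorem convex_combination_mem {ι : Type*} [Fintype ι] {R S : ι → ℝ} (hR : R ∈ stdSimplex ℝ ι)
    (hS : S ∈ stdSimplex ℝ ι) {a b : ℝ} (ha : 0 ≤ a) (hb : 0 ≤ b) (hab : a + b = 1) :
    a • R + b • S ∈ stdSimplex ℝ ι :=
  convex_stdSimplex ℝ ι hR hS ha hb hab

theorem eStrictConcaveOn_dualObjective {α : ℝ} (hα : 1 < α) {P : 𝒳 × 𝒴 → ℝ}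
    (hP : P ∈ stdSimplex ℝ (𝒳 × 𝒴)) :
    EStrictConcaveOn (stdSimplex ℝ (𝒳 × 𝒴)) (dualObjective α P) := by
  have strict : ∀ R ∈ stdSimplex ℝ (𝒳 × 𝒴), dualObjective α P R ≠ ⊥ →
      ∀ S ∈ stdSimplex ℝ (𝒳 × 𝒴), dualObjective α P S ≠ ⊥ → R ≠ S → ∀ a b : ℝ, 0 < a → 0 < b →
      a + b = 1 → (a : EReal) * dualObjective α P R + (b : EReal) * dualObjective α P S
        < dualObjective α P (a • R + b • S) := by
    intro R hR hRb S hS hSb hne a b ha hb hab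
    have hR0 : ∀ p, P p = 0 → R p = 0 := by
      by_contra h
      exact hRb (dualObjective_eq_bot hα hP hR h)
    have hS0 : ∀ p, P p = 0 → S p = 0 := by
      by_contra h
      exact hSb (dualObjective_eq_bot hα hP hS h)
    rw [dualObjective_eq_coe hP hR hR0, dualObjective_eq_coe hP hS hS0, dualObjective_eq_coe hP
      (convex_combination_mem hR hS ha.le hb.le hab) fun p hp => by simp [hR0 p hp, hS0 p hp]]
    exact_mod_cast dual_lt_of_ne hα hR.1 hR0 hS.1 hS0 hne ha hb hab
  refine ⟨⟨convex_stdSimplex ℝ _, ?_⟩, fun R hR hRb S hS hSb hne a b ha hb hab =>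
    strict R hR hRb S hS hSb hne a b ha hb hab⟩
  intro R hR S hS a b ha hb hab
  rcases ha.eq_or_lt with rfl | ha'
  · have : b = 1 := by linarith
    subst this
    simp
  rcases hb.eq_or_lt with rfl | hb'
  · have : a = 1 := by linarith
    subst this
    simp
  by_cases hRb : dualObjective α P R = ⊥
  · rw [hRb, EReal.coe_mul_bot_of_pos ha', EReal.bot_add]
    exact bot_le
  by_cases hSb : dualObjective α P S = ⊥
  · rw [hSb, EReal.coe_mul_bot_of_pos hb', EReal.add_bot]
    exact bot_le
  by_cases hne : R = S
  · subst hne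
    have e : a • R + b • R = R := by rw [← add_smul, hab, one_smul]
    rw [e, ← EReal.right_distrib_of_nonneg (by exact_mod_cast ha) (by exact_mod_cast hb),
      ← EReal.coe_add, hab]
    simp
  · exact (strict R hR hRb S hS hSb hne a b ha' hb' hab).le

/-- By strict concavity a maximizer must be the one already constructed, whose marginals attain
`J_α`. Conversely `J_α ≤ D_α(P‖R_X R_Y)`, so equality puts the value at `R` above every other dual
value. -/
theorem isMaxOn_dualObjective_iff {α : ℝ} (hα : 1 < α) {P R : 𝒳 × 𝒴 → ℝ}
    (hP : P ∈ stdSimplex ℝ (𝒳 × 𝒴)) (hR : R ∈ stdSimplex ℝ (𝒳 × 𝒴)) :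
    IsMaxOn (dualObjective α P) (stdSimplex ℝ (𝒳 × 𝒴)) R ↔
      dualObjective α P R = renyiDiv α P (prodPmf (margFst R) (margSnd R)) := by
  have hα0 : 0 < α := by linarith
  constructor
  · intro hmax
    obtain ⟨S, hS, hS0, e1, e2⟩ := exists_renyiJ_eq_of_one_lt hα hP
    have hSd : dualObjective α P S = renyiJ α P := by rw [e1, dualObjective_eq_coe hP hS hS0]
    have hRd : dualObjective α P R = renyiJ α P :=
      le_antisymm (dualObjective_le_renyiJ hα hP hR) (hSd ▸ isMaxOn_iff.1 hmax S hS)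
    have hbot : renyiJ α P ≠ ⊥ := ne_bot_of_le_ne_bot (by simp) (renyiJ_nonneg hα0 hP)
    by_cases hne : R = S
    · rw [hRd, hne, e2]
    · have h := (eStrictConcaveOn_dualObjective hα hP).2 hR (hRd ▸ hbot) hS (hSd ▸ hbot) hne
        (show (0 : ℝ) < 1 / 2 by norm_num) (show (0 : ℝ) < 1 / 2 by norm_num) (by norm_num)
      have h2 := h.trans_le (dualObjective_le_renyiJ hα hP
        (convex_combination_mem hR hS (a := 1 / 2) (b := 1 / 2) (by norm_num) (by norm_num)
          (by norm_num)))
      rw [hRd, hSd, ← coe_toReal_renyiJ hα0 hP] at h2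
      norm_cast at h2
      linarith
  · intro h
    refine isMaxOn_iff.2 fun S hS => (dualObjective_le_renyiJ hα hP hS).trans ?_
    rw [h]
    exact renyiJ_le (margFst_mem hR) (margSnd_mem hR)

end StrictConcavity

/-! ### Cardinality bounds, monotonicity and continuity in the order -/

section Order

variable {𝒳 𝒴 : Type*} [Fintype 𝒳] [Fintype 𝒴]

/-- Taking `R = P` removes the relative entropy term. -/
theorem renyiJ_le_miReal_of_lt_one {α : ℝ} (hα : 0 < α) (hα1 : α < 1) {P : 𝒳 × 𝒴 → ℝ}
    (hP : P ∈ stdSimplex ℝ (𝒳 × 𝒴)) : renyiJ α P ≤ ((miReal P : ℝ) : EReal) := by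
  have := renyiJ_le_of_lt_one hα hα1 hP hP fun _ h => h
  rwa [klReal_self, mul_zero, add_zero] at this

theorem miReal_le_renyiJ_of_one_lt {α : ℝ} (hα : 1 < α) {P : 𝒳 × 𝒴 → ℝ}
    (hP : P ∈ stdSimplex ℝ (𝒳 × 𝒴)) : ((miReal P : ℝ) : EReal) ≤ renyiJ α P := by
  have := le_renyiJ_of_one_lt hα hP hP fun _ h => h
  rwa [klReal_self, mul_zero, add_zero] at this

theorem renyiJ_le_log_card {α : ℝ} (hα : 0 < α) {P : 𝒳 × 𝒴 → ℝ}
    (hP : P ∈ stdSimplex ℝ (𝒳 × 𝒴)) :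
    renyiJ α P ≤ ((Real.log (Fintype.card 𝒳) : ℝ) : EReal) := by
  rcases lt_trichotomy α 1 with h1 | h1 | h1
  · exact (renyiJ_le_miReal_of_lt_one hα h1 hP).trans (by exact_mod_cast miReal_le_log_card hP)
  · rw [h1, renyiJ_one hP]
    exact_mod_cast miReal_le_log_card hP
  · obtain ⟨R, hR, h, e, -⟩ := exists_renyiJ_eq_of_one_lt h1 hP
    rw [e, EReal.coe_le_coe_iff]
    have h2 := miReal_le_log_card hR
    have h3 : α / (1 - α) * klReal R P ≤ 0 :=
      mul_nonpos_of_nonpos_of_nonneg (div_nonpos_of_nonneg_of_nonpos hα.le (by linarith))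
        (klReal_nonneg hR hP h)
    linarith

theorem renyiJ_le_log_card_right {α : ℝ} (hα : 0 < α) {P : 𝒳 × 𝒴 → ℝ}
    (hP : P ∈ stdSimplex ℝ (𝒳 × 𝒴)) :
    renyiJ α P ≤ ((Real.log (Fintype.card 𝒴) : ℝ) : EReal) := by
  rw [← renyiJ_swap]
  exact renyiJ_le_log_card hα (comp_swap_mem hP)

/-- Positivity of the product says that both orders lie on the same side of the pole at `1`. -/
theorem div_one_sub_mono {α β : ℝ} (h : α ≤ β) (h1 : 0 < (1 - α) * (1 - β)) :
    α / (1 - α) ≤ β / (1 - β) := by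
  have ha : 1 - α ≠ 0 := left_ne_zero_of_mul h1.ne'
  have hb : 1 - β ≠ 0 := right_ne_zero_of_mul h1.ne'
  have : β / (1 - β) - α / (1 - α) = (β - α) / ((1 - α) * (1 - β)) := by
    field_simp
    ring
  have h2 := div_nonneg (sub_nonneg.2 h) h1.le
  linarith

/-- Below one, the minimizer for the larger order is tested at the smaller; above one, the maximizer
for the smaller is tested at the larger. Orders on opposite sides are separated by the mutual
information. -/
theorem monotoneOn_renyiJ {P : 𝒳 × 𝒴 → ℝ} (hP : P ∈ stdSimplex ℝ (𝒳 × 𝒴)) :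
    MonotoneOn (fun α : ℝ => renyiJ α P) (Set.Ioi 0) := by
  intro α hα β hβ hαβ
  simp only [Set.mem_Ioi] at hα hβ
  simp only
  rcases hαβ.eq_or_lt with rfl | hlt
  · exact le_rfl
  rcases lt_or_ge β 1 with hb | hb
  · obtain ⟨R, hR, h, e⟩ := exists_renyiJ_eq_of_lt_one hβ hb hP
    have ha : α < 1 := hlt.trans hb
    refine (renyiJ_le_of_lt_one hα ha hP hR h).trans ?_
    rw [e, EReal.coe_le_coe_iff]
    have := mul_le_mul_of_nonneg_right
      (div_one_sub_mono hαβ (mul_pos (by linarith) (by linarith))) (klReal_nonneg hR hP h)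
    linarith
  · rcases le_or_gt α 1 with ha | ha
    · have h1 : renyiJ α P ≤ ((miReal P : ℝ) : EReal) := by
        rcases ha.eq_or_lt with rfl | ha
        · exact (renyiJ_one hP).le
        · exact renyiJ_le_miReal_of_lt_one hα ha hP
      refine h1.trans ?_
      rcases hb.eq_or_lt with rfl | hb
      · exact (renyiJ_one hP).ge
      · exact miReal_le_renyiJ_of_one_lt hb hP
    · obtain ⟨R, hR, h, e, -⟩ := exists_renyiJ_eq_of_one_lt ha hP
      have hb' : 1 < β := ha.trans hlt
      refine le_trans ?_ (le_renyiJ_of_one_lt hb' hP hR h)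
      rw [e, EReal.coe_le_coe_iff]
      have := mul_le_mul_of_nonneg_right
        (div_one_sub_mono hαβ (mul_pos_of_neg_of_neg (by linarith) (by linarith)))
        (klReal_nonneg hR hP h)
      linarith

/-- For orders close to one, `renyiJ` is controlled by a measure close to `P`. -/
theorem exists_near {α : ℝ} (hα : 0 < α) {P : 𝒳 × 𝒴 → ℝ} (hP : P ∈ stdSimplex ℝ (𝒳 × 𝒴)) :
    ∃ R ∈ stdSimplex ℝ (𝒳 × 𝒴),
      ∑ p, (√(R p) - √(P p)) ^ 2 ≤ Real.log (Fintype.card 𝒳) * (|1 - α| / α) ∧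
      |(renyiJ α P).toReal - miReal P| ≤ |miReal R - miReal P| := by
  have hL : 0 ≤ Real.log (Fintype.card 𝒳) := (miReal_nonneg hP).trans (miReal_le_log_card hP)
  have hcoe := coe_toReal_renyiJ hα hP
  rcases lt_trichotomy α 1 with h1 | h1 | h1
  -- Here `J = I_R + c D(R‖P)` with `c = α/(1-α)`; from `I_R ≥ 0` and `J ≤ log |𝒳|` follows `D(R‖P)
  -- ≤ log |𝒳| / c`. Moreover `J` lies between `I_R` and `I_P`. Above order one, the same works with
  -- `J ≥ 0` and `I_R ≤ log |𝒳|`.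
  · obtain ⟨R, hR, h, e⟩ := exists_renyiJ_eq_of_lt_one hα h1 hP
    have hle := renyiJ_le_miReal_of_lt_one hα h1 hP
    have hJL := renyiJ_le_log_card hα hP
    rw [← hcoe, EReal.coe_le_coe_iff] at hle hJL
    rw [← hcoe, EReal.coe_eq_coe_iff] at e
    have hk := klReal_nonneg hR hP h
    have hm := miReal_nonneg hR
    have hc : 0 < α / (1 - α) := div_pos hα (by linarith)
    refine ⟨R, hR, (hellinger_le_klReal hR hP h).trans ?_, ?_⟩
    · rw [abs_of_pos (by linarith), ← inv_div α, ← div_eq_mul_inv, le_div_iff₀ hc]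
      linarith
    · have := mul_nonneg hc.le hk
      rw [abs_of_nonpos (by linarith), abs_of_nonpos (by linarith)]
      linarith
  · refine ⟨P, hP, ?_, ?_⟩
    · simpa using by positivity
    · rw [h1, renyiJ_one hP, EReal.toReal_coe]
  · obtain ⟨R, hR, h, e, -⟩ := exists_renyiJ_eq_of_one_lt h1 hP
    have hle := miReal_le_renyiJ_of_one_lt h1 hP
    have hJ0 := renyiJ_nonneg hα hP
    rw [← hcoe, EReal.coe_le_coe_iff] at hle
    rw [← hcoe] at hJ0
    rw [← hcoe, EReal.coe_eq_coe_iff] at e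
    have hJ0 : 0 ≤ (renyiJ α P).toReal := by exact_mod_cast hJ0
    have hk := klReal_nonneg hR hP h
    have hm := miReal_le_log_card hR
    have hc : 0 < α / (α - 1) := div_pos hα (by linarith)
    have hneg : α / (1 - α) = -(α / (α - 1)) := by rw [← div_neg]; ring_nf
    rw [hneg] at e
    refine ⟨R, hR, (hellinger_le_klReal hR hP h).trans ?_, ?_⟩
    · rw [abs_of_neg (by linarith), neg_sub, ← inv_div α, ← div_eq_mul_inv, le_div_iff₀ hc]
      linarith
    · have := mul_nonneg hc.le hk
      rw [abs_of_nonneg (by linarith), abs_of_nonneg (by linarith)]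
      linarith

theorem continuousOn_miReal :
    ContinuousOn (miReal : (𝒳 × 𝒴 → ℝ) → ℝ) (stdSimplex ℝ (𝒳 × 𝒴)) := by
  have : Continuous fun R : 𝒳 × 𝒴 → ℝ => ∑ x, Real.negMulLog (margFst R x)
      + ∑ y, Real.negMulLog (margSnd R y) - ∑ p, Real.negMulLog (R p) := by
    have h := Real.continuous_negMulLog
    unfold margFst margSnd
    fun_prop
  exact this.continuousOn.congr fun R hR => miReal_eq_negMulLog hR.1

open Filter Topology in
theorem continuousAt_toReal_renyiJ_one {P : 𝒳 × 𝒴 → ℝ} (hP : P ∈ stdSimplex ℝ (𝒳 × 𝒴)) :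
    ContinuousAt (fun α : ℝ => (renyiJ α P).toReal) 1 := by
  have hex : ∀ α : ℝ, ∃ R ∈ stdSimplex ℝ (𝒳 × 𝒴), 0 < α →
      ∑ p, (√(R p) - √(P p)) ^ 2 ≤ Real.log (Fintype.card 𝒳) * (|1 - α| / α) ∧
      |(renyiJ α P).toReal - miReal P| ≤ |miReal R - miReal P| := by
    intro α
    by_cases hα : 0 < α
    · obtain ⟨R, hR, h⟩ := exists_near hα hP
      exact ⟨R, hR, fun _ => h⟩
    · exact ⟨P, hP, fun h => absurd h hα⟩
  choose R hR hRα using hex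
  have hev : ∀ᶠ α : ℝ in 𝓝 1, 0 < α := lt_mem_nhds one_pos
  have hlim : Tendsto (fun α : ℝ => Real.log (Fintype.card 𝒳) * (|1 - α| / α)) (𝓝 1) (𝓝 0) := by
    have : ContinuousAt (fun α : ℝ => Real.log (Fintype.card 𝒳) * (|1 - α| / α)) 1 := by
      fun_prop (disch := norm_num)
    simpa [ContinuousAt] using this
  have hRlim : Tendsto R (𝓝 1) (𝓝 P) := by
    refine tendsto_pi_nhds.2 fun p => ?_
    have hsq : Tendsto (fun α => (√(R α p) - √(P p)) ^ 2) (𝓝 1) (𝓝 0) := by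
      refine squeeze_zero' (Eventually.of_forall fun _ => sq_nonneg _) ?_ hlim
      filter_upwards [hev] with α hα
      exact (Finset.single_le_sum (f := fun p => (√(R α p) - √(P p)) ^ 2)
        (fun q _ => sq_nonneg _) (Finset.mem_univ p)).trans (hRα α hα).1
    have hab : Tendsto (fun α => √(R α p) - √(P p)) (𝓝 1) (𝓝 0) := by
      have := (Real.continuous_sqrt.tendsto 0).comp hsq
      simp only [Function.comp_def, Real.sqrt_sq_eq_abs, Real.sqrt_zero] at this
      exact (tendsto_zero_iff_abs_tendsto_zero _).2 this
    have hs : Tendsto (fun α => √(R α p)) (𝓝 1) (𝓝 (√(P p))) := by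
      simpa using hab.add_const (√(P p))
    have := hs.pow 2
    simp only [Real.sq_sqrt ((hR _).1 p), Real.sq_sqrt (hP.1 p)] at this
    exact this
  have hmi : Tendsto (fun α => miReal (R α)) (𝓝 1) (𝓝 (miReal P)) :=
    ((continuousOn_miReal P hP).tendsto).comp
      (tendsto_nhdsWithin_iff.2 ⟨hRlim, Eventually.of_forall hR⟩)
  have h1 : (renyiJ 1 P).toReal = miReal P := by rw [renyiJ_one hP, EReal.toReal_coe]
  rw [ContinuousAt, h1, tendsto_iff_norm_sub_tendsto_zero]
  refine squeeze_zero' (Eventually.of_forall fun _ => norm_nonneg _) ?_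
    (tendsto_iff_norm_sub_tendsto_zero.1 hmi)
  filter_upwards [hev] with α hα
  exact (hRα α hα).2

/-- The parameter is `c = α/(1-α)`, in which the variational formula is a minimum of affine
functions. Concavity on an open interval then gives continuity. -/
theorem concaveOn_renyiJ {P : 𝒳 × 𝒴 → ℝ} (hP : P ∈ stdSimplex ℝ (𝒳 × 𝒴)) :
    ConcaveOn ℝ (Set.Ioi 0) fun c : ℝ => (renyiJ (c / (1 + c)) P).toReal := by
  have hα : ∀ c : ℝ, 0 < c → 0 < c / (1 + c) ∧ c / (1 + c) < 1 ∧
      c / (1 + c) / (1 - c / (1 + c)) = c := by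
    intro c hc
    refine ⟨by positivity, by rw [div_lt_one (by positivity)]; linarith, ?_⟩
    have : 1 - c / (1 + c) = 1 / (1 + c) := by field_simp; ring
    rw [this]
    field_simp
  refine ⟨convex_Ioi 0, fun c hc d hd a b ha hb hab => ?_⟩
  have hm : 0 < a • c + b • d := convex_Ioi (0 : ℝ) hc hd ha hb hab
  obtain ⟨R, hR, h, e⟩ := exists_renyiJ_eq_of_lt_one (hα _ hm).1 (hα _ hm).2.1 hP
  have h1 := renyiJ_le_of_lt_one (hα c hc).1 (hα c hc).2.1 hP hR h
  have h2 := renyiJ_le_of_lt_one (hα d hd).1 (hα d hd).2.1 hP hR h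
  rw [← coe_toReal_renyiJ (hα _ hm).1 hP, (hα _ hm).2.2, EReal.coe_eq_coe_iff] at e
  rw [← coe_toReal_renyiJ (hα c hc).1 hP, (hα c hc).2.2, EReal.coe_le_coe_iff] at h1
  rw [← coe_toReal_renyiJ (hα d hd).1 hP, (hα d hd).2.2, EReal.coe_le_coe_iff] at h2
  simp only
  rw [e]
  simp only [smul_eq_mul]
  have h3 := mul_le_mul_of_nonneg_left h1 ha
  have h4 := mul_le_mul_of_nonneg_left h2 hb
  have : miReal R = a * miReal R + b * miReal R := by rw [← add_mul, hab, one_mul]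
  linarith

/-- With `c = α/(α-1)`, a maximum of affine functions of `c` with slopes `-D(R‖P)`. -/
theorem convexOn_renyiJ {P : 𝒳 × 𝒴 → ℝ} (hP : P ∈ stdSimplex ℝ (𝒳 × 𝒴)) :
    ConvexOn ℝ (Set.Ioi 1) fun c : ℝ => (renyiJ (c / (c - 1)) P).toReal := by
  have hα : ∀ c : ℝ, 1 < c → 1 < c / (c - 1) ∧
      c / (c - 1) / (1 - c / (c - 1)) = -c := by
    intro c hc
    have h1 : 0 < c - 1 := by linarith
    refine ⟨by rw [one_lt_div h1]; linarith, ?_⟩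
    have : 1 - c / (c - 1) = -1 / (c - 1) := by field_simp; ring
    rw [this]
    field_simp
  have hα0 : ∀ c : ℝ, 1 < c → 0 < c / (c - 1) := fun c hc => one_pos.trans (hα c hc).1
  refine ⟨convex_Ioi 1, fun c hc d hd a b ha hb hab => ?_⟩
  have hm : 1 < a • c + b • d := convex_Ioi (1 : ℝ) hc hd ha hb hab
  obtain ⟨R, hR, h, e, -⟩ := exists_renyiJ_eq_of_one_lt (hα _ hm).1 hP
  have h1 := le_renyiJ_of_one_lt (hα c hc).1 hP hR h
  have h2 := le_renyiJ_of_one_lt (hα d hd).1 hP hR h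
  rw [← coe_toReal_renyiJ (hα0 _ hm) hP, (hα _ hm).2, EReal.coe_eq_coe_iff] at e
  rw [← coe_toReal_renyiJ (hα0 c hc) hP, (hα c hc).2, EReal.coe_le_coe_iff] at h1
  rw [← coe_toReal_renyiJ (hα0 d hd) hP, (hα d hd).2, EReal.coe_le_coe_iff] at h2
  simp only
  rw [e]
  simp only [smul_eq_mul]
  have h3 := mul_le_mul_of_nonneg_left h1 ha
  have h4 := mul_le_mul_of_nonneg_left h2 hb
  have : miReal R = a * miReal R + b * miReal R := by rw [← add_mul, hab, one_mul]
  linarith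

theorem continuousOn_toReal_renyiJ {P : 𝒳 × 𝒴 → ℝ} (hP : P ∈ stdSimplex ℝ (𝒳 × 𝒴)) :
    ContinuousOn (fun α : ℝ => (renyiJ α P).toReal) (Set.Ioi 0) := by
  intro α hα
  refine ContinuousAt.continuousWithinAt ?_
  simp only [Set.mem_Ioi] at hα
  rcases lt_trichotomy α 1 with h1 | h1 | h1
  · have hc := (concaveOn_renyiJ hP).continuousOn isOpen_Ioi
    have hpos : 0 < α / (1 - α) := div_pos hα (by linarith)
    have hca := hc.continuousAt (isOpen_Ioi.mem_nhds hpos)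
    have hg : ContinuousAt (fun α : ℝ => α / (1 - α)) α := by
      fun_prop (disch := linarith)
    refine (ContinuousAt.comp (f := fun α : ℝ => α / (1 - α)) hca hg).congr ?_
    filter_upwards [isOpen_Iio.mem_nhds h1] with β hβ
    have hβ' : 1 - β ≠ 0 := by simp only [Set.mem_Iio] at hβ; linarith
    have : β / (1 - β) / (1 + β / (1 - β)) = β := by field_simp; ring
    simp only [Function.comp, this]
  · rw [h1]
    exact continuousAt_toReal_renyiJ_one hP
  · have hc := (convexOn_renyiJ hP).continuousOn isOpen_Ioi
    have hpos : 1 < α / (α - 1) := by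
      rw [one_lt_div (by linarith)]
      linarith
    have hca := hc.continuousAt (isOpen_Ioi.mem_nhds hpos)
    have hg : ContinuousAt (fun α : ℝ => α / (α - 1)) α := by
      fun_prop (disch := linarith)
    refine (ContinuousAt.comp (f := fun α : ℝ => α / (α - 1)) hca hg).congr ?_
    filter_upwards [isOpen_Ioi.mem_nhds h1] with β hβ
    have hβ' : β - 1 ≠ 0 := by simp only [Set.mem_Ioi] at hβ; linarith
    have : β / (β - 1) / (β / (β - 1) - 1) = β := by field_simp; ring
    simp only [Function.comp, this]

theorem continuousOn_renyiJ {P : 𝒳 × 𝒴 → ℝ} (hP : P ∈ stdSimplex ℝ (𝒳 × 𝒴)) :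
    ContinuousOn (fun α : ℝ => renyiJ α P) (Set.Ioi 0) :=
  (continuous_coe_real_ereal.comp_continuousOn (continuousOn_toReal_renyiJ hP)).congr
    fun _ hα => (coe_toReal_renyiJ hα hP).symm

end Order

/-! ### Hölder inequalities and data processing for the Rényi divergence -/

section Holder

variable {ι : Type*} [Fintype ι]

theorem sum_rpow_mul_rpow_le {a b : ℝ} (ha : 0 < a) (hb : 0 < b) (hab : a + b = 1)
    (u v : ι → ENNReal) :
    ∑ i, u i ^ a * v i ^ b ≤ (∑ i, u i) ^ a * (∑ i, v i) ^ b := by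
  have hpq : (1 / a).HolderConjugate (1 / b) := by
    refine (Real.holderConjugate_iff).2 ⟨?_, by simpa using hab⟩
    rw [one_lt_div ha]
    linarith
  have h := ENNReal.inner_le_Lp_mul_Lq Finset.univ (fun i => u i ^ a) (fun i => v i ^ b) hpq
  simpa [← ENNReal.rpow_mul, mul_inv_cancel₀ ha.ne', mul_inv_cancel₀ hb.ne'] using h

/-- Reversed Hölder inequality, from the usual one applied to `p = (p^α q^(1-α))^(1/α) q^(1-1/α)`.
This factorization needs `p = 0` where `q = 0`, which holds when the right side is finite. -/
theorem sum_rpow_mul_rpow_ge {α : ℝ} (hα : 1 < α) {p q : ι → ENNReal} (hq : ∀ i, q i ≠ ⊤) :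
    (∑ i, p i) ^ α * (∑ i, q i) ^ (1 - α) ≤ ∑ i, p i ^ α * q i ^ (1 - α) := by
  have hα0 : 0 < α := by linarith
  by_cases htop : ∑ i, p i ^ α * q i ^ (1 - α) = ⊤
  · rw [htop]
    exact le_top
  have hfin := ENNReal.sum_ne_top.1 htop
  have hzero : ∀ i, q i = 0 → p i = 0 := by
    intro i hi
    by_contra h
    refine hfin i (Finset.mem_univ i) ?_
    rw [hi, ENNReal.zero_rpow_of_neg (by linarith), ENNReal.mul_top]
    simp [ENNReal.rpow_eq_zero_iff, h, hα0.not_gt]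
  by_cases hV : ∑ i, q i = 0
  · have : ∀ i, p i = 0 := fun i => hzero i ((Finset.sum_eq_zero_iff.1 hV) i (Finset.mem_univ i))
    simp [this, hα0]
  have hVt : ∑ i, q i ≠ ⊤ := ENNReal.sum_ne_top.2 fun i _ => hq i
  have hterm : ∀ i, p i = (p i ^ α * q i ^ (1 - α)) ^ (1 / α) * q i ^ (1 - 1 / α) := by
    intro i
    by_cases hi : q i = 0
    · simp [hzero i hi, hα0]
    · rw [ENNReal.mul_rpow_of_nonneg _ _ (by positivity), ← ENNReal.rpow_mul, ← ENNReal.rpow_mul,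
        mul_assoc, ← ENNReal.rpow_add _ _ hi (hq i)]
      have e1 : α * (1 / α) = 1 := by field_simp
      have e2 : (1 - α) * (1 / α) + (1 - 1 / α) = 0 := by field_simp; ring
      rw [e1, e2, ENNReal.rpow_one, ENNReal.rpow_zero, mul_one]
  have h1a : 1 / α < 1 := by rw [div_lt_one hα0]; exact hα
  have h := sum_rpow_mul_rpow_le (a := 1 / α) (b := 1 - 1 / α) (by positivity) (by linarith)
    (by ring) (fun i => p i ^ α * q i ^ (1 - α)) q
  simp only [← hterm] at h
  have h2 := ENNReal.rpow_le_rpow h hα0.le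
  rw [ENNReal.mul_rpow_of_nonneg _ _ hα0.le, ← ENNReal.rpow_mul, ← ENNReal.rpow_mul] at h2
  have e1 : 1 / α * α = 1 := by field_simp
  have e2 : (1 - 1 / α) * α = α - 1 := by field_simp
  rw [e1, e2, ENNReal.rpow_one] at h2
  calc (∑ i, p i) ^ α * (∑ i, q i) ^ (1 - α)
      ≤ (∑ i, p i ^ α * q i ^ (1 - α)) * (∑ i, q i) ^ (α - 1) * (∑ i, q i) ^ (1 - α) := by
        gcongr
    _ = ∑ i, p i ^ α * q i ^ (1 - α) := by
        rw [mul_assoc, ← ENNReal.rpow_add _ _ hV hVt]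
        simp

theorem inv_sub_one_neg {α : ℝ} (h : α < 1) : (α - 1)⁻¹ ≤ 0 := inv_nonpos.2 (by linarith)

/-- Data-processing inequality for the Rényi divergence. -/
theorem renyiDiv_kernel_le {κ : Type*} [Fintype κ] {α : ℝ} (hα : 0 < α) (hα1 : α ≠ 1)
    {P Q : ι → ℝ} (hP : ∀ i, 0 ≤ P i) (hQ : ∀ i, 0 ≤ Q i) {K : ι → κ → ℝ}
    (hK : ∀ i, K i ∈ stdSimplex ℝ κ) :
    renyiDiv α (fun k => ∑ i, P i * K i k) (fun k => ∑ i, Q i * K i k) ≤ renyiDiv α P Q := by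
  have hsum : ∀ P : ι → ℝ, (∀ i, 0 ≤ P i) → ∀ k, ENNReal.ofReal (∑ i, P i * K i k)
      = ∑ i, ENNReal.ofReal (P i * K i k) := fun P hP k =>
    ENNReal.ofReal_sum_of_nonneg fun i _ => mul_nonneg (hP i) ((hK i).1 k)
  -- The powers `α` and `1 - α` of the kernel recombine to `K i k`, which sums to one over `k`; only
  -- a Hölder inequality over `i`, for each `k`, remains.
  have hterm : ∀ i k, ENNReal.ofReal (P i * K i k) ^ α * ENNReal.ofReal (Q i * K i k) ^ (1 - α)
      = ENNReal.ofReal (P i) ^ α * ENNReal.ofReal (Q i) ^ (1 - α) * ENNReal.ofReal (K i k) := by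
    intro i k
    rw [ofReal_mul_rpow (hP i), ofReal_mul_rpow (hQ i)]
    rcases ((hK i).1 k).eq_or_lt with h0 | hpos
    · rw [← h0]; simp [hα]
    · rw [mul_mul_mul_comm, ← ENNReal.rpow_add _ _ (by simpa using hpos) ENNReal.ofReal_ne_top]
      simp
  have htot : ∑ k, ∑ i, ENNReal.ofReal (P i * K i k) ^ α * ENNReal.ofReal (Q i * K i k) ^ (1 - α)
      = renyiSum α P Q := by
    rw [Finset.sum_comm, renyiSum]
    refine Finset.sum_congr rfl fun i _ => ?_
    simp only [hterm]
    rw [← Finset.mul_sum, ← ENNReal.ofReal_sum_of_nonneg fun k _ => (hK i).1 k, (hK i).2]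
    simp
  rw [renyiDiv_of_ne_one hα1, renyiDiv_of_ne_one hα1]
  rcases lt_or_gt_of_ne hα1 with h | h
  · refine mul_log_anti (inv_sub_one_neg h) ?_
    rw [← htot]
    refine Finset.sum_le_sum fun k _ => ?_
    rw [hsum P hP, hsum Q hQ]
    exact sum_rpow_mul_rpow_le hα (by linarith) (by ring) _ _
  · refine mul_log_mono (inv_nonneg.2 (by linarith)) ?_
    rw [← htot]
    refine Finset.sum_le_sum fun k _ => ?_
    rw [hsum P hP, hsum Q hQ]
    exact sum_rpow_mul_rpow_ge h fun i => ENNReal.ofReal_ne_top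

end Holder

/-! ### Data processing for `J_α` -/

section DataProcessing

variable {𝒳 𝒴 𝒵 : Type*} [Fintype 𝒳] [Fintype 𝒴] [Fintype 𝒵]

theorem sum_mul_kernel_mem {ι κ : Type*} [Fintype ι] [Fintype κ] {P : ι → ℝ}
    (hP : P ∈ stdSimplex ℝ ι) {K : ι → κ → ℝ} (hK : ∀ i, K i ∈ stdSimplex ℝ κ) :
    (fun k => ∑ i, P i * K i k) ∈ stdSimplex ℝ κ :=
  ⟨fun k => Finset.sum_nonneg fun i _ => mul_nonneg (hP.1 i) ((hK i).1 k), by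
    rw [Finset.sum_comm]
    simp [← Finset.mul_sum, (hK _).2, hP.2]⟩

open Filter Topology in
-- Carries relations proved for orders above one to order one.
theorem tendsto_toReal_renyiJ_one {P : 𝒳 × 𝒴 → ℝ} (hP : P ∈ stdSimplex ℝ (𝒳 × 𝒴)) :
    Tendsto (fun α : ℝ => (renyiJ α P).toReal) (𝓝[>] 1) (𝓝 (renyiJ 1 P).toReal) :=
  (continuousAt_toReal_renyiJ_one hP).tendsto.mono_left nhdsWithin_le_nhds

theorem renyiJ_kernel_le_of_ne_one {α : ℝ} (hα : 0 < α) (hα1 : α ≠ 1) {P : 𝒳 × 𝒴 → ℝ}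
    (hP : P ∈ stdSimplex ℝ (𝒳 × 𝒴)) {V : 𝒴 → 𝒵 → ℝ} (hV : ∀ y, V y ∈ stdSimplex ℝ 𝒵) :
    renyiJ α (fun p : 𝒳 × 𝒵 => ∑ y, P (p.1, y) * V y p.2) ≤ renyiJ α P := by
  classical
  obtain ⟨Q, hQ, T, hT, e⟩ := exists_renyiJ_eq hα hP
  rw [e]
  refine (renyiJ_le hQ (sum_mul_kernel_mem hT hV)).trans ?_
  -- The kernel keeps the first coordinate and applies `V` to the second, so it maps product laws to
  -- product laws.
  let K : 𝒳 × 𝒴 → 𝒳 × 𝒵 → ℝ := fun p r => if p.1 = r.1 then V p.2 r.2 else 0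
  have hK : ∀ p, K p ∈ stdSimplex ℝ (𝒳 × 𝒵) := fun p =>
    ⟨fun r => by simp only [K]; split_ifs; exacts [(hV _).1 _, le_rfl], by
      rw [Fintype.sum_prod_type_right]
      simp [K, (hV _).2]⟩
  have hpush : ∀ R : 𝒳 × 𝒴 → ℝ, (fun r => ∑ p, R p * K p r)
      = fun r => ∑ y, R (r.1, y) * V y r.2 := by
    intro R
    funext r
    rw [Fintype.sum_prod_type_right]
    simp [K]
  have h := renyiDiv_kernel_le hα hα1 hP.1 (prodPmf_mem hQ hT).1 hK
  rw [hpush, hpush] at h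
  convert h using 2
  funext r
  simp [prodPmf, Finset.mul_sum, mul_assoc]

theorem renyiJ_kernel_le {α : ℝ} (hα : 0 < α) {P : 𝒳 × 𝒴 → ℝ}
    (hP : P ∈ stdSimplex ℝ (𝒳 × 𝒴)) {V : 𝒴 → 𝒵 → ℝ} (hV : ∀ y, V y ∈ stdSimplex ℝ 𝒵)
    (hPV : (fun p : 𝒳 × 𝒵 => ∑ y, P (p.1, y) * V y p.2) ∈ stdSimplex ℝ (𝒳 × 𝒵)) :
    renyiJ α (fun p : 𝒳 × 𝒵 => ∑ y, P (p.1, y) * V y p.2) ≤ renyiJ α P := by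
  by_cases hα1 : α = 1
  · subst hα1
    have h := le_of_tendsto_of_tendsto (tendsto_toReal_renyiJ_one hPV)
      (tendsto_toReal_renyiJ_one hP) (by
        filter_upwards [self_mem_nhdsWithin] with α hα'
        have h0 : (0 : ℝ) < α := one_pos.trans hα'
        have := renyiJ_kernel_le_of_ne_one h0 (ne_of_gt hα') hP hV
        rwa [← coe_toReal_renyiJ h0 hP, ← coe_toReal_renyiJ h0 hPV, EReal.coe_le_coe_iff] at this)
    rwa [← coe_toReal_renyiJ one_pos hP, ← coe_toReal_renyiJ one_pos hPV, EReal.coe_le_coe_iff]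
  · exact renyiJ_kernel_le_of_ne_one hα hα1 hP hV

end DataProcessing

/-! ### Additivity over independent pairs -/

section Additivity

variable {𝒳₁ 𝒳₂ 𝒴₁ 𝒴₂ : Type*} [Fintype 𝒳₁] [Fintype 𝒳₂] [Fintype 𝒴₁] [Fintype 𝒴₂]

/-- The joint probability mass function of two independent pairs, regrouped. -/
def prodJoint {𝒳₁ 𝒳₂ 𝒴₁ 𝒴₂ : Type*} (P₁ : 𝒳₁ × 𝒴₁ → ℝ) (P₂ : 𝒳₂ × 𝒴₂ → ℝ) :
    (𝒳₁ × 𝒳₂) × (𝒴₁ × 𝒴₂) → ℝ :=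
  fun p => P₁ (p.1.1, p.2.1) * P₂ (p.1.2, p.2.2)

theorem sum_prodProdProd {M : Type*} [AddCommMonoid M] (F : (𝒳₁ × 𝒳₂) × (𝒴₁ × 𝒴₂) → M) :
    ∑ p, F p = ∑ p₁ : 𝒳₁ × 𝒴₁, ∑ p₂ : 𝒳₂ × 𝒴₂, F ((p₁.1, p₂.1), (p₁.2, p₂.2)) := by
  rw [← Fintype.sum_prod_type']
  exact ((Equiv.prodProdProdComm 𝒳₁ 𝒴₁ 𝒳₂ 𝒴₂).sum_comp F).symm

theorem prodJoint_mem {P₁ : 𝒳₁ × 𝒴₁ → ℝ} {P₂ : 𝒳₂ × 𝒴₂ → ℝ} (h₁ : P₁ ∈ stdSimplex ℝ (𝒳₁ × 𝒴₁))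
    (h₂ : P₂ ∈ stdSimplex ℝ (𝒳₂ × 𝒴₂)) :
    prodJoint P₁ P₂ ∈ stdSimplex ℝ ((𝒳₁ × 𝒳₂) × (𝒴₁ × 𝒴₂)) :=
  ⟨fun p => mul_nonneg (h₁.1 _) (h₂.1 _), by
    rw [sum_prodProdProd]
    simp [prodJoint, ← Finset.mul_sum, h₁.2, h₂.2]⟩

/-- A chain rule: the second factors may depend on the first coordinates, so it covers arbitrary
`Q_X`, `Q_Y` after disintegration. -/
theorem renyiSum_prodJoint (α : ℝ) {P₁ : 𝒳₁ × 𝒴₁ → ℝ} {P₂ : 𝒳₂ × 𝒴₂ → ℝ}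
    (h₁ : ∀ p, 0 ≤ P₁ p) {Q₁ : 𝒳₁ → ℝ} {q : 𝒳₁ → 𝒳₂ → ℝ} {T₁ : 𝒴₁ → ℝ} {t : 𝒴₁ → 𝒴₂ → ℝ}
    (hQ : ∀ x, 0 ≤ Q₁ x) (hT : ∀ x, 0 ≤ T₁ x) :
    renyiSum α (prodJoint P₁ P₂) (prodPmf (fun x => Q₁ x.1 * q x.1 x.2)
        fun y => T₁ y.1 * t y.1 y.2)
      = ∑ p, ENNReal.ofReal (P₁ p) ^ α * ENNReal.ofReal (prodPmf Q₁ T₁ p) ^ (1 - α)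
        * renyiSum α P₂ (prodPmf (q p.1) (t p.2)) := by
  rw [renyiSum, sum_prodProdProd]
  refine Finset.sum_congr rfl fun p₁ _ => ?_
  rw [renyiSum, Finset.mul_sum]
  refine Finset.sum_congr rfl fun p₂ _ => ?_
  simp only [prodJoint, prodPmf]
  rw [mul_mul_mul_comm (Q₁ p₁.1), ofReal_mul_rpow (h₁ _),
    ofReal_mul_rpow (mul_nonneg (hQ _) (hT _)), mul_mul_mul_comm]

theorem exists_conditional {ι κ : Type*} [Fintype κ] [Nonempty κ] {Q : ι × κ → ℝ}
    (hQ : ∀ p, 0 ≤ Q p) : ∃ q : ι → κ → ℝ, (∀ i, q i ∈ stdSimplex ℝ κ) ∧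
      Q = fun p => margFst Q p.1 * q p.1 p.2 := by
  have : ∀ i, ∃ q ∈ stdSimplex ℝ κ, ∀ k, Q (i, k) = margFst Q i * q k := by
    intro i
    by_cases h : margFst Q i = 0
    -- Where the marginal vanishes any conditional law serves; the uniform one is the default.
    · refine ⟨_, uniform_mem, fun k => ?_⟩
      rw [h, zero_mul]
      exact eq_zero_of_margFst hQ h
    · refine ⟨fun k => Q (i, k) / margFst Q i, ⟨fun k => div_nonneg (hQ _)
        (Finset.sum_nonneg fun _ _ => hQ _), ?_⟩, fun k => by field_simp⟩
      rw [← Finset.sum_div]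
      exact div_self h
  choose q hq hq' using this
  exact ⟨q, hq, funext fun p => hq' p.1 p.2⟩

/-- Products of optimal factors give `≤`. For `≥`, disintegrate arbitrary factors: each conditional
inner sum is no better than the optimal one for `P₂`, and the marginals are no better than the
optimum for `P₁`. -/
theorem renyiJ_prodJoint_of_ne_one {α : ℝ} (hα : 0 < α) (hα1 : α ≠ 1) {P₁ : 𝒳₁ × 𝒴₁ → ℝ}
    {P₂ : 𝒳₂ × 𝒴₂ → ℝ} (h₁ : P₁ ∈ stdSimplex ℝ (𝒳₁ × 𝒴₁)) (h₂ : P₂ ∈ stdSimplex ℝ (𝒳₂ × 𝒴₂)) :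
    renyiJ α (prodJoint P₁ P₂) = renyiJ α P₁ + renyiJ α P₂ := by
  obtain ⟨Q₁, hQ₁, T₁, hT₁, e₁⟩ := exists_renyiJ_eq hα h₁
  obtain ⟨Q₂, hQ₂, T₂, hT₂, e₂⟩ := exists_renyiJ_eq hα h₂
  have e₂' := e₂
  rw [renyiDiv_of_ne_one hα1] at e₂'
  have hc : (α - 1)⁻¹ ≠ 0 := inv_ne_zero (sub_ne_zero.2 hα1)
  obtain ⟨u, hu⟩ := exists_coe_of_coe_mul hc
    (e₂' ▸ ne_bot_of_le_ne_bot (by simp) (renyiJ_nonneg hα h₂)) (e₂' ▸ renyiJ_ne_top hα h₂)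
  refine le_antisymm ?_ (le_renyiJ fun Q hQ T hT => ?_)
  · have hQ : (fun x : 𝒳₁ × 𝒳₂ => Q₁ x.1 * Q₂ x.2) ∈ stdSimplex ℝ (𝒳₁ × 𝒳₂) :=
      prodPmf_mem hQ₁ hQ₂
    have hT : (fun x : 𝒴₁ × 𝒴₂ => T₁ x.1 * T₂ x.2) ∈ stdSimplex ℝ (𝒴₁ × 𝒴₂) :=
      prodPmf_mem hT₁ hT₂
    refine (renyiJ_le hQ hT).trans_eq ?_
    rw [renyiDiv_of_ne_one hα1, renyiSum_prodJoint (q := fun _ => Q₂) (t := fun _ => T₂) α h₁.1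
      hQ₁.1 hT₁.1, ← Finset.sum_mul, ENNReal.log_mul_add, hu,
      add_comm _ (u : EReal), coe_mul_coe_add, ← hu,
      ← e₂', e₁, add_comm, renyiDiv_of_ne_one hα1, renyiSum]
  · obtain ⟨p, -⟩ := simplex_exists_pos h₂
    have : Nonempty 𝒳₂ := ⟨p.1⟩
    have : Nonempty 𝒴₂ := ⟨p.2⟩
    obtain ⟨q, hq, eQ⟩ := exists_conditional hQ.1
    obtain ⟨t, ht, eT⟩ := exists_conditional hT.1
    rw [eQ, eT, renyiDiv_of_ne_one hα1, renyiSum_prodJoint α h₁.1 (margFst_mem hQ).1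
      (margFst_mem hT).1]
    have hle : renyiJ α P₁ ≤ renyiDiv α P₁ (prodPmf (margFst Q) (margFst T)) :=
      renyiJ_le (margFst_mem hQ) (margFst_mem hT)
    have hmin : ∀ x y, (((α - 1)⁻¹ : ℝ) : EReal) * ENNReal.log (renyiSum α P₂ (prodPmf Q₂ T₂))
        ≤ (((α - 1)⁻¹ : ℝ) : EReal) * ENNReal.log (renyiSum α P₂ (prodPmf (q x) (t y))) := by
      intro x y
      rw [← e₂', ← renyiDiv_of_ne_one hα1]
      exact renyiJ_le (hq x) (ht y)
    have heq : renyiDiv α P₁ (prodPmf (margFst Q) (margFst T)) + renyiJ α P₂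
        = (((α - 1)⁻¹ : ℝ) : EReal) * ENNReal.log
          (∑ p, ENNReal.ofReal (P₁ p) ^ α *
            ENNReal.ofReal (prodPmf (margFst Q) (margFst T) p) ^ (1 - α)
              * renyiSum α P₂ (prodPmf Q₂ T₂)) := by
      rw [← Finset.sum_mul, ENNReal.log_mul_add, hu,
      add_comm _ (u : EReal), coe_mul_coe_add, ← hu,
        ← e₂', add_comm, renyiDiv_of_ne_one hα1, renyiSum]
    refine (add_le_add_left hle _).trans ?_
    rw [heq]
    rcases lt_or_gt_of_ne hα1 with h | h
    · refine mul_log_anti (inv_sub_one_neg h) (Finset.sum_le_sum fun p _ => ?_)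
      gcongr
      -- The inequality `hmin` compares multiples of logarithms; injectivity of the logarithm and a
      -- nonzero multiplier turn it into one between the Rényi sums.
      by_contra! hlt
      have hneg : (α - 1)⁻¹ < 0 := inv_lt_zero.2 (by linarith)
      have h1 := mul_log_anti hneg.le hlt.le
      have h2 := le_antisymm h1 (hmin p.1 p.2)
      exact hlt.ne (ENNReal.log_injective (coe_mul_cancel hc h2)).symm
    · refine mul_log_mono (inv_nonneg.2 (by linarith)) (Finset.sum_le_sum fun p _ => ?_)
      gcongr
      by_contra! hlt
      have h1 := mul_log_mono (inv_nonneg.2 (by linarith : 0 ≤ α - 1)) hlt.le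
      have h2 := le_antisymm h1 (hmin p.1 p.2)
      exact hlt.ne (ENNReal.log_injective (coe_mul_cancel hc h2))

theorem renyiJ_prodJoint {α : ℝ} (hα : 0 < α) {P₁ : 𝒳₁ × 𝒴₁ → ℝ}
    {P₂ : 𝒳₂ × 𝒴₂ → ℝ} (h₁ : P₁ ∈ stdSimplex ℝ (𝒳₁ × 𝒴₁)) (h₂ : P₂ ∈ stdSimplex ℝ (𝒳₂ × 𝒴₂)) :
    renyiJ α (prodJoint P₁ P₂) = renyiJ α P₁ + renyiJ α P₂ := by
  by_cases hα1 : α = 1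
  · subst hα1
    have h := tendsto_nhds_unique ((tendsto_toReal_renyiJ_one (prodJoint_mem h₁ h₂)).congr' (by
        filter_upwards [self_mem_nhdsWithin] with α hα'
        have h0 : (0 : ℝ) < α := one_pos.trans hα'
        have := renyiJ_prodJoint_of_ne_one h0 (ne_of_gt hα') h₁ h₂
        rwa [← coe_toReal_renyiJ h0 h₁, ← coe_toReal_renyiJ h0 h₂, ← coe_toReal_renyiJ h0
          (prodJoint_mem h₁ h₂), ← EReal.coe_add, EReal.coe_eq_coe_iff] at this))
      ((tendsto_toReal_renyiJ_one h₁).add (tendsto_toReal_renyiJ_one h₂))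
    rwa [← coe_toReal_renyiJ one_pos h₁, ← coe_toReal_renyiJ one_pos h₂, ← coe_toReal_renyiJ one_pos
          (prodJoint_mem h₁ h₂), ← EReal.coe_add, EReal.coe_eq_coe_iff]
  · exact renyiJ_prodJoint_of_ne_one hα hα1 h₁ h₂

end Additivity

/-! ### Joint convexity in the two factors -/

section Convexity

theorem ENNReal_geom_mean_le_arith_mean {a b : ℝ} (ha : 0 < a) (hb : 0 < b) (hab : a + b = 1)
    {x y : ENNReal} (hx : x ≠ ⊤) (hy : y ≠ ⊤) :
    x ^ a * y ^ b ≤ ENNReal.ofReal a * x + ENNReal.ofReal b * y := by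
  lift x to NNReal using hx
  lift y to NNReal using hy
  have h := NNReal.geom_mean_le_arith_mean2_weighted a.toNNReal b.toNNReal x y (by
    rw [← Real.toNNReal_add ha.le hb.le, hab, Real.toNNReal_one])
  rw [Real.coe_toNNReal _ ha.le, Real.coe_toNNReal _ hb.le] at h
  rw [← ENNReal.coe_rpow_of_nonneg _ ha.le, ← ENNReal.coe_rpow_of_nonneg _ hb.le]
  simp only [ENNReal.ofReal]
  exact_mod_cast h

theorem ofReal_convex_combination {a b x y : ℝ} (ha : 0 ≤ a) (hb : 0 ≤ b) (hx : 0 ≤ x)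
    (hy : 0 ≤ y) : ENNReal.ofReal (a * x + b * y)
      = ENNReal.ofReal a * ENNReal.ofReal x + ENNReal.ofReal b * ENNReal.ofReal y := by
  rw [ENNReal.ofReal_add (mul_nonneg ha hx) (mul_nonneg hb hy), ENNReal.ofReal_mul ha,
    ENNReal.ofReal_mul hb]

/-- Weighted AM–GM, reversed by the negative exponent. -/
theorem rpow_log_convex {a b r : ℝ} (ha : 0 < a) (hb : 0 < b) (hab : a + b = 1) (hr : r < 0)
    {x y : ℝ} (hx : 0 ≤ x) (hy : 0 ≤ y) :
    ENNReal.ofReal (a * x + b * y) ^ r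
      ≤ (ENNReal.ofReal x ^ r) ^ a * (ENNReal.ofReal y ^ r) ^ b := by
  have h := ENNReal_geom_mean_le_arith_mean ha hb hab (x := ENNReal.ofReal x)
    (y := ENNReal.ofReal y) ENNReal.ofReal_ne_top ENNReal.ofReal_ne_top
  rw [← ofReal_convex_combination ha.le hb.le hx hy] at h
  have h2 : ENNReal.ofReal (a * x + b * y) ^ r
      ≤ (ENNReal.ofReal x ^ a * ENNReal.ofReal y ^ b) ^ r := by
    rw [← neg_neg r, ENNReal.rpow_neg _ (-r), ENNReal.rpow_neg _ (-r)]
    exact ENNReal.inv_le_inv.2 (ENNReal.rpow_le_rpow h (by linarith))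
  rw [ENNReal.mul_rpow_of_ne_top (ENNReal.rpow_ne_top_of_nonneg ha.le ENNReal.ofReal_ne_top)
    (ENNReal.rpow_ne_top_of_nonneg hb.le ENNReal.ofReal_ne_top)] at h2
  rwa [← ENNReal.rpow_mul, ← ENNReal.rpow_mul, mul_comm a r, mul_comm b r, ENNReal.rpow_mul,
    ENNReal.rpow_mul] at h2

/-- Joint concavity of `(x, y) ↦ (x * y) ^ r` for `r ≤ 1 / 2`. -/
theorem mul_rpow_concave {a b r : ℝ} (ha : 0 ≤ a) (hb : 0 ≤ b) (hab : a + b = 1) (hr : 0 ≤ r)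
    (hr2 : r ≤ 1 / 2) {x₁ y₁ x₂ y₂ : ℝ} (hx₁ : 0 ≤ x₁) (hy₁ : 0 ≤ y₁) (hx₂ : 0 ≤ x₂)
    (hy₂ : 0 ≤ y₂) : a * (x₁ * y₁) ^ r + b * (x₂ * y₂) ^ r
      ≤ ((a * x₁ + b * x₂) * (a * y₁ + b * y₂)) ^ r := by
  -- The geometric mean `√(x y)` is jointly concave by Cauchy–Schwarz, and `t ↦ t^(2r)` is
  -- increasing and concave exactly because `0 ≤ 2r ≤ 1`.
  have hs : ∀ z : ℝ, 0 ≤ z → z ^ r = (√z) ^ (2 * r) := fun z hz => by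
    rw [Real.sqrt_eq_rpow, ← Real.rpow_mul hz]
    congr 1
    ring
  have h1 := (Real.concaveOn_rpow (p := 2 * r) (by linarith) (by linarith)).2
    (Real.sqrt_nonneg (x₁ * y₁)) (Real.sqrt_nonneg (x₂ * y₂)) ha hb hab
  simp only [smul_eq_mul] at h1
  have hX : 0 ≤ a * x₁ + b * x₂ := by positivity
  have hY : 0 ≤ a * y₁ + b * y₂ := by positivity
  rw [hs _ (mul_nonneg hx₁ hy₁), hs _ (mul_nonneg hx₂ hy₂), hs _ (mul_nonneg hX hY)]
  refine h1.trans (Real.rpow_le_rpow (by positivity) ?_ (by linarith))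
  refine Real.le_sqrt_of_sq_le ?_
  rw [Real.sqrt_mul hx₁, Real.sqrt_mul hx₂]
  have e1 := Real.sq_sqrt hx₁
  have e2 := Real.sq_sqrt hx₂
  have e3 := Real.sq_sqrt hy₁
  have e4 := Real.sq_sqrt hy₂
  have hsq := mul_nonneg (mul_nonneg ha hb) (sq_nonneg (√x₁ * √y₂ - √x₂ * √y₁))
  calc (a * (√x₁ * √y₁) + b * (√x₂ * √y₂)) ^ 2
      ≤ (a * (√x₁ * √y₁) + b * (√x₂ * √y₂)) ^ 2
        + a * b * (√x₁ * √y₂ - √x₂ * √y₁) ^ 2 := le_add_of_nonneg_right hsq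
    _ = (a * √x₁ ^ 2 + b * √x₂ ^ 2) * (a * √y₁ ^ 2 + b * √y₂ ^ 2) := by ring
    _ = (a * x₁ + b * x₂) * (a * y₁ + b * y₂) := by rw [e1, e2, e3, e4]

variable {𝒳 𝒴 : Type*} [Fintype 𝒳] [Fintype 𝒴]

/-- Each summand is log-convex in `(Q, T)` jointly, and Hölder's inequality passes this to the sum.
-/
theorem renyiSum_log_convex {α : ℝ} (hα : 1 < α) (P : 𝒳 × 𝒴 → ℝ) {Q₁ Q₂ : 𝒳 → ℝ} {T₁ T₂ : 𝒴 → ℝ}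
    (hQ₁ : ∀ x, 0 ≤ Q₁ x) (hQ₂ : ∀ x, 0 ≤ Q₂ x) (hT₁ : ∀ x, 0 ≤ T₁ x) (hT₂ : ∀ x, 0 ≤ T₂ x)
    {a b : ℝ} (ha : 0 < a) (hb : 0 < b) (hab : a + b = 1) :
    renyiSum α P (prodPmf (a • Q₁ + b • Q₂) (a • T₁ + b • T₂))
      ≤ renyiSum α P (prodPmf Q₁ T₁) ^ a * renyiSum α P (prodPmf Q₂ T₂) ^ b := by
  refine le_trans (Finset.sum_le_sum fun p _ => ?_) (sum_rpow_mul_rpow_le ha hb hab _ _)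
  simp only [prodPmf, Pi.add_apply, Pi.smul_apply, smul_eq_mul]
  have hr : 1 - α < 0 := by linarith
  have hX : 0 ≤ a * Q₁ p.1 + b * Q₂ p.1 :=
    add_nonneg (mul_nonneg ha.le (hQ₁ _)) (mul_nonneg hb.le (hQ₂ _))
  rw [ofReal_mul_rpow hX, ofReal_mul_rpow (hQ₁ _), ofReal_mul_rpow (hQ₂ _)]
  simp only [ENNReal.mul_rpow_of_nonneg _ _ ha.le, ENNReal.mul_rpow_of_nonneg _ _ hb.le]
  have hP : (ENNReal.ofReal (P p) ^ α) = (ENNReal.ofReal (P p) ^ α) ^ a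
      * (ENNReal.ofReal (P p) ^ α) ^ b := by
    rw [← ENNReal.rpow_add_of_nonneg _ _ ha.le hb.le, hab, ENNReal.rpow_one]
  have h1 := rpow_log_convex ha hb hab hr (hQ₁ p.1) (hQ₂ p.1)
  have h2 := rpow_log_convex ha hb hab hr (hT₁ p.2) (hT₂ p.2)
  conv_lhs => rw [hP]
  refine (mul_le_mul_right (mul_le_mul' h1 h2) _).trans_eq ?_
  ring

/-- The condition `α ≥ 1/2` makes `1 - α ≤ 1/2`, so the sum is jointly concave; AM–GM then weakens
this to log-concavity. -/
theorem le_renyiSum_convex_combination {α : ℝ} (hα : 1 / 2 ≤ α) (hα1 : α < 1) {P : 𝒳 × 𝒴 → ℝ}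
    (hP : ∀ p, 0 ≤ P p) {Q₁ Q₂ : 𝒳 → ℝ} {T₁ T₂ : 𝒴 → ℝ}
    (hQ₁ : ∀ x, 0 ≤ Q₁ x) (hQ₂ : ∀ x, 0 ≤ Q₂ x) (hT₁ : ∀ x, 0 ≤ T₁ x) (hT₂ : ∀ x, 0 ≤ T₂ x)
    {a b : ℝ} (ha : 0 < a) (hb : 0 < b) (hab : a + b = 1) :
    renyiSum α P (prodPmf Q₁ T₁) ^ a * renyiSum α P (prodPmf Q₂ T₂) ^ b
      ≤ renyiSum α P (prodPmf (a • Q₁ + b • Q₂) (a • T₁ + b • T₂)) := by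
  have hα0 : 0 < α := by linarith
  have h₁ : ∀ p, 0 ≤ prodPmf Q₁ T₁ p := fun p => mul_nonneg (hQ₁ _) (hT₁ _)
  have h₂ : ∀ p, 0 ≤ prodPmf Q₂ T₂ p := fun p => mul_nonneg (hQ₂ _) (hT₂ _)
  have hm : ∀ p, 0 ≤ prodPmf (a • Q₁ + b • Q₂) (a • T₁ + b • T₂) p := fun p =>
    mul_nonneg (add_nonneg (mul_nonneg ha.le (hQ₁ _)) (mul_nonneg hb.le (hQ₂ _)))
      (add_nonneg (mul_nonneg ha.le (hT₁ _)) (mul_nonneg hb.le (hT₂ _)))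
  rw [renyiSum_eq_ofReal hα0 hP h₁ (Or.inl hα1), renyiSum_eq_ofReal hα0 hP h₂ (Or.inl hα1),
    renyiSum_eq_ofReal hα0 hP hm (Or.inl hα1)]
  refine (ENNReal_geom_mean_le_arith_mean ha hb hab ENNReal.ofReal_ne_top
    ENNReal.ofReal_ne_top).trans ?_
  rw [← ofReal_convex_combination ha.le hb.le (Finset.sum_nonneg fun p _ => tilt_nonneg hP h₁ p)
    (Finset.sum_nonneg fun p _ => tilt_nonneg hP h₂ p), Finset.mul_sum, Finset.mul_sum,
    ← Finset.sum_add_distrib]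
  refine ENNReal.ofReal_le_ofReal (Finset.sum_le_sum fun p _ => ?_)
  have h := mul_le_mul_of_nonneg_left (mul_rpow_concave ha.le hb.le hab (r := 1 - α) (by linarith)
    (by linarith) (hQ₁ p.1) (hT₁ p.2) (hQ₂ p.1) (hT₂ p.2)) (Real.rpow_nonneg (hP p) α)
  simp only [tilt, prodPmf, Pi.add_apply, Pi.smul_apply, smul_eq_mul]
  linarith

/-- Joint convexity of the Rényi divergence to a product measure. -/
theorem renyiDiv_prodPmf_convex {α : ℝ} (hα : 1 / 2 ≤ α) (hα1 : α ≠ 1) {P : 𝒳 × 𝒴 → ℝ}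
    (hP : P ∈ stdSimplex ℝ (𝒳 × 𝒴)) {Q₁ Q₂ : 𝒳 → ℝ} {T₁ T₂ : 𝒴 → ℝ}
    (hQ₁ : Q₁ ∈ stdSimplex ℝ 𝒳) (hQ₂ : Q₂ ∈ stdSimplex ℝ 𝒳) (hT₁ : T₁ ∈ stdSimplex ℝ 𝒴)
    (hT₂ : T₂ ∈ stdSimplex ℝ 𝒴) {a b : ℝ} (ha : 0 < a) (hb : 0 < b) (hab : a + b = 1) :
    renyiDiv α P (prodPmf (a • Q₁ + b • Q₂) (a • T₁ + b • T₂))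
      ≤ (a : EReal) * renyiDiv α P (prodPmf Q₁ T₁) + (b : EReal) * renyiDiv α P (prodPmf Q₂ T₂) := by
  have hα0 : 0 < α := by linarith
  have n₁ := (renyiDiv_nonneg hα0 hP (prodPmf_mem hQ₁ hT₁)).1
  have n₂ := (renyiDiv_nonneg hα0 hP (prodPmf_mem hQ₂ hT₂)).1
  have ha' : (0 : EReal) ≤ a := by exact_mod_cast ha.le
  have hb' : (0 : EReal) ≤ b := by exact_mod_cast hb.le
  by_cases t₁ : renyiDiv α P (prodPmf Q₁ T₁) = ⊤
  · rw [t₁, EReal.coe_mul_top_of_pos ha, EReal.top_add_of_ne_bot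
      (ne_bot_of_le_ne_bot (by simp) (mul_nonneg hb' n₂))]
    exact le_top
  by_cases t₂ : renyiDiv α P (prodPmf Q₂ T₂) = ⊤
  · rw [t₂, EReal.coe_mul_top_of_pos hb, EReal.add_top_of_ne_bot
      (ne_bot_of_le_ne_bot (by simp) (mul_nonneg ha' n₁))]
    exact le_top
  have hc : (α - 1)⁻¹ ≠ 0 := inv_ne_zero (sub_ne_zero.2 hα1)
  have b₁ : renyiDiv α P (prodPmf Q₁ T₁) ≠ ⊥ := ne_bot_of_le_ne_bot (by simp) n₁
  have b₂ : renyiDiv α P (prodPmf Q₂ T₂) ≠ ⊥ := ne_bot_of_le_ne_bot (by simp) n₂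
  rw [renyiDiv_of_ne_one hα1] at t₁ t₂ b₁ b₂ ⊢
  rw [renyiDiv_of_ne_one hα1, renyiDiv_of_ne_one hα1]
  obtain ⟨u, hu⟩ := exists_coe_of_coe_mul hc b₁ t₁
  obtain ⟨v, hv⟩ := exists_coe_of_coe_mul hc b₂ t₂
  have e : (a : EReal) * ((((α - 1)⁻¹ : ℝ) : EReal) * ENNReal.log (renyiSum α P (prodPmf Q₁ T₁)))
      + (b : EReal) * ((((α - 1)⁻¹ : ℝ) : EReal) * ENNReal.log (renyiSum α P (prodPmf Q₂ T₂)))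
      = (((α - 1)⁻¹ : ℝ) : EReal) * ENNReal.log
        (renyiSum α P (prodPmf Q₁ T₁) ^ a * renyiSum α P (prodPmf Q₂ T₂) ^ b) := by
    rw [ENNReal.log_mul_add, ENNReal.log_rpow, ENNReal.log_rpow, hu, hv]
    norm_cast
    ring
  rw [e]
  rcases lt_or_gt_of_ne hα1 with h | h
  · exact mul_log_anti (inv_sub_one_neg h) (le_renyiSum_convex_combination hα h hP.1 hQ₁.1 hQ₂.1
      hT₁.1 hT₂.1 ha hb hab)
  · exact mul_log_mono (inv_nonneg.2 (by linarith)) (renyiSum_log_convex h P hQ₁.1 hQ₂.1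
      hT₁.1 hT₂.1 ha hb hab)

/-- Partial minimization of a jointly convex function is convex: mix the optimal second factors. -/
theorem eConvexOn_reducedObjective {α : ℝ} (hα : 1 / 2 ≤ α) (hα1 : α ≠ 1) {P : 𝒳 × 𝒴 → ℝ}
    (hP : P ∈ stdSimplex ℝ (𝒳 × 𝒴)) : EConvexOn (stdSimplex ℝ 𝒳) (reducedObjective α P) := by
  have hα0 : 0 < α := by linarith
  refine ⟨convex_stdSimplex ℝ _, fun Q₁ hQ₁ Q₂ hQ₂ a b ha hb hab => ?_⟩
  rcases ha.eq_or_lt with rfl | ha'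
  · have : b = 1 := by linarith
    subst this
    simp
  rcases hb.eq_or_lt with rfl | hb'
  · have : a = 1 := by linarith
    subst this
    simp
  obtain ⟨T₁, hT₁, e₁⟩ := (isLeast_reducedObjective hα0 hα1 hP hQ₁.1).1
  obtain ⟨T₂, hT₂, e₂⟩ := (isLeast_reducedObjective hα0 hα1 hP hQ₂.1).1
  rw [← e₁, ← e₂]
  refine le_trans ?_ (renyiDiv_prodPmf_convex hα hα1 hP hQ₁ hQ₂ hT₁ hT₂ ha' hb' hab)
  exact (isLeast_reducedObjective hα0 hα1 hP (convex_combination_mem hQ₁ hQ₂ ha hb hab).1).2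
    ⟨_, convex_combination_mem hT₁ hT₂ ha hb hab, rfl⟩

end Convexity

/-! ### Concavity in the input distribution -/

section Channel

variable {𝒳 𝒴 : Type*} [Fintype 𝒳] [Fintype 𝒴]

/-- The joint probability mass function of a channel with a given input distribution. -/
def channelJoint {𝒳 𝒴 : Type*} (W : 𝒳 → 𝒴 → ℝ) (Q : 𝒳 → ℝ) : 𝒳 × 𝒴 → ℝ :=
  fun p => Q p.1 * W p.1 p.2

theorem channelJoint_mem {W : 𝒳 → 𝒴 → ℝ} (hW : ∀ x, W x ∈ stdSimplex ℝ 𝒴) {Q : 𝒳 → ℝ}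
    (hQ : Q ∈ stdSimplex ℝ 𝒳) : channelJoint W Q ∈ stdSimplex ℝ (𝒳 × 𝒴) :=
  ⟨fun p => mul_nonneg (hQ.1 _) ((hW _).1 _), by
    rw [Fintype.sum_prod_type]
    simp [channelJoint, ← Finset.mul_sum, (hW _).2, hQ.2]⟩

/-- The expression `(∑ y, W(y|x) ^ α * T(y) ^ (1 - α)) ^ (1 / α)`. -/
noncomputable def channelWeight (α : ℝ) (W : 𝒳 → 𝒴 → ℝ) (T : 𝒴 → ℝ) : 𝒳 → ENNReal :=
  fun x => (∑ y, ENNReal.ofReal (W x y) ^ α * ENNReal.ofReal (T y) ^ (1 - α)) ^ (1 / α)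

omit [Fintype 𝒳] in
theorem sum_channelJoint_rpow {α : ℝ} (hα : 0 < α) (W : 𝒳 → 𝒴 → ℝ) {Q : 𝒳 → ℝ}
    (hQ : ∀ x, 0 ≤ Q x) (T : 𝒴 → ℝ) (x : 𝒳) :
    (∑ y, ENNReal.ofReal (channelJoint W Q (x, y)) ^ α * ENNReal.ofReal (T y) ^ (1 - α)) ^ (1 / α)
      = ENNReal.ofReal (Q x) * channelWeight α W T x := by
  simp only [channelJoint, ofReal_mul_rpow (hQ x), mul_assoc]
  rw [← Finset.mul_sum, ENNReal.mul_rpow_of_nonneg _ _ (by positivity), ← ENNReal.rpow_mul,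
    mul_one_div_cancel hα.ne', ENNReal.rpow_one, channelWeight]

/-- Minimizing out the input-side factor instead leaves an outer power `1/α`, which cancels the
power `α` on `Q`: inside the logarithm the objective is linear in `Q`. -/
theorem isLeast_renyiJ_channelJoint {α : ℝ} (hα : 0 < α) (hα1 : α ≠ 1) {W : 𝒳 → 𝒴 → ℝ}
    (hW : ∀ x, W x ∈ stdSimplex ℝ 𝒴) {Q : 𝒳 → ℝ} (hQ : Q ∈ stdSimplex ℝ 𝒳) :
    IsLeast ((fun T => ((α / (α - 1) : ℝ) : EReal) * ENNReal.log
      (∑ x, ENNReal.ofReal (Q x) * channelWeight α W T x)) '' stdSimplex ℝ 𝒴)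
      (renyiJ α (channelJoint W Q)) := by
  have h := isLeast_renyiJ_reducedObjective hα hα1 (comp_swap_mem (channelJoint_mem hW hQ))
  rw [renyiJ_swap] at h
  convert h using 2 with T
  rw [reducedObjective]
  congr 2
  exact Finset.sum_congr rfl fun x _ => (sum_channelJoint_rpow hα W hQ.1 T x).symm

/-- For fixed `T` the objective is a positive multiple of the logarithm of a linear function, hence
concave; the optimal `T` for the mixture is tested at both endpoints. -/
theorem renyiJ_channelJoint_concave_of_one_lt {α : ℝ} (hα : 1 < α) {W : 𝒳 → 𝒴 → ℝ}
    (hW : ∀ x, W x ∈ stdSimplex ℝ 𝒴) {Q₁ Q₂ : 𝒳 → ℝ} (hQ₁ : Q₁ ∈ stdSimplex ℝ 𝒳)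
    (hQ₂ : Q₂ ∈ stdSimplex ℝ 𝒳) {a b : ℝ} (ha : 0 < a) (hb : 0 < b) (hab : a + b = 1) :
    a * (renyiJ α (channelJoint W Q₁)).toReal + b * (renyiJ α (channelJoint W Q₂)).toReal
      ≤ (renyiJ α (channelJoint W (a • Q₁ + b • Q₂))).toReal := by
  have hα0 : 0 < α := by linarith
  have hm := convex_combination_mem hQ₁ hQ₂ ha.le hb.le hab
  have f₁ := coe_toReal_renyiJ hα0 (channelJoint_mem hW hQ₁)
  have f₂ := coe_toReal_renyiJ hα0 (channelJoint_mem hW hQ₂)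
  have fm := coe_toReal_renyiJ hα0 (channelJoint_mem hW hm)
  obtain ⟨T, hT, e⟩ := (isLeast_renyiJ_channelJoint hα0 hα.ne' hW hm).1
  have l₁ := (isLeast_renyiJ_channelJoint hα0 hα.ne' hW hQ₁).2 ⟨T, hT, rfl⟩
  have l₂ := (isLeast_renyiJ_channelJoint hα0 hα.ne' hW hQ₂).2 ⟨T, hT, rfl⟩
  simp only at e l₁ l₂
  rw [← fm] at e
  rw [← f₁] at l₁
  rw [← f₂] at l₂
  have hc : 0 < α / (α - 1) := div_pos hα0 (by linarith)
  set A := ∑ x, ENNReal.ofReal (Q₁ x) * channelWeight α W T x with hA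
  set B := ∑ x, ENNReal.ofReal (Q₂ x) * channelWeight α W T x with hB
  have hmix : ∑ x, ENNReal.ofReal ((a • Q₁ + b • Q₂) x) * channelWeight α W T x
      = ENNReal.ofReal a * A + ENNReal.ofReal b * B := by
    rw [hA, hB, Finset.mul_sum, Finset.mul_sum, ← Finset.sum_add_distrib]
    refine Finset.sum_congr rfl fun x _ => ?_
    simp only [Pi.add_apply, Pi.smul_apply, smul_eq_mul]
    rw [ofReal_convex_combination ha.le hb.le (hQ₁.1 x) (hQ₂.1 x)]
    ring
  rw [hmix] at e
  have hmt : ENNReal.ofReal a * A + ENNReal.ofReal b * B ≠ ⊤ := by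
    intro h
    rw [h, ENNReal.log_top, EReal.coe_mul_top_of_pos hc] at e
    exact EReal.coe_ne_top _ e.symm
  have hAt : A ≠ ⊤ := by
    rintro h
    exact hmt (by rw [h, ENNReal.mul_top (by simpa using ha), top_add])
  have hBt : B ≠ ⊤ := by
    rintro h
    exact hmt (by rw [h, ENNReal.mul_top (by simpa using hb), add_top])
  have hA0 : A ≠ 0 := by
    intro h
    rw [h, ENNReal.log_zero, EReal.coe_mul_bot_of_pos hc] at l₁
    exact EReal.coe_ne_bot _ (le_bot_iff.1 l₁)
  have hB0 : B ≠ 0 := by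
    intro h
    rw [h, ENNReal.log_zero, EReal.coe_mul_bot_of_pos hc] at l₂
    exact EReal.coe_ne_bot _ (le_bot_iff.1 l₂)
  have h := mul_log_mono hc.le (ENNReal_geom_mean_le_arith_mean ha hb hab hAt hBt)
  rw [e, ENNReal.log_mul_add, ENNReal.log_rpow, ENNReal.log_rpow, ENNReal.log_pos_real hA0 hAt,
    ENNReal.log_pos_real hB0 hBt] at h
  rw [ENNReal.log_pos_real hA0 hAt] at l₁
  rw [ENNReal.log_pos_real hB0 hBt] at l₂
  norm_cast at h l₁ l₂
  have h1 := mul_le_mul_of_nonneg_left l₁ ha.le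
  have h2 := mul_le_mul_of_nonneg_left l₂ hb.le
  linarith

theorem eConcaveOn_renyiJ_channelJoint {α : ℝ} (hα : 1 ≤ α) {W : 𝒳 → 𝒴 → ℝ}
    (hW : ∀ x, W x ∈ stdSimplex ℝ 𝒴) :
    EConcaveOn (stdSimplex ℝ 𝒳) fun Q => renyiJ α (channelJoint W Q) := by
  have hα0 : 0 < α := by linarith
  refine ⟨convex_stdSimplex ℝ _, fun Q₁ hQ₁ Q₂ hQ₂ a b ha hb hab => ?_⟩
  rcases ha.eq_or_lt with rfl | ha'
  · have : b = 1 := by linarith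
    subst this
    simp
  rcases hb.eq_or_lt with rfl | hb'
  · have : a = 1 := by linarith
    subst this
    simp
  have m₁ := channelJoint_mem hW hQ₁
  have m₂ := channelJoint_mem hW hQ₂
  have mm := channelJoint_mem hW (convex_combination_mem hQ₁ hQ₂ ha hb hab)
  simp only
  rw [← coe_toReal_renyiJ hα0 m₁, ← coe_toReal_renyiJ hα0 m₂, ← coe_toReal_renyiJ hα0 mm]
  norm_cast
  rcases hα.eq_or_lt with rfl | h1
  · refine le_of_tendsto_of_tendsto (((tendsto_toReal_renyiJ_one m₁).const_mul a).add
      ((tendsto_toReal_renyiJ_one m₂).const_mul b)) (tendsto_toReal_renyiJ_one mm) ?_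
    filter_upwards [self_mem_nhdsWithin] with α hα'
    exact renyiJ_channelJoint_concave_of_one_lt hα' hW hQ₁ hQ₂ ha' hb' hab
  · exact renyiJ_channelJoint_concave_of_one_lt h1 hW hQ₁ hQ₂ ha' hb' hab

end Channel

/-! ### Self-information -/

section Diagonal

variable {𝒳 : Type*} [Fintype 𝒳]

open Classical in
/-- The joint probability mass function of a random variable with itself. -/
noncomputable def diagJoint {𝒳 : Type*} (p : 𝒳 → ℝ) : 𝒳 × 𝒳 → ℝ :=
  fun q => if q.1 = q.2 then p q.1 else 0

theorem margFst_diagJoint (p : 𝒳 → ℝ) : margFst (diagJoint p) = p := by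
  classical
  funext x
  simp [margFst, diagJoint]

theorem margSnd_diagJoint (p : 𝒳 → ℝ) : margSnd (diagJoint p) = p := by
  classical
  funext x
  simp [margSnd, diagJoint]

theorem diagJoint_mem {p : 𝒳 → ℝ} (hp : p ∈ stdSimplex ℝ 𝒳) :
    diagJoint p ∈ stdSimplex ℝ (𝒳 × 𝒳) :=
  ⟨fun q => by simp only [diagJoint]; split_ifs; exacts [hp.1 _, le_rfl], by
    rw [Fintype.sum_prod_type]
    change ∑ x, margFst (diagJoint p) x = 1
    rw [margFst_diagJoint, hp.2]⟩

theorem reducedObjective_diagJoint {α : ℝ} (hα : 0 < α) (p Q : 𝒳 → ℝ) :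
    reducedObjective α (diagJoint p) Q = ((α / (α - 1) : ℝ) : EReal) *
      ENNReal.log (∑ x, ENNReal.ofReal (p x) * ENNReal.ofReal (Q x) ^ ((1 - α) / α)) := by
  classical
  rw [reducedObjective]
  congr 2
  refine Finset.sum_congr rfl fun y _ => ?_
  rw [Finset.sum_eq_single y]
  · simp only [diagJoint, if_true]
    rw [ENNReal.mul_rpow_of_nonneg _ _ (by positivity), ← ENNReal.rpow_mul, ← ENNReal.rpow_mul,
      mul_one_div_cancel hα.ne', ENNReal.rpow_one, mul_one_div]
  · intro x _ hx
    simp [diagJoint, hx, hα]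
  · simp

/-- With `β = (2α-1)/α > 0`, one has `(1-α)/α = 1 - β` and `α/(α-1) = 1/(β-1)`, so the reduced
objective is Sibson's functional of order `β` with weights `p`. Its minimum `β/(β-1) log ∑ p^(1/β)`
is the Rényi entropy of order `1/β`. -/
theorem renyiJ_diagJoint_of_half_lt {α : ℝ} (hα : 1 / 2 < α) {p : 𝒳 → ℝ}
    (hp : p ∈ stdSimplex ℝ 𝒳) :
    renyiJ α (diagJoint p) = ((renyiEntropy (α / (2 * α - 1)) p : ℝ) : EReal) := by
  have hα0 : 0 < α := by linarith
  by_cases hα1 : α = 1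
  · subst hα1
    rw [renyiJ_one (diagJoint_mem hp), EReal.coe_eq_coe_iff, renyiEntropy, if_pos (by norm_num),
      miReal, klReal, margFst_diagJoint, margSnd_diagJoint, Fintype.sum_prod_type]
    classical
    refine Finset.sum_congr rfl fun x _ => ?_
    rw [Finset.sum_eq_single x]
    · simp only [diagJoint, prodPmf, if_true]
      by_cases h : p x = 0
      · simp [h]
      · congr 2
        field_simp
    · intro y _ hy
      simp [diagJoint, hy.symm]
    · simp
  · set β := (2 * α - 1) / α with hβ
    have hβ0 : 0 < β := div_pos (by linarith) hα0
    have hne : α - 1 ≠ 0 := sub_ne_zero.2 hα1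
    have hβ' : β - 1 = (α - 1) / α := by rw [hβ]; field_simp; ring
    have hβ1 : β ≠ 1 := sub_ne_zero.1 (hβ' ▸ div_ne_zero hne hα0.ne')
    have e1 : (β - 1)⁻¹ = α / (α - 1) := by rw [hβ', inv_div]
    have e2 : 1 - β = (1 - α) / α := by rw [← neg_sub, hβ', ← neg_div, neg_sub]
    obtain ⟨x₀, hx₀⟩ := simplex_exists_pos hp
    have : Nonempty 𝒳 := ⟨x₀⟩
    have h1 := isLeast_mul_log_sum hβ0 hβ1 (A := fun x => ENNReal.ofReal (p x))
      fun _ _ => ENNReal.ofReal_ne_top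
    have h2 := isLeast_renyiJ_reducedObjective hα0 hα1 (diagJoint_mem hp)
    have e3 : reducedObjective α (diagJoint p) = fun T : 𝒳 → ℝ => (((β - 1)⁻¹ : ℝ) : EReal)
        * ENNReal.log (∑ x, ENNReal.ofReal (p x) * ENNReal.ofReal (T x) ^ (1 - β)) := by
      funext T
      rw [reducedObjective_diagJoint hα0, e1, e2]
    rw [e3] at h2
    rw [h2.unique h1]
    have hγ : α / (2 * α - 1) = 1 / β := by rw [hβ, one_div_div]
    have hγ1 : 1 / β ≠ 1 := by
      rw [Ne, div_eq_one_iff_eq hβ0.ne']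
      exact hβ1.symm
    have hsum : ∑ x, ENNReal.ofReal (p x) ^ (1 / β) = ENNReal.ofReal (∑ x, p x ^ (1 / β)) := by
      rw [ENNReal.ofReal_sum_of_nonneg fun x _ => Real.rpow_nonneg (hp.1 x) _]
      exact Finset.sum_congr rfl fun x _ =>
        ENNReal.ofReal_rpow_of_nonneg (hp.1 x) (by positivity)
    have hpos : 0 < ∑ x, p x ^ (1 / β) :=
      Finset.sum_pos' (fun x _ => Real.rpow_nonneg (hp.1 x) _)
        ⟨x₀, Finset.mem_univ _, Real.rpow_pos_of_pos hx₀ _⟩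
    rw [hsum, ENNReal.log_ofReal_of_pos hpos, ← EReal.coe_mul, EReal.coe_eq_coe_iff, renyiEntropy,
      hγ, if_neg hγ1]
    congr 1
    have hβ2 : β - 1 ≠ 0 := sub_ne_zero.2 hβ1
    rw [one_sub_div hβ0.ne', one_div_div]

/-- Now `(1-α)/α ≥ 1`, so `Q^((1-α)/α) ≤ Q` and the sum is at most `max p`, attained at a point mass
on a mode. -/
theorem renyiJ_diagJoint_of_le_half {α : ℝ} (hα0 : 0 < α) (hα : α ≤ 1 / 2) {p : 𝒳 → ℝ}
    (hp : p ∈ stdSimplex ℝ 𝒳) :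
    renyiJ α (diagJoint p) = ((α / (1 - α) * minEntropy p : ℝ) : EReal) := by
  classical
  obtain ⟨x₁, hx₁⟩ := simplex_exists_pos hp
  have : Nonempty 𝒳 := ⟨x₁⟩
  obtain ⟨x₀, hx₀⟩ := Finite.exists_max p
  have hpos : 0 < p x₀ := hx₁.trans_le (hx₀ x₁)
  have hsup : ⨆ x, p x = p x₀ :=
    le_antisymm (ciSup_le hx₀) (le_ciSup (Set.finite_range p).bddAbove x₀)
  have hα1 : α < 1 := by linarith
  have hc : α / (α - 1) ≤ 0 := div_nonpos_of_nonneg_of_nonpos hα0.le (by linarith)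
  have hval : ((α / (1 - α) * minEntropy p : ℝ) : EReal)
      = ((α / (α - 1) : ℝ) : EReal) * ENNReal.log (ENNReal.ofReal (p x₀)) := by
    rw [ENNReal.log_ofReal_of_pos hpos, ← EReal.coe_mul, minEntropy, hsup]
    congr 1
    rw [← neg_sub α 1, div_neg]
    ring
  have hγ : 1 ≤ (1 - α) / α := by
    rw [le_div_iff₀ hα0]
    linarith
  have h := isLeast_renyiJ_reducedObjective hα0 hα1.ne (diagJoint_mem hp)
  rw [hval]
  refine le_antisymm ?_ ?_
  · refine (h.2 ⟨Pi.single x₀ 1, single_mem_stdSimplex ℝ x₀, rfl⟩).trans ?_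
    rw [reducedObjective_diagJoint hα0]
    refine mul_log_anti hc ?_
    refine le_trans ?_ (Finset.single_le_sum (f := fun x => ENNReal.ofReal (p x) *
      ENNReal.ofReal ((Pi.single x₀ 1 : 𝒳 → ℝ) x) ^ ((1 - α) / α)) (fun _ _ => zero_le)
      (Finset.mem_univ x₀))
    simp
  · obtain ⟨Q, hQ, e⟩ := h.1
    rw [← e, reducedObjective_diagJoint hα0]
    refine mul_log_anti hc ?_
    have hsum : ∑ x, ENNReal.ofReal (p x₀) * ENNReal.ofReal (Q x) = ENNReal.ofReal (p x₀) := by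
      rw [← Finset.mul_sum, ← ENNReal.ofReal_sum_of_nonneg fun x _ => hQ.1 x, hQ.2]
      simp
    rw [← hsum]
    refine Finset.sum_le_sum fun x _ => mul_le_mul' (ENNReal.ofReal_le_ofReal (hx₀ x)) ?_
    refine (ENNReal.rpow_le_rpow_of_exponent_ge ?_ hγ).trans_eq (ENNReal.rpow_one _)
    exact ENNReal.ofReal_le_one.2 (simplex_le_one hQ x)

end Diagonal

/-! ### From random variables to probability mass functions -/

section RandomVariables

variable {Ω 𝒳 𝒴 𝒵 : Type*} [MeasurableSpace Ω] {μ : Measure Ω}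

theorem pmf_eq_map [MeasurableSpace 𝒳] [MeasurableSingletonClass 𝒳] {X : Ω → 𝒳}
    (hX : Measurable X) (x : 𝒳) : pmf μ X x = (μ.map X).real {x} := by
  rw [map_measureReal_apply hX (measurableSet_singleton x), pmf]

theorem pmf_mem [Fintype 𝒳] [MeasurableSpace 𝒳] [MeasurableSingletonClass 𝒳]
    [IsProbabilityMeasure μ] {X : Ω → 𝒳} (hX : Measurable X) : pmf μ X ∈ stdSimplex ℝ 𝒳 := by
  have := Measure.isProbabilityMeasure_map (μ := μ) hX.aemeasurable
  refine ⟨fun x => measureReal_nonneg, ?_⟩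
  simp only [pmf_eq_map hX]
  rw [sum_measureReal_singleton]
  simp

theorem jointPmf_mem [Fintype 𝒳] [MeasurableSpace 𝒳] [MeasurableSingletonClass 𝒳] [Fintype 𝒴]
    [MeasurableSpace 𝒴] [MeasurableSingletonClass 𝒴] [IsProbabilityMeasure μ] {X : Ω → 𝒳}
    {Y : Ω → 𝒴} (hX : Measurable X) (hY : Measurable Y) :
    jointPmf μ X Y ∈ stdSimplex ℝ (𝒳 × 𝒴) :=
  pmf_mem (hX.prodMk hY)

theorem pmf_eq_sum [Fintype 𝒴] [MeasurableSpace 𝒳] [MeasurableSingletonClass 𝒳]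
    [MeasurableSpace 𝒴] [MeasurableSingletonClass 𝒴] [IsFiniteMeasure μ] {X : Ω → 𝒳}
    {Y : Ω → 𝒴} (hX : Measurable X) (hY : Measurable Y) (x : 𝒳) :
    pmf μ X x = ∑ y, jointPmf μ X Y (x, y) := by
  have h : X ⁻¹' {x} = ⋃ y ∈ (Finset.univ : Finset 𝒴), (fun ω => (X ω, Y ω)) ⁻¹' {(x, y)} := by
    ext ω
    simp
  rw [pmf, h, measureReal_biUnion_finset]
  · rfl
  · intro y _ y' _ hne
    refine Set.disjoint_left.2 fun ω h h' => hne ?_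
    simp only [Set.mem_preimage, Set.mem_singleton_iff, Prod.mk.injEq] at h h'
    exact h.2.symm.trans h'.2
  · intro y _
    exact (hX.prodMk hY) (measurableSet_singleton _)

theorem jointPmf_swap (X : Ω → 𝒳) (Y : Ω → 𝒴) :
    jointPmf μ Y X = jointPmf μ X Y ∘ Prod.swap := by
  funext p
  simp only [jointPmf, pmf, Function.comp]
  congr 1
  ext ω
  simp [Prod.ext_iff, and_comm]

theorem margFst_jointPmf [Fintype 𝒴] [MeasurableSpace 𝒳] [MeasurableSingletonClass 𝒳]
    [MeasurableSpace 𝒴] [MeasurableSingletonClass 𝒴] [IsFiniteMeasure μ] {X : Ω → 𝒳}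
    {Y : Ω → 𝒴} (hX : Measurable X) (hY : Measurable Y) :
    margFst (jointPmf μ X Y) = pmf μ X :=
  funext fun x => (pmf_eq_sum hX hY x).symm

theorem margSnd_jointPmf [Fintype 𝒳] [MeasurableSpace 𝒳] [MeasurableSingletonClass 𝒳]
    [MeasurableSpace 𝒴] [MeasurableSingletonClass 𝒴] [IsFiniteMeasure μ] {X : Ω → 𝒳}
    {Y : Ω → 𝒴} (hX : Measurable X) (hY : Measurable Y) :
    margSnd (jointPmf μ X Y) = pmf μ Y := by
  rw [← margFst_jointPmf hY hX, jointPmf_swap X Y]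
  rfl

theorem indepFun_iff_jointPmf [Fintype 𝒳] [MeasurableSpace 𝒳] [MeasurableSingletonClass 𝒳]
    [Fintype 𝒴] [MeasurableSpace 𝒴] [MeasurableSingletonClass 𝒴] [IsProbabilityMeasure μ]
    {X : Ω → 𝒳} {Y : Ω → 𝒴} (hX : Measurable X) (hY : Measurable Y) :
    IndepFun X Y μ ↔ jointPmf μ X Y = prodPmf (pmf μ X) (pmf μ Y) := by
  have := Measure.isProbabilityMeasure_map (μ := μ) hX.aemeasurable
  have := Measure.isProbabilityMeasure_map (μ := μ) hY.aemeasurable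
  have := Measure.isProbabilityMeasure_map (μ := μ) (hX.prodMk hY).aemeasurable
  rw [indepFun_iff_map_prod_eq_prod_map_map hX.aemeasurable hY.aemeasurable,
    ext_iff_measureReal_singleton, funext_iff]
  refine forall_congr' fun p => ?_
  rw [jointPmf, pmf_eq_map (hX.prodMk hY), prodPmf, pmf_eq_map hX, pmf_eq_map hY,
    ← measureReal_prod_prod, Set.singleton_prod_singleton]

theorem exists_kernel_of_isMarkovChain [Fintype 𝒳] [MeasurableSpace 𝒳]
    [MeasurableSingletonClass 𝒳] [Fintype 𝒴] [MeasurableSpace 𝒴] [MeasurableSingletonClass 𝒴]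
    [Fintype 𝒵] [MeasurableSpace 𝒵] [MeasurableSingletonClass 𝒵] [IsProbabilityMeasure μ]
    {X : Ω → 𝒳} {Y : Ω → 𝒴} {Z : Ω → 𝒵} (hX : Measurable X) (hY : Measurable Y)
    (hZ : Measurable Z) (h : IsMarkovChain μ X Y Z) :
    ∃ V : 𝒴 → 𝒵 → ℝ, (∀ y, V y ∈ stdSimplex ℝ 𝒵) ∧
      jointPmf μ X Z = fun p => ∑ y, jointPmf μ X Y (p.1, y) * V y p.2 := by
  classical
  -- The kernel is the conditional law of `Z` given `Y`; at null values of `Y` the law of `Z` is a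
  -- harmless default, since the joint masses there vanish.
  refine ⟨fun y => if pmf μ Y y = 0 then pmf μ Z else
    fun z => jointPmf μ Y Z (y, z) / pmf μ Y y, fun y => ?_, ?_⟩
  · beta_reduce
    split_ifs with h0
    · exact pmf_mem hZ
    · refine ⟨fun z => div_nonneg measureReal_nonneg measureReal_nonneg, ?_⟩
      rw [← Finset.sum_div, ← pmf_eq_sum hY hZ, div_self h0]
  · funext p
    have e : jointPmf μ X Z p = ∑ y, pmf μ (fun ω => (X ω, Y ω, Z ω)) (p.1, y, p.2) := by
      rw [jointPmf, pmf_eq_sum (hX.prodMk hZ) hY]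
      refine Finset.sum_congr rfl fun y _ => ?_
      simp only [jointPmf, pmf]
      congr 1
      ext ω
      simp only [Set.mem_preimage, Set.mem_singleton_iff, Prod.ext_iff]
      tauto
    rw [e]
    refine Finset.sum_congr rfl fun y _ => ?_
    by_cases h0 : pmf μ Y y = 0
    · have h1 : pmf μ (fun ω => (X ω, Y ω, Z ω)) (p.1, y, p.2) ≤ pmf μ Y y :=
        measureReal_mono fun ω hω => by
          simp only [Set.mem_preimage, Set.mem_singleton_iff, Prod.mk.injEq] at hω ⊢
          exact hω.2.1
      have h2 : jointPmf μ X Y (p.1, y) ≤ pmf μ Y y :=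
        measureReal_mono fun ω hω => by
          simp only [Set.mem_preimage, Set.mem_singleton_iff, Prod.mk.injEq] at hω ⊢
          exact hω.2
      rw [h0] at h1 h2
      rw [le_antisymm h1 measureReal_nonneg, le_antisymm h2 measureReal_nonneg, zero_mul]
    · beta_reduce
      rw [if_neg h0, ← mul_div_assoc, ← h p.1 y p.2, mul_div_cancel_right₀ _ h0]

theorem jointPmf_self (X : Ω → 𝒳) : jointPmf μ X X = diagJoint (pmf μ X) := by
  classical
  funext p
  obtain ⟨x, y⟩ := p
  by_cases h : x = y
  · subst h
    simp only [jointPmf, diagJoint, pmf, if_true]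
    congr 1
    ext ω
    simp
  · have : (fun ω => (X ω, X ω)) ⁻¹' {(x, y)} = ∅ := by
      ext ω
      simp only [Set.mem_preimage, Set.mem_singleton_iff, Prod.mk.injEq, Set.mem_empty_iff_false,
        iff_false]
      rintro ⟨rfl, rfl⟩
      exact h rfl
    simp [jointPmf, pmf, diagJoint, h, this]

theorem jointPmf_prodMk_of_indepFun {𝒳₁ 𝒳₂ 𝒴₁ 𝒴₂ : Type*}
    [Fintype 𝒳₁] [MeasurableSpace 𝒳₁] [MeasurableSingletonClass 𝒳₁]
    [Fintype 𝒳₂] [MeasurableSpace 𝒳₂] [MeasurableSingletonClass 𝒳₂]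
    [Fintype 𝒴₁] [MeasurableSpace 𝒴₁] [MeasurableSingletonClass 𝒴₁]
    [Fintype 𝒴₂] [MeasurableSpace 𝒴₂] [MeasurableSingletonClass 𝒴₂]
    [IsProbabilityMeasure μ] {X₁ : Ω → 𝒳₁} {X₂ : Ω → 𝒳₂} {Y₁ : Ω → 𝒴₁} {Y₂ : Ω → 𝒴₂}
    (hX₁ : Measurable X₁) (hX₂ : Measurable X₂) (hY₁ : Measurable Y₁) (hY₂ : Measurable Y₂)
    (h : IndepFun (fun ω => (X₁ ω, Y₁ ω)) (fun ω => (X₂ ω, Y₂ ω)) μ) :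
    jointPmf μ (fun ω => (X₁ ω, X₂ ω)) (fun ω => (Y₁ ω, Y₂ ω))
      = prodJoint (jointPmf μ X₁ Y₁) (jointPmf μ X₂ Y₂) := by
  rw [indepFun_iff_jointPmf (hX₁.prodMk hY₁) (hX₂.prodMk hY₂)] at h
  funext p
  have h1 := congrFun h ((p.1.1, p.2.1), (p.1.2, p.2.2))
  rw [prodJoint, jointPmf, jointPmf]
  refine Eq.trans ?_ h1
  simp only [jointPmf, pmf]
  congr 1
  ext ω
  simp only [Set.mem_preimage, Set.mem_singleton_iff, Prod.ext_iff]
  tauto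

end RandomVariables

end RenyiDep

/-! ### The theorem for random variables -/

theorem theorem1
    {Ω 𝒳 𝒳₁ 𝒳₂ 𝒴 𝒴₁ 𝒴₂ 𝒵 : Type*} [MeasurableSpace Ω]
    [Fintype 𝒳] [MeasurableSpace 𝒳] [MeasurableSingletonClass 𝒳]
    [Fintype 𝒳₁] [MeasurableSpace 𝒳₁] [MeasurableSingletonClass 𝒳₁]
    [Fintype 𝒳₂] [MeasurableSpace 𝒳₂] [MeasurableSingletonClass 𝒳₂]
    [Fintype 𝒴] [MeasurableSpace 𝒴] [MeasurableSingletonClass 𝒴]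
    [Fintype 𝒴₁] [MeasurableSpace 𝒴₁] [MeasurableSingletonClass 𝒴₁]
    [Fintype 𝒴₂] [MeasurableSpace 𝒴₂] [MeasurableSingletonClass 𝒴₂]
    [Fintype 𝒵] [MeasurableSpace 𝒵] [MeasurableSingletonClass 𝒵]
    (μ : Measure Ω) [IsProbabilityMeasure μ]
    (X : Ω → 𝒳) (hX : Measurable X) (X₁ : Ω → 𝒳₁) (hX₁ : Measurable X₁)
    (X₂ : Ω → 𝒳₂) (hX₂ : Measurable X₂) (Y : Ω → 𝒴) (hY : Measurable Y)
    (Y₁ : Ω → 𝒴₁) (hY₁ : Measurable Y₁) (Y₂ : Ω → 𝒴₂) (hY₂ : Measurable Y₂)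
    (Z : Ω → 𝒵) (hZ : Measurable Z) :
    -- the minimum in the definition of `J_α(X;Y)` is attained
    (∀ α : ℝ, 0 < α → ∃ QX ∈ stdSimplex ℝ 𝒳, ∃ QY ∈ stdSimplex ℝ 𝒴,
      renyiJRV μ α X Y = renyiDiv α (jointPmf μ X Y) (prodPmf QX QY)) ∧
    -- nonnegativity
    (∀ α : ℝ, 0 < α → 0 ≤ renyiJRV μ α X Y ∧ (renyiJRV μ α X Y = 0 ↔ IndepFun X Y μ)) ∧
    -- symmetry
    (∀ α : ℝ, 0 < α → renyiJRV μ α X Y = renyiJRV μ α Y X) ∧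
    -- data-processing inequality
    (∀ α : ℝ, 0 < α → IsMarkovChain μ X Y Z → renyiJRV μ α X Z ≤ renyiJRV μ α X Y) ∧
    -- additivity
    (∀ α : ℝ, 0 < α → IndepFun (fun ω => (X₁ ω, Y₁ ω)) (fun ω => (X₂ ω, Y₂ ω)) μ →
      renyiJRV μ α (fun ω => (X₁ ω, X₂ ω)) (fun ω => (Y₁ ω, Y₂ ω))
        = renyiJRV μ α X₁ Y₁ + renyiJRV μ α X₂ Y₂) ∧
    -- upper bounds
    (∀ α : ℝ, 0 < α →
      renyiJRV μ α X Y ≤ ((Real.log (Fintype.card 𝒳) : ℝ) : EReal) ∧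
      renyiJRV μ α X Y ≤ ((Real.log (Fintype.card 𝒴) : ℝ) : EReal)) ∧
    -- order one
    (renyiJRV μ 1 X Y = mutualInfo (jointPmf μ X Y)) ∧
    -- continuity and monotonicity in the order
    (ContinuousOn (fun α : ℝ => renyiJRV μ α X Y) (Set.Ioi 0) ∧
      MonotoneOn (fun α : ℝ => renyiJRV μ α X Y) (Set.Ioi 0)) ∧
    -- minimization over `Q_X` alone
    (∀ α : ℝ, 0 < α → α ≠ 1 →
      IsLeast (reducedObjective α (jointPmf μ X Y) '' stdSimplex ℝ 𝒳) (renyiJRV μ α X Y) ∧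
      (1 / 2 ≤ α → EConvexOn (stdSimplex ℝ 𝒳) (reducedObjective α (jointPmf μ X Y)))) ∧
    -- variational formula for orders below one
    (∀ α : ℝ, 0 < α → α < 1 →
      IsLeast (dualObjective α (jointPmf μ X Y) '' stdSimplex ℝ (𝒳 × 𝒴)) (renyiJRV μ α X Y)) ∧
    -- variational formula for orders above one
    (∀ α : ℝ, 1 < α →
      IsGreatest (dualObjective α (jointPmf μ X Y) '' stdSimplex ℝ (𝒳 × 𝒴)) (renyiJRV μ α X Y) ∧
      EStrictConcaveOn (stdSimplex ℝ (𝒳 × 𝒴)) (dualObjective α (jointPmf μ X Y)) ∧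
      ∀ R ∈ stdSimplex ℝ (𝒳 × 𝒴),
        IsMaxOn (dualObjective α (jointPmf μ X Y)) (stdSimplex ℝ (𝒳 × 𝒴)) R ↔
          dualObjective α (jointPmf μ X Y) R
            = renyiDiv α (jointPmf μ X Y) (prodPmf (margFst R) (margSnd R))) ∧
    -- concavity in `P_X` for a fixed conditional probability mass function `W = P_{Y|X}`
    (∀ α : ℝ, 1 ≤ α → ∀ W : 𝒳 → 𝒴 → ℝ, (∀ x, W x ∈ stdSimplex ℝ 𝒴) →
      EConcaveOn (stdSimplex ℝ 𝒳) (fun PX => renyiJ α (fun p => PX p.1 * W p.1 p.2))) ∧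
    -- self-information
    (∀ α : ℝ, (1 / 2 < α →
        renyiJRV μ α X X = ((renyiEntropy (α / (2 * α - 1)) (pmf μ X) : ℝ) : EReal)) ∧
      (0 < α → α ≤ 1 / 2 →
        renyiJRV μ α X X = ((α / (1 - α) * minEntropy (pmf μ X) : ℝ) : EReal))) := by
  have hP := jointPmf_mem (μ := μ) hX hY
  refine ⟨fun α hα => exists_renyiJ_eq hα hP, fun α hα => ⟨renyiJ_nonneg hα hP, ?_⟩,
    fun α hα => ?_, fun α hα hM => ?_, fun α hα hI => ?_,
    fun α hα => ⟨renyiJ_le_log_card hα hP, renyiJ_le_log_card_right hα hP⟩, ?_,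
    ⟨continuousOn_renyiJ hP, monotoneOn_renyiJ hP⟩,
    fun α hα hα1 => ⟨isLeast_renyiJ_reducedObjective hα hα1 hP,
      fun h => eConvexOn_reducedObjective h hα1 hP⟩,
    fun α hα hα1 => isLeast_dualObjective hα hα1 hP,
    fun α hα => ⟨isGreatest_dualObjective hα hP, eStrictConcaveOn_dualObjective hα hP,
      fun R hR => isMaxOn_dualObjective_iff hα hP hR⟩,
    fun α hα W hW => eConcaveOn_renyiJ_channelJoint hα hW,
    fun α => ⟨fun hα => ?_, fun hα0 hα => ?_⟩⟩
  · rw [renyiJRV, renyiJ_eq_zero_iff hα hP, margFst_jointPmf hX hY, margSnd_jointPmf hX hY,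
      indepFun_iff_jointPmf hX hY]
  · rw [renyiJRV, renyiJRV, jointPmf_swap X Y, renyiJ_swap]
  · obtain ⟨V, hV, e⟩ := exists_kernel_of_isMarkovChain hX hY hZ hM
    have hXZ := jointPmf_mem (μ := μ) hX hZ
    rw [e] at hXZ
    rw [renyiJRV, renyiJRV, e]
    exact renyiJ_kernel_le hα hP hV hXZ
  · rw [renyiJRV, jointPmf_prodMk_of_indepFun hX₁ hX₂ hY₁ hY₂ hI]
    exact renyiJ_prodJoint hα (jointPmf_mem hX₁ hY₁) (jointPmf_mem hX₂ hY₂)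
  · rw [renyiJRV, renyiJ_one hP, mutualInfo_eq_coe hP]
  · rw [renyiJRV, jointPmf_self]
    exact renyiJ_diagJoint_of_half_lt hα (pmf_mem hX)
  · rw [renyiJRV, jointPmf_self]
    exact renyiJ_diagJoint_of_le_half hα0 hα (pmf_mem hX)
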